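/- Let $k\ge 1$ and let $\pi:E\to\mathbb R$ be a smooth bundle, $\dim E=n+1$, with canonical coordinate $t$ on $\mathbb R$ (it is enough that $\pi$ is a submersion, jets being taken of local sections). Let $J^m\pi$ be the $m$th order jet bundle, with projections $\pi^m_r:J^m\pi\to J^r\pi$ and $\bar\pi^m:J^m\pi\to\mathbb R$; a chart $(t,q^A)$ of $E$ adapted to $\pi$ induces coordinates $(t,q_0^A,\dots,q_m^A)$ on $J^m\pi$, coordinates $(t,q_i^A,p,p_A^i)$, $0\le i\le k-1$, on $T^*(J^{k-1}\pi)$, and coordinates $(t,q_i^A,p_A^i)$ on $J^{k-1}\pi^*=T^*(J^{k-1}\pi)/(\bar\pi^{k-1})^*T^*\mathbb R$. Let $\mu:T^*(J^{k-1}\pi)\to J^{k-1}\pi^*$ be the quotient map, and let $\mathcal W=J^{2k-1}\pi\times_{J^{k-1}\pi}T^*(J^{k-1}\pi)$, $\mathcal W_r=J^{2k-1}\pi\times_{J^{k-1}\pi}J^{k-1}\pi^*$ and $\mu_{\mathcal W}=\mathrm{id}\times\mu:\mathcal W\to\mathcal W_r$. Let $\mathcal L=L\,dt$ with $L\in C^\infty(J^k\pi)$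 be a $k$th order Lagrangian density. For $w=(\bar y,\alpha)\in\mathcal W$ with $\bar y=j^{2k-1}_{t}\phi$ put $\hat L(w)=L(\pi^{2k-1}_k(\bar y))$ and $\hat C(w)=\langle\alpha,\,T(j^{k-1}\phi)(\partial/\partial t)\rangle$, and let $\mathcal W_o=\{w\in\mathcal W:\hat C(w)=\hat L(w)\}$. Let $\Omega_o$ be the pull-back to $\mathcal W_o$ of the canonical symplectic form of $T^*(J^{k-1}\pi)$, let $\hat\rho_2^o:\mathcal W_o\to J^{k-1}\pi^*$, $(\bar y,\alpha)\mapsto\mu(\alpha)$, and let $$\mathcal W_c=\{w\in\mathcal W_o:\ (i(Y)\Omega_o)(w)=0\ \text{for every $\hat\rho_2^o$-vertical vector field $Y$ on }\mathcal W_o\}$$ be the first constraint submanifold. Then $\mathcal W_o$ and $\mathcal W_c$ are embedded submanifolds of $J^{2k-1}\pi\times T^*(J^{k-1}\pi)$ of dimensions $3kn+1$ and $(3k-1)n+1$, and $\mathcal W_c$ contains an embedded submanifold $\mathcal W_1$, of dimension $2kn+1$, such that the following hold. 1. There is a smooth map $\mathcal{FL}:J^{2k-1}\pi\to J^{k-1}\pi^*$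 (the restricted Legendre–Ostrogradsky map) such that $\mu_{\mathcal W}$ maps $\mathcal W_1$ bijectively onto the graph of $\mathcal{FL}$ and such that, in the coordinates induced by every adapted chart, $$\mathcal{FL}^*t=t,\qquad \mathcal{FL}^*q_r^A=q_r^A\ (0\le r\le k-1),\qquad \mathcal{FL}^*p_A^{r-1}=\sum_{i=0}^{k-r}(-1)^i d_T^i\Big(\frac{\partial L}{\partial q_{r+i}^A}\Big)\ (1\le r\le k),$$ where $d_T=\partial/\partial t+\sum_{i\ge0}\sum_A q_{i+1}^A\,\partial/\partial q_i^A$ is the total time derivative. 2. $\mathcal W_1$ is the graph of a smooth map $\widetilde{\mathcal{FL}}:J^{2k-1}\pi\to T^*(J^{k-1}\pi)$ (the extended Legendre–Ostrogradsky map) which, in the coordinates induced by every adapted chart, is given by the same formulas for $t,q_r^A,p_A^{r-1}$ together with $$\widetilde{\mathcal{FL}}^*p=L-\sum_{r=1}^k\sum_A q_r^A\sum_{i=0}^{k-r}(-1)^i d_T^i\Big(\frac{\partial L}{\partial q_{r+i}^A}\Big).$$ -/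

import Mathlib

open Set Filter Function
open scoped Manifold ContDiff Topology

noncomputable section


namespace SkinnerRusk

/-- The coordinate space of `J^m π`: tuples `(t, q_0, …, q_m)` with `q_i = (q_i^A)_A ∈ ℝⁿ`. -/
abbrev Coord (n m : ℕ) : Type := ℝ × (Fin (m + 1) → Fin n → ℝ)

/-- The coordinate expression `(t, q_0, …, q_m) ↦ (t, q_0, …, q_r)` of `π^m_r` for `r ≤ m`
(missing entries, which do not occur for `r ≤ m`, are filled with `0`). -/
def Coord.trunc {n m : ℕ} (r : ℕ) (c : Coord n m) : Coord n r :=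
  (c.1, fun i => if h : (i : ℕ) < m + 1 then c.2 ⟨i, h⟩ else 0)

/-- The total time derivative in coordinates: for `f` a function of `(t, q_0, …, q_m)`,
`d_T f = ∂f/∂t + ∑ i ≤ m, q_{i+1}^A ∂f/∂q_i^A`, a function of `(t, q_0, …, q_{m+1})`. -/
def totalDeriv {n m : ℕ} {F : Type*} [NormedAddCommGroup F] [NormedSpace ℝ F]
    (f : Coord n m → F) : Coord n (m + 1) → F :=
  fun c => fderiv ℝ f (c.1, fun i => c.2 i.castSucc) (1, fun i => c.2 i.succ)

/-- The iterated total time derivative `d_T^i f`, a function of `(t, q_0, …, q_{m+i})`. -/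
def totalDerivIter {n m : ℕ} {F : Type*} [NormedAddCommGroup F] [NormedSpace ℝ F]
    (f : Coord n m → F) : (i : ℕ) → Coord n (m + i) → F
  | 0 => f
  | i + 1 => totalDeriv (totalDerivIter f i)

section Calculus

variable {n m : ℕ} {F : Type*} [NormedAddCommGroup F] [NormedSpace ℝ F]

theorem Coord.contDiff_trunc (r : ℕ) : ContDiff ℝ ∞ (Coord.trunc (n := n) (m := m) r) := by
  unfold Coord.trunc
  refine contDiff_fst.prodMk (contDiff_pi.2 fun i => ?_)
  by_cases h : (i : ℕ) < m + 1
  · simp only [h, dite_true]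
    exact (contDiff_apply ℝ (Fin n → ℝ) (⟨i, h⟩ : Fin (m + 1))).comp contDiff_snd
  · simp only [h, dite_false]
    exact contDiff_const

theorem Coord.trunc_self (c : Coord n m) : Coord.trunc m c = c := by
  ext i
  · rfl
  · simp [Coord.trunc, Nat.le_of_lt_succ i.2]

theorem Coord.trunc_trunc {r s : ℕ} (h : s ≤ r) (c : Coord n m) :
    Coord.trunc s (Coord.trunc r c) = Coord.trunc s c := by
  ext i A
  · rfl
  · have : (i : ℕ) < r + 1 := by omega
    simp [Coord.trunc, Nat.le_of_lt_succ this]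

theorem contDiffOn_totalDeriv {f : Coord n m → F} {Ω : Set (Coord n m)} (hΩ : IsOpen Ω)
    (hf : ContDiffOn ℝ ∞ f Ω) :
    ContDiffOn ℝ ∞ (totalDeriv f) {c | Coord.trunc m c ∈ Ω} := by
  have h1 : ContDiffOn ℝ ∞ (fderiv ℝ f) Ω := hf.fderiv_of_isOpen hΩ (by simp)
  have h2 : ∀ c : Coord n (m + 1), Coord.trunc m c = (c.1, fun i => c.2 i.castSucc) := by
    intro c
    ext i A
    · rfl
    · simp only [Coord.trunc]
      rw [dif_pos (by omega)]
      rfl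
  have h3 : ContDiff ℝ ∞ (fun c : Coord n (m + 1) =>
      ((1, fun i => c.2 i.succ) : Coord n m)) := by
    refine contDiff_const.prodMk (contDiff_pi.2 fun i => ?_)
    exact (contDiff_apply ℝ (Fin n → ℝ) i.succ).comp contDiff_snd
  have h4 : ContDiffOn ℝ ∞ (fun c : Coord n (m + 1) => fderiv ℝ f (Coord.trunc m c))
      {c | Coord.trunc m c ∈ Ω} :=
    h1.comp (Coord.contDiff_trunc m).contDiffOn fun c hc => hc
  have h5 := h4.clm_apply h3.contDiffOn
  refine h5.congr fun c _ => ?_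
  simp only [totalDeriv, h2]

theorem contDiffOn_totalDerivIter {f : Coord n m → F} {Ω : Set (Coord n m)} (hΩ : IsOpen Ω)
    (hf : ContDiffOn ℝ ∞ f Ω) (i : ℕ) :
    ContDiffOn ℝ ∞ (totalDerivIter f i) {c | Coord.trunc m c ∈ Ω} := by
  induction i with
  | zero =>
    refine hf.mono fun c hc => ?_
    have : Coord.trunc m c ∈ Ω := hc
    rwa [Coord.trunc_self] at this
  | succ i ih =>
    refine (contDiffOn_totalDeriv
      (hΩ.preimage (Coord.contDiff_trunc (n := n) (m := m + i) m).continuous) ih).mono ?_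
    intro c hc
    have hc' : Coord.trunc m c ∈ Ω := hc
    change Coord.trunc m (Coord.trunc (m + i) c) ∈ Ω
    rwa [Coord.trunc_trunc (by omega)]

/-- The curve `s ↦ (s, γ(s), γ'(s), …, γ^{(m)}(s))`. -/
def jetCurve (γ : ℝ → Fin n → ℝ) (m : ℕ) (s : ℝ) : Coord n m :=
  (s, fun i => iteratedDeriv i γ s)

theorem trunc_jetCurve (γ : ℝ → Fin n → ℝ) {r : ℕ} (h : r ≤ m) (s : ℝ) :
    Coord.trunc r (jetCurve γ m s) = jetCurve γ r s := by
  ext i A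
  · rfl
  · have : (i : ℕ) < m + 1 := by omega
    simp [Coord.trunc, jetCurve, Nat.le_of_lt_succ this]

theorem hasDerivAt_iteratedDeriv {γ : ℝ → Fin n → ℝ} {s : ℝ} (hγ : ContDiffAt ℝ ∞ γ s) (i : ℕ) :
    HasDerivAt (iteratedDeriv i γ) (iteratedDeriv (i + 1) γ s) s := by
  rw [iteratedDeriv_succ]
  have h1 : ContDiffAt ℝ ∞ (iteratedFDeriv ℝ i γ) s := hγ.iteratedFDeriv_right (by exact_mod_cast le_top)
  have h2 : ContDiffAt ℝ ∞ (iteratedDeriv i γ) s := by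
    rw [iteratedDeriv_eq_equiv_comp]
    exact (LinearIsometryEquiv.contDiff _).comp_contDiffAt s h1
  exact (h2.differentiableAt (by simp)).hasDerivAt

theorem hasDerivAt_jetCurve {γ : ℝ → Fin n → ℝ} {s : ℝ} (hγ : ContDiffAt ℝ ∞ γ s) (m : ℕ) :
    HasDerivAt (jetCurve γ m) (1, fun i => iteratedDeriv ((i : ℕ) + 1) γ s) s := by
  refine (hasDerivAt_id s).prodMk ?_
  exact hasDerivAt_pi.2 fun i => hasDerivAt_iteratedDeriv hγ i

theorem deriv_comp_jetCurve {γ : ℝ → Fin n → ℝ} {s : ℝ} (hγ : ContDiffAt ℝ ∞ γ s)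
    {f : Coord n m → F} (hf : DifferentiableAt ℝ f (jetCurve γ m s)) :
    deriv (fun s => f (jetCurve γ m s)) s = totalDeriv f (jetCurve γ (m + 1) s) := by
  have := hf.hasFDerivAt.comp_hasDerivAt s (hasDerivAt_jetCurve hγ m)
  exact this.deriv

theorem iteratedDeriv_comp_jetCurve {γ : ℝ → Fin n → ℝ} {D : Set ℝ} (hD : IsOpen D)
    (hγ : ContDiffOn ℝ ∞ γ D) {f : Coord n m → F} {Ω : Set (Coord n m)} (hΩ : IsOpen Ω)
    (hf : ContDiffOn ℝ ∞ f Ω) (hγΩ : ∀ s ∈ D, jetCurve γ m s ∈ Ω) (i : ℕ) :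
    ∀ s ∈ D, iteratedDeriv i (fun s => f (jetCurve γ m s)) s
      = totalDerivIter f i (jetCurve γ (m + i) s) := by
  induction i with
  | zero => intro s _; simp [totalDerivIter]
  | succ i ih =>
    intro s hs
    have h1 : iteratedDeriv i (fun s => f (jetCurve γ m s)) =ᶠ[𝓝 s]
        fun s => totalDerivIter f i (jetCurve γ (m + i) s) := by
      filter_upwards [hD.mem_nhds hs] with x hx using ih x hx
    rw [iteratedDeriv_succ, h1.deriv_eq]
    refine deriv_comp_jetCurve (hγ.contDiffAt (hD.mem_nhds hs)) ?_
    have h2 : IsOpen {c : Coord n (m + i) | Coord.trunc m c ∈ Ω} :=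
      hΩ.preimage (Coord.contDiff_trunc (n := n) (m := m + i) m).continuous
    have h3 : jetCurve γ (m + i) s ∈ {c : Coord n (m + i) | Coord.trunc m c ∈ Ω} := by
      change Coord.trunc m _ ∈ Ω
      rw [trunc_jetCurve γ (by omega)]
      exact hγΩ s hs
    exact ((contDiffOn_totalDerivIter hΩ hf i).contDiffAt (h2.mem_nhds h3)).differentiableAt
      (by simp)

/-- The Taylor polynomial `s ↦ ∑ i ≤ m, (s - t)^i / i! • q_i` at `t` with derivatives `q_i`. -/
def taylorCurve (c : Coord n m) (s : ℝ) : Fin n → ℝ :=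
  ∑ i : Fin (m + 1), ((s - c.1) ^ (i : ℕ) / ((i : ℕ).factorial : ℝ)) • c.2 i

theorem iteratedDeriv_sum_pow (t : ℝ) (j : ℕ) :
    ∀ (N : ℕ) (Q : ℕ → Fin n → ℝ),
    iteratedDeriv j (fun s => ∑ i ∈ Finset.range N,
      ((s - t) ^ i / (i.factorial : ℝ)) • Q i) t = if j < N then Q j else 0 := by
  induction j with
  | zero =>
    intro N Q
    rcases N with _ | N
    · simp
    · simp [Finset.sum_range_succ']
  | succ j ih =>
    intro N Q
    rcases N with _ | N
    · simp [iteratedDeriv_fun_const_zero]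
    · have h : deriv (fun s => ∑ i ∈ Finset.range (N + 1),
          ((s - t) ^ i / (i.factorial : ℝ)) • Q i)
          = fun s => ∑ i ∈ Finset.range N, ((s - t) ^ i / (i.factorial : ℝ)) • Q (i + 1) := by
        funext s
        refine HasDerivAt.deriv ?_
        simp only [Finset.sum_range_succ' _ N]
        simp only [pow_zero, Nat.factorial_zero, Nat.cast_one, div_one, one_smul]
        refine HasDerivAt.add_const _ (HasDerivAt.fun_sum fun i _ => ?_)
        refine HasDerivAt.smul_const ?_ _
        have h1 : HasDerivAt (fun s : ℝ => (s - t) ^ (i + 1)) ((i + 1 : ℝ) * (s - t) ^ i) s := by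
          simpa using ((hasDerivAt_id s).sub_const t).fun_pow (i + 1)
        have h2 := h1.div_const ((i + 1).factorial : ℝ)
        convert h2 using 1
        rw [Nat.factorial_succ]
        have : (i.factorial : ℝ) ≠ 0 := by positivity
        push_cast
        field_simp
      rw [iteratedDeriv_succ', h, ih N fun i => Q (i + 1)]
      simp

theorem iteratedDeriv_taylorCurve (c : Coord n m) (j : Fin (m + 1)) :
    iteratedDeriv j (taylorCurve c) c.1 = c.2 j := by
  have h : taylorCurve c = fun s => ∑ i ∈ Finset.range (m + 1),
      ((s - c.1) ^ i / (i.factorial : ℝ)) • (fun i => (Coord.trunc i c).2 (Fin.last i)) i := by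
    funext s
    rw [taylorCurve, Finset.sum_range]
    refine Finset.sum_congr rfl fun i _ => ?_
    simp [Coord.trunc, Nat.le_of_lt_succ i.2]
  rw [h, iteratedDeriv_sum_pow]
  simp [Coord.trunc, Nat.le_of_lt_succ j.2]

theorem contDiff_taylorCurve (c : Coord n m) : ContDiff ℝ ∞ (taylorCurve c) := by
  unfold taylorCurve
  fun_prop

theorem jetCurve_taylorCurve (c : Coord n m) : jetCurve (taylorCurve c) m c.1 = c := by
  ext i A
  · rfl
  · simp [jetCurve, iteratedDeriv_taylorCurve]

end Calculus

/-! ### Adapted charts, local sections and jets -/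

section Jets

variable {n : ℕ} {E : Type*} [TopologicalSpace E]
  [ChartedSpace (EuclideanSpace ℝ (Fin (n + 1))) E]

/-- A chart `(t, q^A)` of the `(n+1)`-dimensional manifold `E` adapted to `π : E → ℝ`: a
diffeomorphism from an open subset of `E` onto an open subset of `ℝ × ℝⁿ` whose first component
is `π`. -/
structure AdaptedChart (n : ℕ) {E : Type*} [TopologicalSpace E]
    [ChartedSpace (EuclideanSpace ℝ (Fin (n + 1))) E] (π : E → ℝ) extends
    OpenPartialHomeomorph E (ℝ × (Fin n → ℝ)) where
  contMDiffOn_toFun : ContMDiffOn (𝓡 (n + 1)) 𝓘(ℝ, ℝ × (Fin n → ℝ)) ∞ toFun source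
  contMDiffOn_invFun : ContMDiffOn 𝓘(ℝ, ℝ × (Fin n → ℝ)) (𝓡 (n + 1)) ∞ invFun target
  fst_apply : ∀ x ∈ source, (toFun x).1 = π x

/-- `π : E → ℝ` is fibred: `E` is covered by charts adapted to `π`, in which `π` is
`(t, q) ↦ t`.  This is the local normal form of a submersion; every smooth locally trivial bundle
over `ℝ` has it. -/
class IsFibred (n : ℕ) {E : Type*} [TopologicalSpace E]
    [ChartedSpace (EuclideanSpace ℝ (Fin (n + 1))) E] (π : E → ℝ) : Prop where
  exists_adaptedChart : ∀ x : E, ∃ e : AdaptedChart n π, x ∈ e.source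

/-- A smooth local section of `π`, defined on an open set `dom`. -/
structure LocalSection (n : ℕ) {E : Type*} [TopologicalSpace E]
    [ChartedSpace (EuclideanSpace ℝ (Fin (n + 1))) E] (π : E → ℝ) where
  toFun : ℝ → E
  dom : Set ℝ
  isOpen_dom : IsOpen dom
  contMDiffOn : ContMDiffOn 𝓘(ℝ, ℝ) (𝓡 (n + 1)) ∞ toFun dom
  section_apply : ∀ t ∈ dom, π (toFun t) = t

/-- A local section together with a point of its domain. -/
structure PreJet (n : ℕ) {E : Type*} [TopologicalSpace E]
    [ChartedSpace (EuclideanSpace ℝ (Fin (n + 1))) E] (π : E → ℝ) where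
  sec : LocalSection n π
  time : ℝ
  mem_dom : time ∈ sec.dom

/-- The value `φ(t) ∈ E` at the base point. -/
def PreJet.value {π : E → ℝ} (a : PreJet n π) : E := a.sec.toFun a.time

/-- The fibre part `s ↦ (φ^A(s))_A` of a section in an adapted chart. -/
def LocalSection.coord {π : E → ℝ} (φ : LocalSection n π) (e : AdaptedChart n π) :
    ℝ → Fin n → ℝ :=
  fun s => (e.toOpenPartialHomeomorph (φ.toFun s)).2

/-- The induced coordinates `(t, φ^A(t), …, d^mφ^A/dt^m(t))`. -/
def PreJet.coords {π : E → ℝ} (a : PreJet n π) (e : AdaptedChart n π) (m : ℕ) : Coord n m :=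
  jetCurve (a.sec.coord e) m a.time

/-- Contact of order `m`: same base point, same value, and the same derivatives up to order `m` in
adapted charts. -/
def jetSetoid (n : ℕ) {E : Type*} [TopologicalSpace E]
    [ChartedSpace (EuclideanSpace ℝ (Fin (n + 1))) E] (π : E → ℝ) (m : ℕ) :
    Setoid (PreJet n π) where
  r a b := a.time = b.time ∧ a.value = b.value ∧
    ∀ e : AdaptedChart n π, a.value ∈ e.source → a.coords e m = b.coords e m
  iseqv :=
    { refl := fun _ => ⟨rfl, rfl, fun _ _ => rfl⟩
      symm := fun h => ⟨h.1.symm, h.2.1.symm, fun e he => (h.2.2 e (h.2.1 ▸ he)).symm⟩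
      trans := fun h h' => ⟨h.1.trans h'.1, h.2.1.trans h'.2.1,
        fun e he => (h.2.2 e he).trans (h'.2.2 e (h.2.1 ▸ he))⟩ }

/-- The `m`th order jet bundle `J^m π`. -/
def Jet (n : ℕ) {E : Type*} [TopologicalSpace E]
    [ChartedSpace (EuclideanSpace ℝ (Fin (n + 1))) E] (π : E → ℝ) (m : ℕ) : Type _ :=
  Quotient (jetSetoid n π m)

variable {π : E → ℝ} {m : ℕ}

namespace Jet

/-- The jet `j^m_t φ` of a local section at a point of its domain. -/
def mk (m : ℕ) (a : PreJet n π) : Jet n π m := Quotient.mk (jetSetoid n π m) a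

/-- A local section representing the jet, with its base point. -/
def rep (y : Jet n π m) : PreJet n π := Quotient.out y

theorem mk_rep (y : Jet n π m) : mk m y.rep = y := Quotient.out_eq y

theorem mk_eq_mk {a b : PreJet n π} : mk m a = mk m b ↔
    a.time = b.time ∧ a.value = b.value ∧
      ∀ e : AdaptedChart n π, a.value ∈ e.source → a.coords e m = b.coords e m :=
  Quotient.eq (r := jetSetoid n π m)

/-- The projection `π^m : J^m π → E`. -/
def value (y : Jet n π m) : E := y.rep.value

/-- The projection `π̄^m : J^m π → ℝ`. -/
def time (y : Jet n π m) : ℝ := y.rep.time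

/-- The projection `π^m_r : J^m π → J^r π`, `j^m_t φ ↦ j^r_t φ` (for `r ≤ m`). -/
def proj (r : ℕ) (y : Jet n π m) : Jet n π r := mk r y.rep

/-- The induced coordinates `(t, q_0, …, q_m)` on `J^m π`. -/
def coords (e : AdaptedChart n π) (y : Jet n π m) : Coord n m := y.rep.coords e m

theorem rep_mk (a : PreJet n π) : (mk m a).rep.time = a.time ∧ (mk m a).rep.value = a.value ∧
    ∀ e : AdaptedChart n π, a.value ∈ e.source → (mk m a).rep.coords e m = a.coords e m := by
  have := mk_eq_mk.1 (mk_rep (mk m a))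
  exact ⟨this.1, this.2.1, fun e he => this.2.2 e (this.2.1 ▸ he)⟩

theorem value_mk (a : PreJet n π) : (mk m a).value = a.value := (rep_mk a).2.1

theorem time_mk (a : PreJet n π) : (mk m a).time = a.time := (rep_mk a).1

theorem coords_mk (a : PreJet n π) (e : AdaptedChart n π) (h : a.value ∈ e.source) :
    (mk m a).coords e = a.coords e m := (rep_mk a).2.2 e h

end Jet

/-! ### Induced charts -/

/-- Transition of fibre coordinates, as a function of `(t, q_0)`. -/
def fibreTransition (e e' : AdaptedChart n π) (c : Coord n 0) : Fin n → ℝ :=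
  (e'.toOpenPartialHomeomorph (e.toOpenPartialHomeomorph.symm (c.1, c.2 0))).2

/-- The domain of the transition of fibre coordinates. -/
def transitionDomain (e e' : AdaptedChart n π) : Set (Coord n 0) :=
  {c | (c.1, c.2 0) ∈ (e.toOpenPartialHomeomorph.symm.trans e'.toOpenPartialHomeomorph).source}

theorem isOpen_transitionDomain (e e' : AdaptedChart n π) : IsOpen (transitionDomain e e') := by
  refine (OpenPartialHomeomorph.open_source _).preimage ?_
  fun_prop

theorem contDiffOn_fibreTransition (e e' : AdaptedChart n π) :
    ContDiffOn ℝ ∞ (fibreTransition e e') (transitionDomain e e') := by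
  have h1 : ContDiffOn ℝ ∞
      (fun x => e'.toOpenPartialHomeomorph (e.toOpenPartialHomeomorph.symm x))
      (e.toOpenPartialHomeomorph.symm.trans e'.toOpenPartialHomeomorph).source := by
    rw [← contMDiffOn_iff_contDiffOn]
    refine e'.contMDiffOn_toFun.comp (e.contMDiffOn_invFun.mono ?_) ?_
    · intro x hx
      exact hx.1
    · intro x hx
      exact hx.2
  have h2 : ContDiff ℝ ∞ (fun c : Coord n 0 => (c.1, c.2 0)) := by fun_prop
  exact (contDiff_snd.comp_contDiffOn h1).comp h2.contDiffOn fun c hc => hc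

/-- The transition `(t, q_0, …, q_m) ↦ (t, q'_0, …, q'_m)` of induced coordinates. -/
def jetTransition (e e' : AdaptedChart n π) (m : ℕ) (c : Coord n m) : Coord n m :=
  (c.1, fun i => totalDerivIter (fibreTransition e e') i (Coord.trunc (0 + i) c))

theorem contDiffOn_jetTransition (e e' : AdaptedChart n π) (m : ℕ) :
    ContDiffOn ℝ ∞ (jetTransition e e' m) {c | Coord.trunc 0 c ∈ transitionDomain e e'} := by
  refine contDiffOn_fst.prodMk (contDiffOn_pi.2 fun i => ?_)
  refine (contDiffOn_totalDerivIter (isOpen_transitionDomain e e')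
    (contDiffOn_fibreTransition e e') i).comp (Coord.contDiff_trunc (0 + i)).contDiffOn ?_
  intro c hc
  change Coord.trunc 0 (Coord.trunc (0 + (i : ℕ)) c) ∈ transitionDomain e e'
  rw [Coord.trunc_trunc (by omega)]
  exact hc

theorem AdaptedChart.apply_sec (e : AdaptedChart n π) (φ : LocalSection n π) {s : ℝ}
    (hs : s ∈ φ.dom) (h : φ.toFun s ∈ e.source) :
    e.toOpenPartialHomeomorph (φ.toFun s) = (s, φ.coord e s) := by
  ext1
  · exact (e.fst_apply _ h).trans (φ.section_apply s hs)
  · rfl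

/-- The part of the domain of a section on which the chart is defined. -/
def LocalSection.domIn (φ : LocalSection n π) (e : AdaptedChart n π) : Set ℝ :=
  φ.dom ∩ φ.toFun ⁻¹' e.source

theorem LocalSection.isOpen_domIn (φ : LocalSection n π) (e : AdaptedChart n π) :
    IsOpen (φ.domIn e) :=
  φ.contMDiffOn.continuousOn.isOpen_inter_preimage φ.isOpen_dom e.open_source

theorem LocalSection.contDiffOn_coord (φ : LocalSection n π) (e : AdaptedChart n π) :
    ContDiffOn ℝ ∞ (φ.coord e) (φ.domIn e) := by
  have h1 : ContDiffOn ℝ ∞ (fun s => e.toOpenPartialHomeomorph (φ.toFun s)) (φ.domIn e) := by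
    rw [← contMDiffOn_iff_contDiffOn]
    exact e.contMDiffOn_toFun.comp (φ.contMDiffOn.mono inter_subset_left) inter_subset_right
  exact contDiff_snd.comp_contDiffOn h1

theorem PreJet.trunc_coords_mem (a : PreJet n π) (e e' : AdaptedChart n π)
    (h : a.value ∈ e.source) (h' : a.value ∈ e'.source) :
    Coord.trunc 0 (a.coords e m) ∈ transitionDomain e e' := by
  rw [PreJet.coords, trunc_jetCurve _ (by omega)]
  have h1 := e.apply_sec a.sec a.mem_dom h
  have h2 : ((jetCurve (a.sec.coord e) 0 a.time).1, (jetCurve (a.sec.coord e) 0 a.time).2 0)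
      = e.toOpenPartialHomeomorph a.value := by
    simpa [jetCurve, PreJet.value] using h1.symm
  change _ ∈ (e.toOpenPartialHomeomorph.symm.trans e'.toOpenPartialHomeomorph).source
  rw [h2, OpenPartialHomeomorph.trans_source]
  refine ⟨e.map_source h, ?_⟩
  change e.toOpenPartialHomeomorph.symm (e.toOpenPartialHomeomorph a.value) ∈ e'.source
  rwa [e.left_inv h]

theorem PreJet.coords_eq_jetTransition (a : PreJet n π) (e e' : AdaptedChart n π)
    (h : a.value ∈ e.source) (h' : a.value ∈ e'.source) :
    a.coords e' m = jetTransition e e' m (a.coords e m) := by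
  set D := a.sec.domIn e ∩ a.sec.domIn e' with hDdef
  have hD : IsOpen D := (a.sec.isOpen_domIn e).inter (a.sec.isOpen_domIn e')
  have haD : a.time ∈ D := ⟨⟨a.mem_dom, h⟩, ⟨a.mem_dom, h'⟩⟩
  have hpt : ∀ s ∈ D, jetCurve (a.sec.coord e) 0 s ∈ transitionDomain e e' ∧
      a.sec.coord e' s = fibreTransition e e' (jetCurve (a.sec.coord e) 0 s) := by
    intro s hs
    let b : PreJet n π := ⟨a.sec, s, hs.1.1⟩
    have hb : b.value ∈ e.source := hs.1.2
    have hb' : b.value ∈ e'.source := hs.2.2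
    have h1 := b.trunc_coords_mem (m := 0) e e' hb hb'
    rw [Coord.trunc_self] at h1
    refine ⟨h1, ?_⟩
    have h2 := e.apply_sec a.sec hs.1.1 hs.1.2
    have h3 : ((jetCurve (a.sec.coord e) 0 s).1, (jetCurve (a.sec.coord e) 0 s).2 0)
        = e.toOpenPartialHomeomorph (a.sec.toFun s) := by
      simpa [jetCurve] using h2.symm
    rw [fibreTransition, h3, e.left_inv hs.1.2]
    rfl
  have hiter := fun i => iteratedDeriv_comp_jetCurve hD
    ((a.sec.contDiffOn_coord e).mono inter_subset_left) (isOpen_transitionDomain e e')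
    (contDiffOn_fibreTransition e e') (fun s hs => (hpt s hs).1) i a.time haD
  refine Prod.ext rfl (funext fun i => ?_)
  change iteratedDeriv i (a.sec.coord e') a.time = totalDerivIter _ i _
  rw [PreJet.coords, trunc_jetCurve _ (by omega), ← hiter i]
  have : a.sec.coord e' =ᶠ[𝓝 a.time]
      fun s => fibreTransition e e' (jetCurve (a.sec.coord e) 0 s) := by
    filter_upwards [hD.mem_nhds haD] with s hs using (hpt s hs).2
  exact this.iteratedDeriv_eq i

theorem PreJet.ext_of_coords {a b : PreJet n π} (e : AdaptedChart n π) (ha : a.value ∈ e.source)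
    (hb : b.value ∈ e.source) (h : a.coords e m = b.coords e m) :
    Jet.mk m a = Jet.mk m b := by
  have ht : a.time = b.time := congrArg Prod.fst h
  have hv : a.value = b.value := by
    have h1 := e.apply_sec a.sec a.mem_dom ha
    have h2 := e.apply_sec b.sec b.mem_dom hb
    have h3 : a.sec.coord e a.time = b.sec.coord e b.time := by
      have := congrFun (congrArg Prod.snd h) 0
      simpa [PreJet.coords, jetCurve] using this
    refine e.toOpenPartialHomeomorph.injOn ha hb ?_
    change e.toOpenPartialHomeomorph (a.sec.toFun a.time)
      = e.toOpenPartialHomeomorph (b.sec.toFun b.time)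
    rw [h1, h2, h3, ht]
  refine Jet.mk_eq_mk.2 ⟨ht, hv, fun e' he' => ?_⟩
  rw [a.coords_eq_jetTransition e e' ha he', b.coords_eq_jetTransition e e' hb (hv ▸ he'), h]

/-- The coordinate domain of `J^m π` over an adapted chart, in coordinates. -/
def jetTarget (e : AdaptedChart n π) (m : ℕ) : Set (Coord n m) :=
  {c | (c.1, c.2 0) ∈ e.target}

/-- The local section which is the Taylor polynomial with prescribed derivatives at `t`. -/
def taylorSection (e : AdaptedChart n π) (c : Coord n m) : LocalSection n π where
  toFun s := e.toOpenPartialHomeomorph.symm (s, taylorCurve c s)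
  dom := {s | (s, taylorCurve c s) ∈ e.target}
  isOpen_dom := e.open_target.preimage
    (continuous_id.prodMk (contDiff_taylorCurve c).continuous)
  contMDiffOn := by
    refine e.contMDiffOn_invFun.comp (t := e.target) ?_ fun s hs => hs
    exact (contDiff_id.prodMk (contDiff_taylorCurve c)).contMDiff.contMDiffOn
  section_apply s hs := by
    rw [← e.fst_apply _ (e.map_target hs)]
    exact congrArg Prod.fst (e.right_inv hs)

theorem taylorCurve_self (c : Coord n m) : taylorCurve c c.1 = c.2 0 := by
  simpa using iteratedDeriv_taylorCurve c 0

/-- The representative of the jet with coordinates `c`. -/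
def taylorPreJet (e : AdaptedChart n π) (c : Coord n m) (hc : c ∈ jetTarget e m) :
    PreJet n π where
  sec := taylorSection e c
  time := c.1
  mem_dom := by
    change (c.1, taylorCurve c c.1) ∈ e.target
    rw [taylorCurve_self]
    exact hc

theorem value_taylorPreJet (e : AdaptedChart n π) (c : Coord n m) (hc : c ∈ jetTarget e m) :
    (taylorPreJet e c hc).value = e.toOpenPartialHomeomorph.symm (c.1, c.2 0) := by
  change e.toOpenPartialHomeomorph.symm (c.1, taylorCurve c c.1) = _
  rw [taylorCurve_self]

theorem value_taylorPreJet_mem (e : AdaptedChart n π) (c : Coord n m) (hc : c ∈ jetTarget e m) :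
    (taylorPreJet e c hc).value ∈ e.source := by
  rw [value_taylorPreJet]
  exact e.map_target hc

theorem coords_taylorPreJet (e : AdaptedChart n π) (c : Coord n m) (hc : c ∈ jetTarget e m) :
    (taylorPreJet e c hc).coords e m = c := by
  conv_rhs => rw [← jetCurve_taylorCurve c]
  have hD := (taylorSection e c).isOpen_dom
  have hmem : c.1 ∈ (taylorSection e c).dom := (taylorPreJet e c hc).mem_dom
  have : (taylorSection e c).coord e =ᶠ[𝓝 c.1] taylorCurve c := by
    filter_upwards [hD.mem_nhds hmem] with s hs
    exact congrArg Prod.snd (e.right_inv hs)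
  refine Prod.ext rfl (funext fun i => ?_)
  exact this.iteratedDeriv_eq i

theorem PreJet.coords_mem_jetTarget (a : PreJet n π) (e : AdaptedChart n π)
    (h : a.value ∈ e.source) : a.coords e m ∈ jetTarget e m := by
  have := (a.trunc_coords_mem (m := m) e e h h).1
  exact this

theorem Jet.nonempty_of_chart [IsFibred n π] (e : AdaptedChart n π) (m : ℕ) :
    Nonempty (Jet n π m) := by
  obtain ⟨e', he'⟩ :=
    IsFibred.exists_adaptedChart (n := n) (π := π) (e.toOpenPartialHomeomorph.symm (0, 0))
  set x := e.toOpenPartialHomeomorph.symm (0, 0)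
  let c : Coord n m := ((e'.toOpenPartialHomeomorph x).1, fun _ => (e'.toOpenPartialHomeomorph x).2)
  have hc : c ∈ jetTarget e' m := e'.map_source he'
  exact ⟨Jet.mk m (taylorPreJet e' c hc)⟩

open Classical in
/-- The inverse of the induced coordinates on `J^m π`. -/
def jetOfCoords [IsFibred n π] (e : AdaptedChart n π) (m : ℕ) (c : Coord n m) : Jet n π m :=
  if hc : c ∈ jetTarget e m then Jet.mk m (taylorPreJet e c hc)
  else (Jet.nonempty_of_chart e m).some

/-- The induced coordinate system on `J^m π`, defined on `(π^m)⁻¹(U)` for `U` the domain of the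
adapted chart. -/
def jetPartialEquiv [IsFibred n π] (e : AdaptedChart n π) (m : ℕ) :
    PartialEquiv (Jet n π m) (Coord n m) where
  toFun := Jet.coords e
  invFun := jetOfCoords e m
  source := {y | y.value ∈ e.source}
  target := jetTarget e m
  map_source' y hy := y.rep.coords_mem_jetTarget e hy
  map_target' c hc := by
    change Jet.value _ ∈ e.source
    rw [jetOfCoords, dif_pos hc, Jet.value_mk]
    exact value_taylorPreJet_mem e c hc
  left_inv' y hy := by
    have hc : Jet.coords e y ∈ jetTarget e m := y.rep.coords_mem_jetTarget e hy
    change jetOfCoords e m (Jet.coords e y) = y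
    rw [jetOfCoords, dif_pos hc]
    conv_rhs => rw [← y.mk_rep]
    exact PreJet.ext_of_coords e (value_taylorPreJet_mem e _ hc) hy (coords_taylorPreJet e _ hc)
  right_inv' c hc := by
    rw [jetOfCoords, dif_pos hc, Jet.coords_mk _ _ (value_taylorPreJet_mem e c hc)]
    exact coords_taylorPreJet e c hc

theorem jetPartialEquiv_trans_source [IsFibred n π] (e e' : AdaptedChart n π) :
    ((jetPartialEquiv e m).symm.trans (jetPartialEquiv e' m)).source
      = {c | Coord.trunc 0 c ∈ transitionDomain e e'} := by
  ext c
  constructor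
  · rintro ⟨hc, hc'⟩
    have hc : c ∈ jetTarget e m := hc
    have hc' : (jetOfCoords e m c).value ∈ e'.source := hc'
    rw [jetOfCoords, dif_pos hc, Jet.value_mk, value_taylorPreJet] at hc'
    exact ⟨hc, hc'⟩
  · rintro ⟨hc, hc'⟩
    have hc : c ∈ jetTarget e m := hc
    have hc' : e.toOpenPartialHomeomorph.symm (c.1, c.2 0) ∈ e'.source := hc'
    refine ⟨hc, ?_⟩
    change (jetOfCoords e m c).value ∈ e'.source
    rw [jetOfCoords, dif_pos hc, Jet.value_mk, value_taylorPreJet]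
    exact hc'

theorem jetPartialEquiv_trans_apply [IsFibred n π] (e e' : AdaptedChart n π) {c : Coord n m}
    (hc : Coord.trunc 0 c ∈ transitionDomain e e') :
    (jetPartialEquiv e m).symm.trans (jetPartialEquiv e' m) c = jetTransition e e' m c := by
  have hc' : c ∈ ((jetPartialEquiv e m).symm.trans (jetPartialEquiv e' m)).source := by
    rw [jetPartialEquiv_trans_source]
    exact hc
  obtain ⟨h1, h2⟩ := hc'
  have h1 : c ∈ jetTarget e m := h1
  have h2 : (jetOfCoords e m c).value ∈ e'.source := h2
  change Jet.coords e' (jetOfCoords e m c) = _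
  rw [jetOfCoords, dif_pos h1, Jet.value_mk] at h2
  rw [jetOfCoords, dif_pos h1, Jet.coords_mk _ _ h2,
    PreJet.coords_eq_jetTransition _ e e' (value_taylorPreJet_mem e c h1) h2,
    coords_taylorPreJet]

theorem contDiffOn_jetPartialEquiv_trans [IsFibred n π] (e e' : AdaptedChart n π) :
    ContDiffOn ℝ ∞ ((jetPartialEquiv e m).symm.trans (jetPartialEquiv e' m))
      ((jetPartialEquiv e m).symm.trans (jetPartialEquiv e' m)).source := by
  rw [jetPartialEquiv_trans_source]
  exact (contDiffOn_jetTransition e e' m).congr fun c hc => jetPartialEquiv_trans_apply e e' hc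

/-- The atlas of `J^m π` formed by the induced coordinate systems. -/
def jetCore (π : E → ℝ) [IsFibred n π] (m : ℕ) :
    ChartedSpaceCore (Coord n m) (Jet n π m) where
  atlas := range fun e : AdaptedChart n π => jetPartialEquiv e m
  chartAt y := jetPartialEquiv (IsFibred.exists_adaptedChart (n := n) (π := π) y.value).choose m
  mem_chart_source y := (IsFibred.exists_adaptedChart (n := n) (π := π) y.value).choose_spec
  chart_mem_atlas _ := mem_range_self _
  open_source := by
    rintro _ _ ⟨e, rfl⟩ ⟨e', rfl⟩
    rw [jetPartialEquiv_trans_source]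
    exact (isOpen_transitionDomain e e').preimage (Coord.contDiff_trunc 0).continuous
  continuousOn_toFun := by
    rintro _ _ ⟨e, rfl⟩ ⟨e', rfl⟩
    exact (contDiffOn_jetPartialEquiv_trans e e').continuousOn

instance [IsFibred n π] : TopologicalSpace (Jet n π m) := (jetCore π m).toTopologicalSpace

instance [IsFibred n π] : ChartedSpace (Coord n m) (Jet n π m) := (jetCore π m).toChartedSpace

/-- The induced chart `(t, q_0, …, q_m)` of `J^m π` over an adapted chart. -/
def jetChart [IsFibred n π] (e : AdaptedChart n π) (m : ℕ) :
    OpenPartialHomeomorph (Jet n π m) (Coord n m) :=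
  (jetCore π m).openPartialHomeomorph (jetPartialEquiv e m) (mem_range_self e)

theorem jetChart_mem_atlas [IsFibred n π] (e : AdaptedChart n π) (m : ℕ) :
    jetChart e m ∈ atlas (Coord n m) (Jet n π m) := by
  exact mem_iUnion₂.2 ⟨_, mem_range_self e, rfl⟩

theorem exists_eq_jetChart [IsFibred n π] {f : OpenPartialHomeomorph (Jet n π m) (Coord n m)}
    (hf : f ∈ atlas (Coord n m) (Jet n π m)) : ∃ e : AdaptedChart n π, f = jetChart e m := by
  obtain ⟨_, ⟨e, rfl⟩, hf⟩ := mem_iUnion₂.1 hf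
  exact ⟨e, hf⟩

instance [IsFibred n π] : IsManifold 𝓘(ℝ, Coord n m) ∞ (Jet n π m) := by
  refine isManifold_of_contDiffOn _ _ _ fun f f' hf hf' => ?_
  obtain ⟨e, rfl⟩ := exists_eq_jetChart hf
  obtain ⟨e', rfl⟩ := exists_eq_jetChart hf'
  have := contDiffOn_jetPartialEquiv_trans (m := m) e e'
  simp only [modelWithCornersSelf_coe, modelWithCornersSelf_coe_symm, Function.id_comp,
    Function.comp_id, range_id, inter_univ, preimage_id]
  exact this

end Jets

/-! ### Extended and restricted momentum bundles -/

section Momenta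

variable {n : ℕ} {E : Type*} [TopologicalSpace E]
  [ChartedSpace (EuclideanSpace ℝ (Fin (n + 1))) E] {π : E → ℝ} [IsFibred n π] {m : ℕ}

/-- The coordinate frame at `y`: `v ↦ v_t ∂/∂t + ∑ v_i^A ∂/∂q_i^A` in the induced chart. -/
def coordFrame (e : AdaptedChart n π) (y : Jet n π m) :
    Coord n m →L[ℝ] TangentSpace 𝓘(ℝ, Coord n m) y :=
  mfderiv 𝓘(ℝ, Coord n m) 𝓘(ℝ, Coord n m) (jetChart e m).symm (jetChart e m y)

/-- The coordinate coframe at `y`: the components `(dt, dq_i^A)` of tangent vectors. -/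
def coordCoframe (e : AdaptedChart n π) (y : Jet n π m) :
    TangentSpace 𝓘(ℝ, Coord n m) y →L[ℝ] Coord n m :=
  mfderiv 𝓘(ℝ, Coord n m) 𝓘(ℝ, Coord n m) (jetChart e m) y

/-- The coordinate vector field `∂/∂t`. -/
def partialT (e : AdaptedChart n π) (y : Jet n π m) : TangentSpace 𝓘(ℝ, Coord n m) y :=
  coordFrame e y (1, 0)

/-- The coordinate vector field `∂/∂q_i^A`. -/
def partialQ (e : AdaptedChart n π) (y : Jet n π m) (i : Fin (m + 1)) (A : Fin n) :
    TangentSpace 𝓘(ℝ, Coord n m) y :=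
  coordFrame e y (0, Pi.single i (Pi.single A 1))

/-- The form `(π̄^m)^* dt` on `J^m π`. -/
def dtForm (y : Jet n π m) : TangentSpace 𝓘(ℝ, Coord n m) y →L[ℝ] ℝ :=
  mfderiv 𝓘(ℝ, Coord n m) 𝓘(ℝ, ℝ) Jet.time y

variable (n π m) in
/-- The cotangent bundle `T^*(J^m π)`. -/
abbrev Cotangent : Type _ :=
  Bundle.TotalSpace (Coord n m →L[ℝ] ℝ)
    (fun y : Jet n π m => TangentSpace 𝓘(ℝ, Coord n m) y →L[ℝ] ℝ)

variable (n m) in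
/-- The model of the manifold `T^*(J^m π)`. -/
abbrev cotangentModel :=
  𝓘(ℝ, Coord n m).prod 𝓘(ℝ, Coord n m →L[ℝ] ℝ)

variable (n π m) in
/-- The restricted momentum bundle `J^m π^* = T^*(J^m π) / (π̄^m)^* T^*ℝ`: pairs of a point of
`J^m π` and a class of covectors at that point modulo multiples of `dt`. -/
structure Restricted where
  proj : Jet n π m
  cls : (TangentSpace 𝓘(ℝ, Coord n m) proj →L[ℝ] ℝ) ⧸ Submodule.span ℝ {dtForm proj}

/-- The quotient map `μ : T^*(J^m π) → J^m π^*`. -/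
def quotientMap (α : Cotangent n π m) : Restricted n π m :=
  ⟨α.proj, Submodule.Quotient.mk α.2⟩

/-- The momentum coordinate `p` of a covector. -/
def momentumT (e : AdaptedChart n π) (α : Cotangent n π m) : ℝ := α.2 (partialT e α.proj)

/-- The momentum coordinates `p_A^i` of a covector. -/
def momentumQ (e : AdaptedChart n π) (α : Cotangent n π m) (i : Fin (m + 1)) (A : Fin n) : ℝ :=
  α.2 (partialQ e α.proj i A)

/-- The momentum coordinates `p_A^i` on `J^m π^*`, computed on a representing covector. -/
def Restricted.momentum (e : AdaptedChart n π) (x : Restricted n π m) (i : Fin (m + 1))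
    (A : Fin n) : ℝ :=
  (Submodule.Quotient.mk_surjective _ x.cls).choose (partialQ e x.proj i A)

theorem mem_jetChart_source {e : AdaptedChart n π} {y : Jet n π m} :
    y ∈ (jetChart e m).source ↔ y.value ∈ e.source := Iff.rfl

theorem jetChart_mdifferentiable (e : AdaptedChart n π) :
    (jetChart e m).MDifferentiable 𝓘(ℝ, Coord n m) 𝓘(ℝ, Coord n m) :=
  mdifferentiable_of_mem_atlas (jetChart_mem_atlas e m)

theorem coordFrame_coordCoframe (e : AdaptedChart n π) {y : Jet n π m}
    (hy : y ∈ (jetChart e m).source) (u : TangentSpace 𝓘(ℝ, Coord n m) y) :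
    coordFrame e y (coordCoframe e y u) = u :=
  DFunLike.congr_fun ((jetChart_mdifferentiable e).symm_comp_deriv hy) u

theorem coordCoframe_coordFrame (e : AdaptedChart n π) {y : Jet n π m}
    (hy : y ∈ (jetChart e m).source) (v : Coord n m) :
    coordCoframe e y (coordFrame e y v) = v := by
  have h := (jetChart_mdifferentiable (m := m) e).comp_symm_deriv ((jetChart e m).map_source hy)
  rw [(jetChart e m).left_inv hy] at h
  exact DFunLike.congr_fun h v

theorem time_jetChart_symm (e : AdaptedChart n π) {c : Coord n m}
    (hc : c ∈ (jetChart e m).target) : Jet.time ((jetChart e m).symm c) = c.1 := by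
  have h : jetChart e m ((jetChart e m).symm c) = c := (jetChart e m).right_inv hc
  exact congrArg Prod.fst h

theorem dtForm_eq (e : AdaptedChart n π) {y : Jet n π m} (hy : y ∈ (jetChart e m).source) :
    dtForm y = (ContinuousLinearMap.fst ℝ ℝ (Fin (m + 1) → Fin n → ℝ)).comp
      (coordCoframe e y) := by
  have h1 : (Jet.time : Jet n π m → ℝ) = Prod.fst ∘ jetChart e m := rfl
  have h2 : HasMFDerivAt 𝓘(ℝ, Coord n m) 𝓘(ℝ, ℝ) (Prod.fst : Coord n m → ℝ) (jetChart e m y)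
      (ContinuousLinearMap.fst ℝ ℝ (Fin (m + 1) → Fin n → ℝ)) :=
    (hasFDerivAt_fst (𝕜 := ℝ) (p := jetChart e m y)).hasMFDerivAt
  have h3 := h2.comp y ((jetChart_mdifferentiable e).mdifferentiableAt hy).hasMFDerivAt
  rw [← h1] at h3
  exact h3.mfderiv

/-- The form `∑ p_A^i dq_i^A` in coordinates. -/
def pairing (p : Fin (m + 1) → Fin n → ℝ) : Coord n m →L[ℝ] ℝ :=
  ∑ i, ∑ A, p i A • ((ContinuousLinearMap.proj A).comp
    ((ContinuousLinearMap.proj (R := ℝ) (φ := fun _ : Fin (m + 1) => Fin n → ℝ) i).comp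
      (ContinuousLinearMap.snd ℝ ℝ (Fin (m + 1) → Fin n → ℝ))))

theorem pairing_apply (p : Fin (m + 1) → Fin n → ℝ) (v : Coord n m) :
    pairing p v = ∑ i, ∑ A, p i A * v.2 i A := by
  simp [pairing]

theorem pairing_single (p : Fin (m + 1) → Fin n → ℝ) (i : Fin (m + 1)) (A : Fin n) :
    pairing p (0, Pi.single i (Pi.single A 1)) = p i A := by
  rw [pairing_apply, Finset.sum_eq_single i, Finset.sum_eq_single A]
  · simp
  · intro B _ hB
    simp [hB]
  · simp
  · intro j _ hj
    simp [Pi.single_eq_of_ne hj]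
  · simp

theorem eq_pairing (a : Coord n m →L[ℝ] ℝ) (v : Coord n m) :
    a v = v.1 * a (1, 0) + pairing (fun i A => a (0, Pi.single i (Pi.single A 1))) v := by
  have hv : v = v.1 • ((1, 0) : Coord n m)
      + ∑ i, ∑ A, v.2 i A • ((0, Pi.single i (Pi.single A 1)) : Coord n m) := by
    refine Prod.ext ?_ ?_
    · simp [Prod.fst_sum]
    · funext j B
      simp only [Prod.snd_add, Prod.smul_snd, smul_zero, zero_add, Prod.snd_sum, Finset.sum_apply,
        Pi.smul_apply, smul_eq_mul]
      rw [Finset.sum_eq_single j, Finset.sum_eq_single B]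
      · simp
      · intro A _ hA
        simp [Pi.single_eq_of_ne hA.symm]
      · simp
      · intro i _ hi
        simp [Pi.single_eq_of_ne hi.symm]
      · simp
  conv_lhs => rw [hv]
  rw [map_add, map_smul, map_sum, pairing_apply, smul_eq_mul]
  congr 1
  refine Finset.sum_congr rfl fun i _ => ?_
  rw [map_sum]
  refine Finset.sum_congr rfl fun A _ => ?_
  rw [map_smul, smul_eq_mul, mul_comm]

theorem momentum_mk (e : AdaptedChart n π) {y : Jet n π m} (hy : y ∈ (jetChart e m).source)
    (α : TangentSpace 𝓘(ℝ, Coord n m) y →L[ℝ] ℝ) (i : Fin (m + 1)) (A : Fin n) :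
    Restricted.momentum e (⟨y, Submodule.Quotient.mk α⟩ : Restricted n π m) i A
      = α (partialQ e y i A) := by
  have h := (Submodule.Quotient.mk_surjective (Submodule.span ℝ {dtForm y})
    (Submodule.Quotient.mk α)).choose_spec
  set β := (Submodule.Quotient.mk_surjective (Submodule.span ℝ {dtForm y})
    (Submodule.Quotient.mk α)).choose with hβ
  rw [Submodule.Quotient.eq, Submodule.mem_span_singleton] at h
  obtain ⟨r, hr⟩ := h
  change β (partialQ e y i A) = α (partialQ e y i A)
  have h1 : dtForm y (partialQ e y i A) = 0 := by
    rw [dtForm_eq e hy]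
    change (coordCoframe e y (coordFrame e y (0, Pi.single i (Pi.single A 1)))).1 = 0
    rw [coordCoframe_coordFrame e hy]
  have h2 : (r • dtForm y) (partialQ e y i A) = (β - α) (partialQ e y i A) := by rw [hr]
  have h3 : r • dtForm y (partialQ e y i A) = β (partialQ e y i A) - α (partialQ e y i A) := h2
  rw [h1, smul_zero] at h3
  linarith

/-- The class of the covector `∑ p_A^i dq_i^A` at `y`. -/
def restrictedOfMomenta (e : AdaptedChart n π) (y : Jet n π m) (p : Fin (m + 1) → Fin n → ℝ) :
    Restricted n π m :=
  ⟨y, Submodule.Quotient.mk ((pairing p).comp (coordCoframe e y))⟩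

/-- The induced coordinates `(t, q_i^A, p_A^i)` on `J^m π^*`. -/
def restrictedPartialEquiv (e : AdaptedChart n π) (m : ℕ) :
    PartialEquiv (Restricted n π m) (Coord n m × (Fin (m + 1) → Fin n → ℝ)) where
  toFun x := (jetChart e m x.proj, x.momentum e)
  invFun c := restrictedOfMomenta e ((jetChart e m).symm c.1) c.2
  source := {x | x.proj ∈ (jetChart e m).source}
  target := (jetChart e m).target ×ˢ univ
  map_source' x hx := ⟨(jetChart e m).map_source hx, mem_univ _⟩
  map_target' c hc := (jetChart e m).map_target hc.1
  left_inv' := by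
    rintro ⟨y, x⟩ hy
    have hy : y ∈ (jetChart e m).source := hy
    obtain ⟨α, rfl⟩ := Submodule.Quotient.mk_surjective _ x
    change restrictedOfMomenta e ((jetChart e m).symm (jetChart e m y)) _ = _
    have hl : (jetChart e m).symm (jetChart e m y) = y := (jetChart e m).left_inv hy
    rw [hl]
    have hp : Restricted.momentum e (⟨y, Submodule.Quotient.mk α⟩ : Restricted n π m)
        = fun i A => α (partialQ e y i A) := by
      funext i A
      exact momentum_mk e hy α i A
    rw [hp, restrictedOfMomenta]
    refine congrArg (Restricted.mk y) ?_
    rw [Submodule.Quotient.eq, Submodule.mem_span_singleton]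
    refine ⟨-α (partialT e y), ?_⟩
    ext u
    have h1 := eq_pairing (α.comp (coordFrame e y)) (coordCoframe e y u)
    have h2 : (α.comp (coordFrame e y)) (coordCoframe e y u) = α u :=
      congrArg α (coordFrame_coordCoframe e hy u)
    rw [h2] at h1
    have h3 : dtForm y u = (coordCoframe e y u).1 := by
      rw [dtForm_eq e hy]
      rfl
    change -α (partialT e y) * dtForm y u = pairing _ (coordCoframe e y u) - α u
    rw [h1, h3]
    change -α (coordFrame e y (1, 0)) * _ = pairing (fun i A => α (coordFrame e y _)) _
      - (_ * α (coordFrame e y (1, 0)) + pairing (fun i A => α (coordFrame e y _)) _)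
    ring
  right_inv' := by
    rintro ⟨c, p⟩ ⟨hc, -⟩
    have hc : c ∈ (jetChart e m).target := hc
    have hy := (jetChart e m).map_target hc
    refine Prod.ext ((jetChart e m).right_inv hc) ?_
    funext i A
    change Restricted.momentum e (restrictedOfMomenta e _ p) i A = p i A
    rw [restrictedOfMomenta, momentum_mk e hy]
    change pairing p (coordCoframe e _ (coordFrame e _ _)) = _
    rw [coordCoframe_coordFrame e hy, pairing_single]

theorem restrictedPartialEquiv_trans_source (e e' : AdaptedChart n π) :
    ((restrictedPartialEquiv e m).symm.trans (restrictedPartialEquiv e' m)).source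
      = ((jetChart e m).symm.trans (jetChart e' m)).source ×ˢ univ := by
  ext ⟨c, p⟩
  constructor
  · rintro ⟨⟨h, -⟩, h'⟩
    exact ⟨⟨h, h'⟩, mem_univ _⟩
  · rintro ⟨⟨h, h'⟩, -⟩
    exact ⟨⟨h, mem_univ _⟩, h'⟩

theorem contDiffOn_jetChart_trans (e e' : AdaptedChart n π) :
    ContDiffOn ℝ ∞ ((jetChart e m).symm.trans (jetChart e' m))
      ((jetChart e m).symm.trans (jetChart e' m)).source :=
  contDiffOn_jetPartialEquiv_trans e e'

theorem coordCoframe_coordFrame' (e e' : AdaptedChart n π) {y : Jet n π m}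
    (hy : y ∈ (jetChart e m).source) (hy' : y ∈ (jetChart e' m).source) (v : Coord n m) :
    coordCoframe e y (coordFrame e' y v)
      = fderiv ℝ ((jetChart e' m).symm.trans (jetChart e m)) (jetChart e' m y) v := by
  have h1 := ((jetChart_mdifferentiable e').mdifferentiableAt_symm
    ((jetChart e' m).map_source hy')).hasMFDerivAt
  have h2 : MDifferentiableAt 𝓘(ℝ, Coord n m) 𝓘(ℝ, Coord n m) (jetChart e m)
      ((jetChart e' m).symm (jetChart e' m y)) := by
    rw [(jetChart e' m).left_inv hy']
    exact (jetChart_mdifferentiable e).mdifferentiableAt hy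
  have h3 := (h2.hasMFDerivAt.comp _ h1).mfderiv
  rw [mfderiv_eq_fderiv, (jetChart e' m).left_inv hy'] at h3
  exact (DFunLike.congr_fun h3 v).symm

theorem contDiffOn_restrictedPartialEquiv_trans (e e' : AdaptedChart n π) :
    ContDiffOn ℝ ∞ ((restrictedPartialEquiv e m).symm.trans (restrictedPartialEquiv e' m))
      ((restrictedPartialEquiv e m).symm.trans (restrictedPartialEquiv e' m)).source := by
  rw [restrictedPartialEquiv_trans_source]
  set Φ := (jetChart e m).symm.trans (jetChart e' m) with hΦ
  set Ψ := (jetChart e' m).symm.trans (jetChart e m) with hΨ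
  have hΦs : ContDiffOn ℝ ∞ (fun x : Coord n m × (Fin (m + 1) → Fin n → ℝ) => Φ x.1)
      (Φ.source ×ˢ univ) :=
    (contDiffOn_jetChart_trans e e').comp contDiff_fst.contDiffOn fun x hx => hx.1
  have hmaps : ∀ c ∈ Φ.source, Φ c ∈ Ψ.source := by
    rintro c ⟨hc, hc'⟩
    refine ⟨(jetChart e' m).map_source hc', ?_⟩
    change (jetChart e' m).symm (jetChart e' m ((jetChart e m).symm c)) ∈ (jetChart e m).source
    have hl : (jetChart e' m).symm (jetChart e' m ((jetChart e m).symm c))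
        = (jetChart e m).symm c := (jetChart e' m).left_inv hc'
    rw [hl]
    exact (jetChart e m).map_target hc
  have hD : ContDiffOn ℝ ∞ (fun x : Coord n m × (Fin (m + 1) → Fin n → ℝ) =>
      fderiv ℝ Ψ (Φ x.1)) (Φ.source ×ˢ univ) :=
    ((contDiffOn_jetChart_trans e' e).fderiv_of_isOpen Ψ.open_source (by simp)).comp hΦs
      fun x hx => hmaps _ hx.1
  have hmain : ContDiffOn ℝ ∞ (fun x : Coord n m × (Fin (m + 1) → Fin n → ℝ) =>
      (Φ x.1, fun (i : Fin (m + 1)) (A : Fin n) => ∑ j, ∑ B, x.2 j B *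
        (fderiv ℝ Ψ (Φ x.1) (0, Pi.single i (Pi.single A 1))).2 j B)) (Φ.source ×ˢ univ) := by
    refine hΦs.prodMk (contDiffOn_pi.2 fun i => contDiffOn_pi.2 fun A => ?_)
    refine ContDiffOn.sum fun j _ => ContDiffOn.sum fun B _ => ContDiffOn.mul ?_ ?_
    · exact ContDiff.contDiffOn (by fun_prop)
    · have h1 : ContDiffOn ℝ ∞ (fun x : Coord n m × (Fin (m + 1) → Fin n → ℝ) =>
          fderiv ℝ Ψ (Φ x.1) (0, Pi.single i (Pi.single A 1))) (Φ.source ×ˢ univ) :=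
        hD.clm_apply contDiffOn_const
      have h2 : ContDiff ℝ ∞ (fun v : Coord n m => v.2 j B) := by fun_prop
      exact h2.comp_contDiffOn h1
  refine hmain.congr ?_
  rintro ⟨c, p⟩ ⟨⟨hc, hc'⟩, -⟩
  have hc : c ∈ (jetChart e m).target := hc
  have hc' : (jetChart e m).symm c ∈ (jetChart e' m).source := hc'
  refine Prod.ext rfl ?_
  funext i A
  change Restricted.momentum e' (restrictedOfMomenta e ((jetChart e m).symm c) p) i A = _
  rw [restrictedOfMomenta, momentum_mk e' hc']
  change pairing p (coordCoframe e _ (coordFrame e' _ _)) = _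
  rw [coordCoframe_coordFrame' e e' ((jetChart e m).map_target hc) hc', pairing_apply]
  rfl

/-- The atlas of `J^m π^*` formed by the induced coordinate systems. -/
def restrictedCore (π : E → ℝ) [IsFibred n π] (m : ℕ) :
    ChartedSpaceCore (Coord n m × (Fin (m + 1) → Fin n → ℝ)) (Restricted n π m) where
  atlas := range fun e : AdaptedChart n π => restrictedPartialEquiv e m
  chartAt x := restrictedPartialEquiv
    (IsFibred.exists_adaptedChart (n := n) (π := π) x.proj.value).choose m
  mem_chart_source x := (IsFibred.exists_adaptedChart (n := n) (π := π) x.proj.value).choose_spec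
  chart_mem_atlas _ := mem_range_self _
  open_source := by
    rintro _ _ ⟨e, rfl⟩ ⟨e', rfl⟩
    rw [restrictedPartialEquiv_trans_source]
    exact ((jetChart e m).symm.trans (jetChart e' m)).open_source.prod isOpen_univ
  continuousOn_toFun := by
    rintro _ _ ⟨e, rfl⟩ ⟨e', rfl⟩
    exact (contDiffOn_restrictedPartialEquiv_trans e e').continuousOn

instance : TopologicalSpace (Restricted n π m) := (restrictedCore π m).toTopologicalSpace

instance : ChartedSpace (Coord n m × (Fin (m + 1) → Fin n → ℝ)) (Restricted n π m) :=
  (restrictedCore π m).toChartedSpace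

variable (n m) in
/-- The model of the manifold `J^m π^*`. -/
abbrev restrictedModel := 𝓘(ℝ, Coord n m × (Fin (m + 1) → Fin n → ℝ))

instance : IsManifold (restrictedModel n m) ∞ (Restricted n π m) := by
  refine isManifold_of_contDiffOn _ _ _ fun f f' hf hf' => ?_
  obtain ⟨_, ⟨e, rfl⟩, rfl⟩ := mem_iUnion₂.1 hf
  obtain ⟨_, ⟨e', rfl⟩, rfl⟩ := mem_iUnion₂.1 hf'
  have := contDiffOn_restrictedPartialEquiv_trans (m := m) e e'
  simp only [modelWithCornersSelf_coe, modelWithCornersSelf_coe_symm, Function.id_comp,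
    Function.comp_id, range_id, inter_univ, preimage_id]
  exact this

end Momenta

/-! ### General notions on manifolds -/

section Manifolds

variable {EM : Type*} [NormedAddCommGroup EM] [NormedSpace ℝ EM] {HM : Type*} [TopologicalSpace HM]
  (I : ModelWithCorners ℝ EM HM) {M : Type*} [TopologicalSpace M] [ChartedSpace HM M]

/-- `S` is an embedded submanifold of dimension `d` (for `M` without boundary): near each of its
points there is a chart of the smooth structure of `M` in which `S` is a `d`-dimensional linear
slice. -/
def IsEmbeddedSubmanifold (S : Set M) (d : ℕ) : Prop :=
  ∀ x ∈ S, ∃ φ ∈ IsManifold.maximalAtlas I ∞ M, x ∈ φ.source ∧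
    ∃ V : Submodule ℝ EM, Module.finrank ℝ V = d ∧ ∀ z ∈ φ.source, z ∈ S ↔ φ.extend I z ∈ V

/-- `u ∈ T_x M` is tangent to `S`: it is the velocity at `x` of a smooth curve lying in `S`. -/
def IsTangentTo (S : Set M) {x : M} (u : TangentSpace I x) : Prop :=
  ∃ γ : ℝ → M, ContMDiff 𝓘(ℝ, ℝ) I ∞ γ ∧ (∀ s, γ s ∈ S) ∧
    (⟨γ 0, mfderiv 𝓘(ℝ, ℝ) I γ 0 (1 : ℝ)⟩ : TangentBundle I M) = ⟨x, u⟩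

/-- `Y` restricts to a smooth vector field on the submanifold `S`; only its values on `S`
matter. -/
structure IsVectorFieldOn [IsManifold I 1 M] (S : Set M) (Y : (x : M) → TangentSpace I x) : Prop where
  contMDiffOn : ContMDiffOn I I.tangent ∞ (fun x => (⟨x, Y x⟩ : TangentBundle I M)) S
  isTangentTo : ∀ x ∈ S, IsTangentTo I S (Y x)

/-- The expression of a `1`-form in the preferred chart at `x`. -/
def oneFormInChart (θ : (x : M) → TangentSpace I x →L[ℝ] ℝ) (x : M) (z : EM) : EM →L[ℝ] ℝ :=
  (θ ((extChartAt I x).symm z)).comp (mfderiv 𝓘(ℝ, EM) I (extChartAt I x).symm z)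

/-- The exterior derivative `dθ(u, v)` of a `1`-form on a manifold without boundary, computed in
the preferred chart at the point. -/
def extDerivOneForm (θ : (x : M) → TangentSpace I x →L[ℝ] ℝ) (x : M)
    (u v : TangentSpace I x) : ℝ :=
  extDeriv (fun z => ContinuousAlternatingMap.ofSubsingleton ℝ EM ℝ (0 : Fin 1)
    (oneFormInChart I θ x z)) (extChartAt I x x)
    ![mfderiv I 𝓘(ℝ, EM) (extChartAt I x) x u, mfderiv I 𝓘(ℝ, EM) (extChartAt I x) x v]

end Manifolds

/-! ### The unified formalism -/

section Unified

variable {n : ℕ} {E : Type*} [TopologicalSpace E]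
  [ChartedSpace (EuclideanSpace ℝ (Fin (n + 1))) E] {π : E → ℝ} [IsFibred n π] {m : ℕ}

/-- The tautological `1`-form on `T^*(J^m π)`. -/
def tautologicalForm (α : Cotangent n π m) : TangentSpace (cotangentModel n m) α →L[ℝ] ℝ :=
  α.2.comp (mfderiv (cotangentModel n m) 𝓘(ℝ, Coord n m)
    (Bundle.TotalSpace.proj : Cotangent n π m → Jet n π m) α)

/-- The canonical symplectic form `-dΘ` on `T^*(J^m π)`. -/
def symplecticForm (α : Cotangent n π m) (u v : TangentSpace (cotangentModel n m) α) : ℝ :=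
  -extDerivOneForm (cotangentModel n m) tautologicalForm α u v

open Classical in
/-- The prolongation `s ↦ j^r_s φ` of a local section (constant outside of its open domain). -/
def PreJet.prolong (a : PreJet n π) (r : ℕ) (s : ℝ) : Jet n π r :=
  if h : s ∈ a.sec.dom then Jet.mk r ⟨a.sec, s, h⟩ else Jet.mk r a

/-- The holonomic lift `T(j^r φ)(∂/∂t)` at `y = j^m_t φ`, for `r < m`; it is a tangent vector at
`π^m_r(y) = j^r_t φ`. -/
def holonomicLift (r : ℕ) (y : Jet n π m) : TangentSpace 𝓘(ℝ, Coord n r) (y.proj r) :=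
  mfderiv 𝓘(ℝ, ℝ) 𝓘(ℝ, Coord n r) (y.rep.prolong r) y.rep.time (1 : ℝ)

variable (n π) in
/-- The product `J^{2k-1}π × T^*(J^{k-1}π)`, which contains the extended jet-momentum bundle. -/
abbrev Ambient (k : ℕ) : Type _ := Jet n π (2 * k - 1) × Cotangent n π (k - 1)

variable (n) in
/-- The model of the manifold `J^{2k-1}π × T^*(J^{k-1}π)`. -/
abbrev ambientModel (k : ℕ) :=
  𝓘(ℝ, Coord n (2 * k - 1)).prod (cotangentModel n (k - 1))

variable (n π) in
/-- The extended jet-momentum bundle `W = J^{2k-1}π ×_{J^{k-1}π} T^*(J^{k-1}π)`. -/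
def jetMomentum (k : ℕ) : Set (Ambient n π k) := {w | w.2.proj = w.1.proj (k - 1)}

/-- The projection `μ_W : W → W_r ⊆ J^{2k-1}π × J^{k-1}π^*`. -/
def restrictMomentum {k : ℕ} (w : Ambient n π k) : Jet n π (2 * k - 1) × Restricted n π (k - 1) :=
  (w.1, quotientMap w.2)

/-- The coupling function `Ĉ(y, α) = ⟨α, T(j^{k-1}φ)(∂/∂t)⟩` for `y = j^{2k-1}_t φ`. -/
def couplingFunction {k : ℕ} (w : Ambient n π k) : ℝ :=
  w.2.2 (holonomicLift (k - 1) w.1 : Coord n (k - 1))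

/-- The Hamiltonian submanifold `W_o = {w ∈ W | Ĉ(w) = L̂(w)}`, with `L̂` the pull-back of `L`. -/
def hamiltonianSubmanifold {k : ℕ} (L : Jet n π k → ℝ) : Set (Ambient n π k) :=
  {w | w ∈ jetMomentum n π k ∧ couplingFunction w = L (w.1.proj k)}

/-- The form `Ω_o`, the pull-back of the canonical symplectic form along the projection to
`T^*(J^{k-1}π)`; to be evaluated on vectors tangent to `W_o`. -/
def presymplecticForm {k : ℕ} (w : Ambient n π k) (u v : TangentSpace (ambientModel n k) w) : ℝ :=
  symplecticForm w.2
    (mfderiv (ambientModel n k) (cotangentModel n (k - 1)) Prod.snd w u)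
    (mfderiv (ambientModel n k) (cotangentModel n (k - 1)) Prod.snd w v)

/-- Vector fields on `W_o` that are vertical for the projection `ρ̂_2^o : W_o → J^{k-1}π^*`. -/
structure IsVerticalField {k : ℕ} (L : Jet n π k → ℝ)
    (Y : (w : Ambient n π k) → TangentSpace (ambientModel n k) w) : Prop where
  isVectorFieldOn : IsVectorFieldOn (ambientModel n k) (hamiltonianSubmanifold L) Y
  vertical : ∀ w ∈ hamiltonianSubmanifold L,
    mfderiv (ambientModel n k) (restrictedModel n (k - 1))
      (fun w : Ambient n π k => quotientMap w.2) w (Y w) = 0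

/-- The first constraint submanifold `W_c`: the points `w` of `W_o` at which the `1`-form
`i(Y)Ω_o` on `W_o` vanishes for every `ρ̂_2^o`-vertical vector field `Y` on `W_o`. -/
def constraintSubmanifold {k : ℕ} (L : Jet n π k → ℝ) : Set (Ambient n π k) :=
  {w | w ∈ hamiltonianSubmanifold L ∧
    ∀ Y : (w : Ambient n π k) → TangentSpace (ambientModel n k) w, IsVerticalField L Y →
      ∀ v : TangentSpace (ambientModel n k) w,
        IsTangentTo (ambientModel n k) (hamiltonianSubmanifold L) v →
          presymplecticForm w (Y w) v = 0}

/-! ### The Legendre–Ostrogradsky maps in coordinates -/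

/-- The coordinate function `q_r^A` (for `r ≤ m`). -/
def Coord.q (c : Coord n m) (r : ℕ) (A : Fin n) : ℝ :=
  if h : r < m + 1 then c.2 ⟨r, h⟩ A else 0

/-- The partial derivative `∂f/∂q_j^A` of a function of `(t, q_0, …, q_m)`. -/
def Coord.partialQ (j : ℕ) (A : Fin n) (f : Coord n m → ℝ) : Coord n m → ℝ :=
  fun c => fderiv ℝ f c (0, fun i => if (i : ℕ) = j then Pi.single A 1 else 0)

/-- The Lagrangian function in the induced coordinates of `J^k π`. -/
def localLagrangian (e : AdaptedChart n π) {k : ℕ} (L : Jet n π k → ℝ) : Coord n k → ℝ :=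
  fun c => L ((jetChart e k).symm c)

/-- The function `∑_{i=0}^{k-r} (-1)^i d_T^i(∂L/∂q_{r+i}^A)` of the coordinates of `J^{2k-1}π`,
for `1 ≤ r ≤ k`. -/
def ostrogradsky (e : AdaptedChart n π) {k : ℕ} (L : Jet n π k → ℝ) (r : ℕ) (A : Fin n)
    (c : Coord n (2 * k - 1)) : ℝ :=
  ∑ i ∈ Finset.range (k - r + 1), (-1) ^ i *
    totalDerivIter (Coord.partialQ (r + i) A (localLagrangian e L)) i (Coord.trunc (k + i) c)

/-- `FL : J^{2k-1}π → J^{k-1}π^*` has the local expression of the restricted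
Legendre–Ostrogradsky map in all adapted charts. -/
def IsRestrictedLegendre {k : ℕ} (L : Jet n π k → ℝ)
    (FL : Jet n π (2 * k - 1) → Restricted n π (k - 1)) : Prop :=
  ∀ (e : AdaptedChart n π), ∀ y ∈ (jetChart e (2 * k - 1)).source,
    (FL y).proj ∈ (jetChart e (k - 1)).source ∧
    (jetChart e (k - 1) (FL y).proj).1 = (jetChart e (2 * k - 1) y).1 ∧
    (∀ r < k, ∀ A, (jetChart e (k - 1) (FL y).proj).q r A = (jetChart e (2 * k - 1) y).q r A) ∧
    ∀ (s : Fin (k - 1 + 1)) (A : Fin n),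
      (FL y).momentum e s A = ostrogradsky e L (s + 1) A (jetChart e (2 * k - 1) y)

/-- `FL : J^{2k-1}π → T^*(J^{k-1}π)` has the local expression of the extended
Legendre–Ostrogradsky map in all adapted charts. -/
def IsExtendedLegendre {k : ℕ} (L : Jet n π k → ℝ)
    (FL : Jet n π (2 * k - 1) → Cotangent n π (k - 1)) : Prop :=
  ∀ (e : AdaptedChart n π), ∀ y ∈ (jetChart e (2 * k - 1)).source,
    (FL y).proj ∈ (jetChart e (k - 1)).source ∧
    (jetChart e (k - 1) (FL y).proj).1 = (jetChart e (2 * k - 1) y).1 ∧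
    (∀ r < k, ∀ A, (jetChart e (k - 1) (FL y).proj).q r A = (jetChart e (2 * k - 1) y).q r A) ∧
    (momentumT e (FL y) = localLagrangian e L (Coord.trunc k (jetChart e (2 * k - 1) y))
      - ∑ r ∈ Finset.Icc 1 k, ∑ A, (jetChart e (2 * k - 1) y).q r A *
          ostrogradsky e L r A (jetChart e (2 * k - 1) y)) ∧
    ∀ (s : Fin (k - 1 + 1)) (A : Fin n),
      momentumQ e (FL y) s A = ostrogradsky e L (s + 1) A (jetChart e (2 * k - 1) y)

end Unified

end SkinnerRusk

end

open SkinnerRusk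
open scoped Manifold ContDiff

open Set Filter Function
open scoped Manifold ContDiff Topology

noncomputable section

/-! In coordinates `W_o` is given by `p + ∑ p_A^i q_{i+1}^A = L`, the base point of the covector
being the truncation of the jet. The holonomic lift has time component `1`, so this can be solved
for `p`, and `W_o` is a graph. A vector tangent to `W_o` and vertical over `J^{k-1}π^*` has `δt =
δq_i = δp_A^i = 0` for `i < k`, and differentiating the equation leaves `δp = ∑ (∂L/∂q_k^A -
p_A^{k-1}) δq_k^A`. Its contraction with `Ω_o` is `-δp dt`. Since `W_o` has tangent vectors with `dt
≠ 0`, and since `∂/∂q_k^A` can be cut off to a global vertical field, `W_c` is the part of `W_o`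
where `p_A^{k-1} = ∂L/∂q_k^A` (`mem_constraintSubmanifold_iff`). Both sets are graphs over part of
the coordinates, and `isEmbeddedSubmanifold_of_forall_exists` makes them submanifolds.

`W_1` is the graph of the Legendre–Ostrogradsky covector `legendreCovector`. Its top momentum is
`∂L/∂q_k^A`, and its `p` is chosen so that its value on the holonomic lift is `L`; hence `W_1 ⊆
W_c`. The substance is that the covector does not depend on the adapted chart
(`legendreCovector_eq`). A tangent vector of `J^{k-1}π` is a multiple of the holonomic lift plus the
prolongation of a variation `ξ` of the section. On the lift the covector has the value `L` in every
chart. On the prolongation of `ξ` it gives the boundary term of the first variation formula `δL =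
(boundary term)' + (Euler–Lagrange expression) · ξ` (`hasDerivAt_boundaryTerm`).

That the boundary term is invariant is not checked by transforming the Ostrogradsky sums. Since `δL`
itself is invariant, the difference `Δ ξ` of the boundary terms in two charts is a local operator
whose derivative is bounded by `C ‖ξ‖`, because the Euler–Lagrange terms are of order zero in `ξ`.
Such an operator vanishes (`eq_zero_of_hasDerivAt_le`): cut `ξ` off to be zero near `t + δ` without
changing it near `t`; then `|Δ ξ t| ≤ K δ` with `K` independent of `δ`. -/

namespace SkinnerRusk

/-! ### Variations of functions along jet curves -/

section Variations

variable {n m : ℕ} {F : Type*} [NormedAddCommGroup F] [NormedSpace ℝ F]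

/-- `Coord.trunc` as a continuous linear map. -/
def Coord.truncL (n m r : ℕ) : Coord n m →L[ℝ] Coord n r where
  toFun := Coord.trunc r
  map_add' c c' := by
    ext i A
    · rfl
    · by_cases h : (i : ℕ) ≤ m <;> simp [Coord.trunc, h]
  map_smul' a c := by
    ext i A
    · rfl
    · by_cases h : (i : ℕ) ≤ m <;> simp [Coord.trunc, h]
  cont := (Coord.contDiff_trunc r).continuous

@[simp] theorem Coord.truncL_apply (r : ℕ) (c : Coord n m) :
    Coord.truncL n m r c = Coord.trunc r c := rfl

/-- The prolongation `(0, ξ(s), ξ'(s), …, ξ^{(m)}(s))` of a variation `ξ` of a curve. -/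
def jetVariation (ξ : ℝ → Fin n → ℝ) (m : ℕ) (s : ℝ) : Coord n m :=
  (0, fun i => iteratedDeriv i ξ s)

/-- The variation of `f(s, γ, …, γ^{(m)})` in the direction of `ξ`. -/
def variation (f : Coord n m → F) (γ ξ : ℝ → Fin n → ℝ) (s : ℝ) : F :=
  fderiv ℝ f (jetCurve γ m s) (jetVariation ξ m s)

theorem trunc_jetVariation (ξ : ℝ → Fin n → ℝ) {r : ℕ} (h : r ≤ m) (s : ℝ) :
    Coord.trunc r (jetVariation ξ m s) = jetVariation ξ r s := by
  ext i A
  · rfl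
  · have : (i : ℕ) < m + 1 := by omega
    simp [Coord.trunc, jetVariation, Nat.le_of_lt_succ this]

theorem hasDerivAt_jetVariation {ξ : ℝ → Fin n → ℝ} {s : ℝ} (hξ : ContDiffAt ℝ ∞ ξ s) (m : ℕ) :
    HasDerivAt (jetVariation ξ m) (0, fun i => iteratedDeriv ((i : ℕ) + 1) ξ s) s := by
  refine (hasDerivAt_const s (0 : ℝ)).prodMk ?_
  exact hasDerivAt_pi.2 fun i => hasDerivAt_iteratedDeriv hξ i

theorem contDiffOn_iteratedDeriv {γ : ℝ → F} {D : Set ℝ} (hD : IsOpen D)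
    (hγ : ContDiffOn ℝ ∞ γ D) (i : ℕ) : ContDiffOn ℝ ∞ (iteratedDeriv i γ) D := by
  intro s hs
  have h1 : ContDiffAt ℝ ∞ (iteratedFDeriv ℝ i γ) s :=
    (hγ.contDiffAt (hD.mem_nhds hs)).iteratedFDeriv_right (by exact_mod_cast le_top)
  rw [iteratedDeriv_eq_equiv_comp]
  exact ((LinearIsometryEquiv.contDiff _).comp_contDiffAt s h1).contDiffWithinAt

theorem contDiffOn_jetCurve {γ : ℝ → Fin n → ℝ} {D : Set ℝ} (hD : IsOpen D)
    (hγ : ContDiffOn ℝ ∞ γ D) (m : ℕ) : ContDiffOn ℝ ∞ (jetCurve γ m) D :=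
  contDiffOn_id.prodMk (contDiffOn_pi.2 fun i => contDiffOn_iteratedDeriv hD hγ i)

theorem contDiffOn_jetVariation {ξ : ℝ → Fin n → ℝ} {D : Set ℝ} (hD : IsOpen D)
    (hξ : ContDiffOn ℝ ∞ ξ D) (m : ℕ) : ContDiffOn ℝ ∞ (jetVariation ξ m) D :=
  contDiffOn_const.prodMk (contDiffOn_pi.2 fun i => contDiffOn_iteratedDeriv hD hξ i)

theorem contDiffOn_variation {f : Coord n m → F} {Ω : Set (Coord n m)} (hΩ : IsOpen Ω)
    (hf : ContDiffOn ℝ ∞ f Ω) {γ ξ : ℝ → Fin n → ℝ} {D : Set ℝ} (hD : IsOpen D)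
    (hγ : ContDiffOn ℝ ∞ γ D) (hξ : ContDiffOn ℝ ∞ ξ D) (hγΩ : ∀ s ∈ D, jetCurve γ m s ∈ Ω) :
    ContDiffOn ℝ ∞ (variation f γ ξ) D :=
  ((hf.fderiv_of_isOpen hΩ (by simp)).comp (contDiffOn_jetCurve hD hγ m) hγΩ).clm_apply
    (contDiffOn_jetVariation hD hξ m)

/-- Dropping the lowest order part of coordinates: the linear part of the holonomic lift. -/
def Coord.shiftL (n m : ℕ) : Coord n (m + 1) →L[ℝ] Coord n m :=
  ContinuousLinearMap.prod 0 (ContinuousLinearMap.pi fun i =>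
    (ContinuousLinearMap.proj (R := ℝ) (φ := fun _ : Fin (m + 2) => Fin n → ℝ) i.succ).comp
      (ContinuousLinearMap.snd ℝ ℝ _))

theorem Coord.trunc_succ (c : Coord n (m + 1)) :
    Coord.trunc m c = (c.1, fun i => c.2 i.castSucc) := by
  ext i A
  · rfl
  · simp only [Coord.trunc]
    rw [dif_pos (by omega)]
    rfl

/-- Written with the linear maps `truncL` and `shiftL`, the total derivative can be differentiated
by the chain rule. -/
theorem totalDeriv_eq (f : Coord n m → F) (c : Coord n (m + 1)) :
    totalDeriv f c = fderiv ℝ f (Coord.truncL n (m + 1) m c) ((1, 0) + Coord.shiftL n m c) := by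
  have h : ((1, 0) + Coord.shiftL n m c : Coord n m) = (1, fun i => c.2 i.succ) := by
    ext <;> simp [Coord.shiftL]
  rw [h, Coord.truncL_apply, Coord.trunc_succ]
  rfl

/-- The total time derivative commutes with variations. -/
theorem hasDerivAt_variation {f : Coord n m → F} {γ ξ : ℝ → Fin n → ℝ} {s : ℝ}
    (hγ : ContDiffAt ℝ ∞ γ s) (hξ : ContDiffAt ℝ ∞ ξ s)
    (hf : ContDiffAt ℝ ∞ f (jetCurve γ m s)) :
    HasDerivAt (variation f γ ξ) (variation (totalDeriv f) γ ξ s) s := by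
  have hd : DifferentiableAt ℝ (fderiv ℝ f) (jetCurve γ m s) :=
    (hf.fderiv_right (m := ∞) (by simp)).differentiableAt (by simp)
  have h1 := (hd.hasFDerivAt.comp_hasDerivAt s (hasDerivAt_jetCurve hγ m)).clm_apply
    (hasDerivAt_jetVariation hξ m)
  have htr : Coord.truncL n (m + 1) m (jetCurve γ (m + 1) s) = jetCurve γ m s :=
    trunc_jetCurve γ (by omega) s
  have h3 : HasFDerivAt (fderiv ℝ f) (fderiv ℝ (fderiv ℝ f) (jetCurve γ m s))
      (Coord.truncL n (m + 1) m (jetCurve γ (m + 1) s)) := htr ▸ hd.hasFDerivAt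
  have h4 := (h3.comp _ (Coord.truncL n (m + 1) m).hasFDerivAt).clm_apply
    ((Coord.shiftL n m).hasFDerivAt.const_add ((1, 0) : Coord n m))
  have h2 := h4.congr_of_eventuallyEq (f₁ := totalDeriv f)
    (Eventually.of_forall fun c => totalDeriv_eq f c)
  -- The derivative along the curve contains `D²f(γ', ξ)`, the variation of `d_T f` contains `D²f(ξ,
  -- γ')`; symmetry identifies them.
  have hsymm := hf.isSymmSndFDerivAt (by simpa using ENat.LEInfty.out)
  refine h1.congr_deriv ?_
  rw [variation, h2.fderiv]
  simp only [comp_apply, _root_.add_apply, ContinuousLinearMap.comp_apply,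
    ContinuousLinearMap.flip_apply, htr]
  rw [add_comm]
  have e1 : Coord.shiftL n m (jetVariation ξ (m + 1) s)
      = (0, fun i : Fin (m + 1) => iteratedDeriv ((i : ℕ) + 1) ξ s) := by
    ext <;> simp [Coord.shiftL, jetVariation]
  have e2 : ((1, 0) + Coord.shiftL n m (jetCurve γ (m + 1) s) : Coord n m)
      = (1, fun i : Fin (m + 1) => iteratedDeriv ((i : ℕ) + 1) γ s) := by
    ext <;> simp [Coord.shiftL, jetCurve]
  rw [e1, e2, Coord.truncL_apply, trunc_jetVariation ξ (by omega), hsymm]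

/-- Applied with `f` a transition of fibre coordinates, this shows that coordinate changes map
prolonged variations to prolonged variations. -/
theorem iteratedDeriv_variation {f : Coord n m → F} {Ω : Set (Coord n m)} (hΩ : IsOpen Ω)
    (hf : ContDiffOn ℝ ∞ f Ω) {γ ξ : ℝ → Fin n → ℝ} {D : Set ℝ} (hD : IsOpen D)
    (hγ : ContDiffOn ℝ ∞ γ D) (hξ : ContDiffOn ℝ ∞ ξ D) (hγΩ : ∀ s ∈ D, jetCurve γ m s ∈ Ω)
    (i : ℕ) : ∀ s ∈ D, iteratedDeriv i (variation f γ ξ) s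
      = variation (totalDerivIter f i) γ ξ s := by
  induction i with
  | zero => intro s _; simp [totalDerivIter]
  | succ i ih =>
    intro s hs
    have h1 : iteratedDeriv i (variation f γ ξ) =ᶠ[𝓝 s] variation (totalDerivIter f i) γ ξ := by
      filter_upwards [hD.mem_nhds hs] with x hx using ih x hx
    rw [iteratedDeriv_succ, h1.deriv_eq]
    have h2 : IsOpen {c : Coord n (m + i) | Coord.trunc m c ∈ Ω} :=
      hΩ.preimage (Coord.contDiff_trunc (n := n) (m := m + i) m).continuous
    have h3 : jetCurve γ (m + i) s ∈ {c : Coord n (m + i) | Coord.trunc m c ∈ Ω} := by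
      change Coord.trunc m _ ∈ Ω
      rw [trunc_jetCurve γ (by omega)]
      exact hγΩ s hs
    exact (hasDerivAt_variation (hγ.contDiffAt (hD.mem_nhds hs)) (hξ.contDiffAt (hD.mem_nhds hs))
      ((contDiffOn_totalDerivIter hΩ hf i).contDiffAt (h2.mem_nhds h3))).deriv

end Variations

/-! ### Ostrogradsky momenta and the first variation formula -/

section FirstVariation

variable {n k : ℕ}

/-- The Ostrogradsky momentum `∑_i (-1)^i (d/ds)^i (∂f/∂q_{r+i}^A)` along a curve. -/
def curveMomentum (f : Coord n k → ℝ) (γ : ℝ → Fin n → ℝ) (r : ℕ) (A : Fin n) (s : ℝ) : ℝ :=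
  ∑ i ∈ Finset.range (k - r + 1),
    (-1) ^ i * iteratedDeriv i (fun s => Coord.partialQ (r + i) A f (jetCurve γ k s)) s

/-- The boundary term of the first variation formula. -/
def boundaryTerm (f : Coord n k → ℝ) (γ ξ : ℝ → Fin n → ℝ) (s : ℝ) : ℝ :=
  ∑ r ∈ Finset.range k, ∑ A, curveMomentum f γ (r + 1) A s * iteratedDeriv r ξ s A

theorem contDiffOn_partialQ {f : Coord n k → ℝ} {Ω : Set (Coord n k)} (hΩ : IsOpen Ω)
    (hf : ContDiffOn ℝ ∞ f Ω) (j : ℕ) (A : Fin n) :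
    ContDiffOn ℝ ∞ (Coord.partialQ j A f) Ω :=
  (hf.fderiv_of_isOpen hΩ (by simp)).clm_apply contDiffOn_const

variable {f : Coord n k → ℝ} {Ω : Set (Coord n k)} (hΩ : IsOpen Ω) (hf : ContDiffOn ℝ ∞ f Ω)
  {γ : ℝ → Fin n → ℝ} {D : Set ℝ} (hD : IsOpen D) (hγ : ContDiffOn ℝ ∞ γ D)
  (hγΩ : ∀ s ∈ D, jetCurve γ k s ∈ Ω)

include hΩ hf hD hγ hγΩ

theorem contDiffOn_curveMomentum (r : ℕ) (A : Fin n) :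
    ContDiffOn ℝ ∞ (curveMomentum f γ r A) D := by
  refine ContDiffOn.sum fun i _ => contDiffOn_const.mul (contDiffOn_iteratedDeriv hD ?_ i)
  exact (contDiffOn_partialQ hΩ hf _ A).comp (contDiffOn_jetCurve hD hγ k) hγΩ

/-- The recursion behind integration by parts. Differentiation turns the sum for `r + 1` into minus
the terms `i ≥ 1` of the sum for `r`; the missing term `i = 0` is the partial derivative. The bound
on `r` makes the truncated subtractions match. -/
theorem hasDerivAt_curveMomentum {r : ℕ} (hr : r < k) (A : Fin n) {s : ℝ} (hs : s ∈ D) :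
    HasDerivAt (curveMomentum f γ (r + 1) A)
      (Coord.partialQ r A f (jetCurve γ k s) - curveMomentum f γ r A s) s := by
  have h1 : ∀ i, HasDerivAt
      (iteratedDeriv i (fun s => Coord.partialQ (r + 1 + i) A f (jetCurve γ k s)))
      (iteratedDeriv (i + 1) (fun s => Coord.partialQ (r + 1 + i) A f (jetCurve γ k s)) s) s := by
    intro i
    rw [iteratedDeriv_succ]
    exact ((contDiffOn_iteratedDeriv hD ((contDiffOn_partialQ hΩ hf _ A).comp
      (contDiffOn_jetCurve hD hγ k) hγΩ) i).contDiffAt (hD.mem_nhds hs)).differentiableAt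
        (by simp) |>.hasDerivAt
  have h2 := HasDerivAt.fun_sum (u := Finset.range (k - (r + 1) + 1))
    fun i _ => (h1 i).const_mul ((-1 : ℝ) ^ i)
  refine h2.congr_deriv ?_
  rw [curveMomentum, show k - r + 1 = (k - (r + 1) + 1) + 1 by omega,
    Finset.sum_range_succ' _ (k - (r + 1) + 1)]
  simp only [pow_zero, one_mul, iteratedDeriv_zero, add_zero]
  rw [sub_add_cancel_right, ← Finset.sum_neg_distrib]
  refine Finset.sum_congr rfl fun i _ => ?_
  rw [pow_succ, show r + (i + 1) = r + 1 + i by ring]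
  ring

omit hΩ hf hD hγ hγΩ in
theorem variation_eq_sum (ξ : ℝ → Fin n → ℝ) (s : ℝ) :
    variation f γ ξ s = ∑ r ∈ Finset.range (k + 1), ∑ A,
      Coord.partialQ r A f (jetCurve γ k s) * iteratedDeriv r ξ s A := by
  rw [variation, eq_pairing, pairing_apply, Finset.sum_range]
  simp only [jetVariation, zero_mul, zero_add]
  refine Finset.sum_congr rfl fun r _ => Finset.sum_congr rfl fun A _ => ?_
  rw [Coord.partialQ]
  congr 3
  funext i
  by_cases h : i = r
  · subst h; simp
  · have : (i : ℕ) ≠ r := fun h' => h (Fin.ext h')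
    simp [Pi.single_eq_of_ne h, this]

/-- The first variation formula. -/
theorem hasDerivAt_boundaryTerm {ξ : ℝ → Fin n → ℝ} (hξ : ContDiffOn ℝ ∞ ξ D) {s : ℝ}
    (hs : s ∈ D) :
    HasDerivAt (boundaryTerm f γ ξ)
      (variation f γ ξ s - ∑ A, curveMomentum f γ 0 A s * ξ s A) s := by
  have h1 := HasDerivAt.fun_sum (u := Finset.range k) fun r hr =>
    HasDerivAt.fun_sum (u := (Finset.univ : Finset (Fin n))) fun A _ =>
      (hasDerivAt_curveMomentum hΩ hf hD hγ hγΩ (Finset.mem_range.1 hr) A hs).mul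
        (hasDerivAt_pi.1 (hasDerivAt_iteratedDeriv (hξ.contDiffAt (hD.mem_nhds hs)) r) A)
  refine h1.congr_deriv ?_
  -- By the recursion the momentum terms telescope over `r`. Only the Euler–Lagrange term, at `r =
  -- 0`, and the term at `r = k` survive.
  have h2 : ∀ r, ∑ A, ((Coord.partialQ r A f (jetCurve γ k s) - curveMomentum f γ r A s)
        * iteratedDeriv r ξ s A + curveMomentum f γ (r + 1) A s * iteratedDeriv (r + 1) ξ s A)
      = ∑ A, Coord.partialQ r A f (jetCurve γ k s) * iteratedDeriv r ξ s A
        + (∑ A, curveMomentum f γ (r + 1) A s * iteratedDeriv (r + 1) ξ s A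
          - ∑ A, curveMomentum f γ r A s * iteratedDeriv r ξ s A) := by
    intro r
    rw [← Finset.sum_sub_distrib, ← Finset.sum_add_distrib]
    exact Finset.sum_congr rfl fun A _ => by ring
  simp only [h2]
  rw [Finset.sum_add_distrib,
    Finset.sum_range_sub fun r => ∑ A, curveMomentum f γ r A s * iteratedDeriv r ξ s A,
    variation_eq_sum, Finset.sum_range_succ]
  -- The surviving top term supplies the order `k` summand that is missing from the variation.
  have h3 : ∀ A, curveMomentum f γ k A s = Coord.partialQ k A f (jetCurve γ k s) := by
    intro A
    simp [curveMomentum]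
  simp only [h3, iteratedDeriv_zero]
  ring

end FirstVariation

/-! ### Uniqueness and invariance of the boundary term -/

/-- A local operator whose derivative is of order zero vanishes. -/
theorem eq_zero_of_hasDerivAt_le {n : ℕ} (Δ : (ℝ → Fin n → ℝ) → ℝ → ℝ) {t C : ℝ}
    (hloc : ∀ ξ η : ℝ → Fin n → ℝ, ∀ s, ξ =ᶠ[𝓝 s] η → Δ ξ s = Δ η s) (hzero : Δ 0 = 0)
    (hΔ : ∀ᶠ s in 𝓝 t, ∀ ξ : ℝ → Fin n → ℝ, ContDiff ℝ ∞ ξ →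
      ∃ d, HasDerivAt (Δ ξ) d s ∧ |d| ≤ C * ‖ξ s‖)
    (ξ : ℝ → Fin n → ℝ) (hξ : ContDiff ℝ ∞ ξ) : Δ ξ t = 0 := by
  have hC : ∀ᶠ s in 𝓝 t, ‖ξ s‖ ≤ ‖ξ t‖ + 1 :=
    (hξ.continuous.norm.continuousAt.eventually (gt_mem_nhds (lt_add_one ‖ξ t‖))).mono
      fun s hs => hs.le
  obtain ⟨δ₀, hδ₀, hball⟩ := Metric.eventually_nhds_iff.1 (hΔ.and hC)
  set K := |C| * (‖ξ t‖ + 1) with hK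
  have hK0 : 0 ≤ K := by positivity
  have key : ∀ δ, 0 < δ → δ < δ₀ → |Δ ξ t| ≤ K * δ := by
    intro δ hδ hδ'
    -- The outer radius is less than `δ`, so `χ • ξ` equals `ξ` near `t` and vanishes near `t + δ`.
    let χ : ContDiffBump t := ⟨δ / 3, δ / 2, by positivity, by linarith⟩
    set η : ℝ → Fin n → ℝ := fun s => χ s • ξ s with hη
    have hηs : ContDiff ℝ ∞ η := χ.contDiff.smul hξ
    have h1 : Δ ξ t = Δ η t := by
      refine hloc _ _ _ ?_
      filter_upwards [χ.eventuallyEq_one] with s hs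
      simp [hη, hs]
    have h2 : Δ η (t + δ) = 0 := by
      have : η =ᶠ[𝓝 (t + δ)] 0 := by
        have hopen : IsOpen {s : ℝ | δ / 2 < dist s t} :=
          isOpen_lt continuous_const (by fun_prop)
        filter_upwards [hopen.mem_nhds (show δ / 2 < dist (t + δ) t by
          simp [abs_of_pos hδ]; linarith)] with s hs
        have : χ s = 0 := χ.zero_of_le_dist (le_of_lt hs)
        simp [hη, this]
      rw [hloc _ _ _ this, hzero]
      rfl
    have h3 : ∀ s ∈ Icc t (t + δ), ∃ d, HasDerivAt (Δ η) d s ∧ |d| ≤ K := by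
      intro s hs
      have hs' : dist s t < δ₀ := by
        rw [Real.dist_eq, abs_of_nonneg (by linarith [hs.1])]
        linarith [hs.2]
      obtain ⟨d, hd, hd'⟩ := (hball hs').1 η hηs
      refine ⟨d, hd, hd'.trans ?_⟩
      have h4 : ‖η s‖ ≤ ‖ξ t‖ + 1 := by
        rw [hη, norm_smul, Real.norm_of_nonneg χ.nonneg]
        calc χ s * ‖ξ s‖ ≤ 1 * ‖ξ s‖ := by gcongr; exact χ.le_one
          _ ≤ _ := by rw [one_mul]; exact (hball hs').2
      calc C * ‖η s‖ ≤ |C| * ‖η s‖ := by gcongr; exact le_abs_self C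
        _ ≤ K := by rw [hK]; gcongr
    choose! d hd hd' using h3
    -- The mean value inequality between `t` and `t + δ`. The derivatives of `χ`, which blow up as
    -- `δ → 0`, do not enter: the bound involves only the values of `χ • ξ`, and `0 ≤ χ ≤ 1`.
    have h5 := (convex_Icc t (t + δ)).norm_image_sub_le_of_norm_hasDerivWithin_le
      (fun s hs => (hd s hs).hasDerivWithinAt) (fun s hs => hd' s hs)
      (left_mem_Icc.2 (by linarith)) (right_mem_Icc.2 (by linarith))
    rw [h2, zero_sub, norm_neg, Real.norm_eq_abs, add_sub_cancel_left, Real.norm_of_nonneg hδ.le]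
      at h5
    rw [h1]
    exact h5
  have hlim : Tendsto (fun δ : ℝ => K * δ) (𝓝[>] 0) (𝓝 (K * 0)) :=
    ((continuous_const.mul continuous_id).tendsto 0).mono_left nhdsWithin_le_nhds
  rw [mul_zero] at hlim
  have hev : ∀ᶠ δ in 𝓝[>] (0 : ℝ), |Δ ξ t| ≤ K * δ := by
    filter_upwards [Ioo_mem_nhdsGT hδ₀] with δ hδ using key δ hδ.1 hδ.2
  exact abs_nonpos_iff.1 (ge_of_tendsto hlim hev)

section Invariance

variable {n m k : ℕ} {F : Type*} [NormedAddCommGroup F] [NormedSpace ℝ F]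

theorem jetVariation_congr {ξ η : ℝ → Fin n → ℝ} {s : ℝ} (h : ξ =ᶠ[𝓝 s] η) :
    jetVariation ξ m s = jetVariation η m s :=
  Prod.ext rfl (funext fun i => h.iteratedDeriv_eq i)

theorem variation_congr {f : Coord n m → F} {γ ξ η : ℝ → Fin n → ℝ} {s : ℝ}
    (h : ξ =ᶠ[𝓝 s] η) : variation f γ ξ =ᶠ[𝓝 s] variation f γ η := by
  filter_upwards [h.eventuallyEq_nhds] with x hx
  rw [variation, jetVariation_congr hx, variation]

theorem boundaryTerm_congr {f : Coord n k → ℝ} {γ ξ η : ℝ → Fin n → ℝ} {s : ℝ}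
    (h : ξ =ᶠ[𝓝 s] η) : boundaryTerm f γ ξ s = boundaryTerm f γ η s := by
  simp only [boundaryTerm, h.iteratedDeriv_eq]

theorem variation_zero (f : Coord n m → F) (γ : ℝ → Fin n → ℝ) : variation f γ 0 = 0 := by
  funext s
  have : jetVariation (0 : ℝ → Fin n → ℝ) m s = 0 :=
    Prod.ext rfl (funext fun i => by simp [jetVariation])
  simp [variation, this]

theorem boundaryTerm_zero (f : Coord n k → ℝ) (γ : ℝ → Fin n → ℝ) : boundaryTerm f γ 0 = 0 := by
  funext s
  simp [boundaryTerm]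

theorem abs_sum_mul_le (p v : Fin n → ℝ) : |∑ A, p A * v A| ≤ (∑ A, |p A|) * ‖v‖ := by
  rw [Finset.sum_mul]
  refine (Finset.abs_sum_le_sum_abs _ _).trans (Finset.sum_le_sum fun A _ => ?_)
  rw [abs_mul]
  gcongr
  exact norm_le_pi_norm v A

theorem norm_jetVariation_zero_le (ξ : ℝ → Fin n → ℝ) (s : ℝ) :
    ‖jetVariation ξ 0 s‖ ≤ ‖ξ s‖ := by
  refine norm_prod_le_iff.2 ⟨by simp [jetVariation], ?_⟩
  refine (pi_norm_le_iff_of_nonneg (norm_nonneg _)).2 fun i => ?_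
  rw [Subsingleton.elim (α := Fin 1) i 0]
  simp [jetVariation]

/-- The boundary term of the first variation is determined by the variation of the Lagrangian, and
hence invariant under changes of fibre coordinates. -/
theorem boundaryTerm_eq {f f' : Coord n k → ℝ} {Ω Ω' : Set (Coord n k)} (hΩ : IsOpen Ω)
    (hΩ' : IsOpen Ω') (hf : ContDiffOn ℝ ∞ f Ω) (hf' : ContDiffOn ℝ ∞ f' Ω')
    {γ γ' : ℝ → Fin n → ℝ} {D : Set ℝ} (hD : IsOpen D) (hγ : ContDiffOn ℝ ∞ γ D)
    (hγ' : ContDiffOn ℝ ∞ γ' D) (hγΩ : ∀ s ∈ D, jetCurve γ k s ∈ Ω)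
    (hγΩ' : ∀ s ∈ D, jetCurve γ' k s ∈ Ω') {g : Coord n 0 → Fin n → ℝ} {U : Set (Coord n 0)}
    (hU : IsOpen U) (hg : ContDiffOn ℝ ∞ g U) (hγU : ∀ s ∈ D, jetCurve γ 0 s ∈ U)
    (hvar : ∀ ξ : ℝ → Fin n → ℝ, ContDiff ℝ ∞ ξ → ∀ s ∈ D,
      variation f γ ξ s = variation f' γ' (variation g γ ξ) s)
    {ξ : ℝ → Fin n → ℝ} (hξ : ContDiff ℝ ∞ ξ) {t : ℝ} (ht : t ∈ D) :
    boundaryTerm f γ ξ t = boundaryTerm f' γ' (variation g γ ξ) t := by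
  -- `curveMomentum` with `r = 0` is the Euler–Lagrange expression. Since `g` is a function of `(t,
  -- q_0)`, its variation depends on `ξ` only through the value `ξ s`; so both Euler–Lagrange terms
  -- together are at most `K s * ‖ξ s‖`.
  set K : ℝ → ℝ := fun s => (∑ A, |curveMomentum f γ 0 A s|)
    + (∑ A, |curveMomentum f' γ' 0 A s|) * ‖fderiv ℝ g (jetCurve γ 0 s)‖ with hK
  have hKc : ContinuousAt K t := by
    have h1 : ContinuousOn K D := by
      refine (continuousOn_finsetSum _ fun A _ =>
        (contDiffOn_curveMomentum hΩ hf hD hγ hγΩ 0 A).continuousOn.abs).add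
        ((continuousOn_finsetSum _ fun A _ =>
          (contDiffOn_curveMomentum hΩ' hf' hD hγ' hγΩ' 0 A).continuousOn.abs).mul ?_)
      exact ((hg.fderiv_of_isOpen hU (m := ∞) (by simp)).comp
        (contDiffOn_jetCurve hD hγ 0) hγU).continuousOn.norm
    exact h1.continuousAt (hD.mem_nhds ht)
  -- By continuity `K t + 1` dominates `K` near `t`.
  have h := eq_zero_of_hasDerivAt_le (t := t) (C := K t + 1)
    (fun ξ s => boundaryTerm f γ ξ s - boundaryTerm f' γ' (variation g γ ξ) s)
    (fun ξ η s h => by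
      simp only [boundaryTerm_congr h, boundaryTerm_congr (variation_congr h)])
    (by simp only [variation_zero, boundaryTerm_zero]; simp; rfl) ?_ ξ hξ
  · exact sub_eq_zero.1 h
  filter_upwards [hD.mem_nhds ht, hKc.eventually (gt_mem_nhds (lt_add_one (K t)))] with s hs hsK
  intro ξ hξ
  have h1 := hasDerivAt_boundaryTerm hΩ hf hD hγ hγΩ hξ.contDiffOn hs
  have h2 := hasDerivAt_boundaryTerm hΩ' hf' hD hγ' hγΩ'
    (contDiffOn_variation hU hg hD hγ hξ.contDiffOn hγU) hs
  refine ⟨_, h1.sub h2, ?_⟩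
  -- The variations of the two Lagrangians cancel; the Euler–Lagrange terms remain.
  rw [hvar ξ hξ s hs, sub_sub_sub_cancel_left]
  have h3 : ‖variation g γ ξ s‖ ≤ ‖fderiv ℝ g (jetCurve γ 0 s)‖ * ‖ξ s‖ :=
    (ContinuousLinearMap.le_opNorm _ _).trans (by
      gcongr
      exact norm_jetVariation_zero_le ξ s)
  calc _ ≤ |∑ A, curveMomentum f' γ' 0 A s * variation g γ ξ s A|
        + |∑ A, curveMomentum f γ 0 A s * ξ s A| := abs_sub _ _
    _ ≤ (∑ A, |curveMomentum f' γ' 0 A s|) * (‖fderiv ℝ g (jetCurve γ 0 s)‖ * ‖ξ s‖)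
        + (∑ A, |curveMomentum f γ 0 A s|) * ‖ξ s‖ := by
      gcongr
      · exact (abs_sum_mul_le _ _).trans (by gcongr)
      · exact abs_sum_mul_le _ _
    _ = K s * ‖ξ s‖ := by rw [hK]; ring
    _ ≤ (K t + 1) * ‖ξ s‖ := by gcongr

end Invariance

/-! ### Prolonged variations under coordinate changes -/

section Transition

variable {n : ℕ} {E : Type*} [TopologicalSpace E]
  [ChartedSpace (EuclideanSpace ℝ (Fin (n + 1))) E] {π : E → ℝ} {m : ℕ}

/-- Prolongations of variations are transformed to prolongations of variations. -/
theorem fderiv_jetTransition (e e' : AdaptedChart n π) {γ ξ : ℝ → Fin n → ℝ} {D : Set ℝ}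
    (hD : IsOpen D) (hγ : ContDiffOn ℝ ∞ γ D) (hξ : ContDiffOn ℝ ∞ ξ D)
    (hγU : ∀ s ∈ D, jetCurve γ 0 s ∈ transitionDomain e e') {s : ℝ} (hs : s ∈ D) :
    fderiv ℝ (jetTransition e e' m) (jetCurve γ m s) (jetVariation ξ m s)
      = jetVariation (variation (fibreTransition e e') γ ξ) m s := by
  have hd : ∀ i : Fin (m + 1), DifferentiableAt ℝ (totalDerivIter (fibreTransition e e') i)
      (Coord.truncL n m (0 + i) (jetCurve γ m s)) := by
    intro i
    have hopen : IsOpen {c : Coord n (0 + i) | Coord.trunc 0 c ∈ transitionDomain e e'} :=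
      (isOpen_transitionDomain e e').preimage (Coord.contDiff_trunc 0).continuous
    refine ((contDiffOn_totalDerivIter (isOpen_transitionDomain e e')
      (contDiffOn_fibreTransition e e') i).contDiffAt (hopen.mem_nhds ?_)).differentiableAt
      (by simp)
    change Coord.trunc 0 (Coord.trunc (0 + (i : ℕ)) _) ∈ transitionDomain e e'
    rw [trunc_jetCurve _ (by omega), trunc_jetCurve _ (by omega)]
    exact hγU s hs
  have h1 : HasFDerivAt (jetTransition e e' m) (_ : Coord n m →L[ℝ] Coord n m)
      (jetCurve γ m s) :=
    hasFDerivAt_fst.prodMk (hasFDerivAt_pi.2 fun i =>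
      (hd i).hasFDerivAt.comp _ (Coord.truncL n m (0 + i)).hasFDerivAt)
  rw [h1.fderiv]
  refine Prod.ext rfl (funext fun i => ?_)
  -- The `i`th component of the transition is `d_T^i` of the fibre transition, so its variation is
  -- the `i`th derivative of the variation of the fibre transition.
  have h2 := iteratedDeriv_variation (isOpen_transitionDomain e e')
    (contDiffOn_fibreTransition e e') hD hγ hξ hγU i s hs
  change _ = iteratedDeriv i (variation (fibreTransition e e') γ ξ) s
  have hi : 0 + (i : ℕ) ≤ m := by omega
  rw [h2, variation, ← trunc_jetCurve γ hi, ← trunc_jetVariation ξ hi]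
  rfl

end Transition

/-! ### Induced coordinates on jet bundles and the holonomic lift -/

section JetCoordinates

variable {n : ℕ} {E : Type*} [TopologicalSpace E]
  [ChartedSpace (EuclideanSpace ℝ (Fin (n + 1))) E] {π : E → ℝ} [IsFibred n π] {m : ℕ}

omit [IsFibred n π] in
theorem Jet.value_proj (r : ℕ) (y : Jet n π m) : (y.proj r).value = y.value :=
  Jet.value_mk _

theorem proj_mem_source (r : ℕ) {e : AdaptedChart n π} {y : Jet n π m} :
    y.proj r ∈ (jetChart e r).source ↔ y ∈ (jetChart e m).source := by
  rw [mem_jetChart_source, Jet.value_proj, mem_jetChart_source]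

theorem jetChart_apply (e : AdaptedChart n π) (y : Jet n π m) :
    jetChart e m y = jetCurve (y.rep.sec.coord e) m y.rep.time := rfl

theorem jetChart_mk (e : AdaptedChart n π) {a : PreJet n π} (h : a.value ∈ e.source) :
    jetChart e m (Jet.mk m a) = jetCurve (a.sec.coord e) m a.time :=
  Jet.coords_mk a e h

theorem jetChart_proj {r : ℕ} (hr : r ≤ m) {e : AdaptedChart n π} {y : Jet n π m}
    (hy : y ∈ (jetChart e m).source) :
    jetChart e r (y.proj r) = Coord.trunc r (jetChart e m y) := by
  rw [Jet.proj, jetChart_mk e hy, jetChart_apply, trunc_jetCurve _ hr]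

theorem jetChart_eq_jetTransition {e e' : AdaptedChart n π} {y : Jet n π m}
    (hy : y ∈ (jetChart e m).source) (hy' : y ∈ (jetChart e' m).source) :
    jetChart e' m y = jetTransition e e' m (jetChart e m y) :=
  y.rep.coords_eq_jetTransition e e' hy hy'

-- Chart domains constrain only `(t, q_0)`. Hence coordinates of positive order may be moved freely
-- inside a chart.
omit [IsFibred n π] in
theorem mem_jetTarget_trunc {e : AdaptedChart n π} {r : ℕ} {c : Coord n m} :
    Coord.trunc r c ∈ jetTarget e r ↔ c ∈ jetTarget e m := by
  simp [jetTarget, Coord.trunc]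

theorem isOpen_jetTarget (e : AdaptedChart n π) (m : ℕ) : IsOpen (jetTarget e m) :=
  (jetChart e m).open_target

theorem jetChart_mem_maximalAtlas (e : AdaptedChart n π) (m : ℕ) :
    jetChart e m ∈ IsManifold.maximalAtlas 𝓘(ℝ, Coord n m) ∞ (Jet n π m) :=
  IsManifold.subset_maximalAtlas (jetChart_mem_atlas e m)

theorem contMDiffOn_jetChart (e : AdaptedChart n π) (m : ℕ) :
    ContMDiffOn 𝓘(ℝ, Coord n m) 𝓘(ℝ, Coord n m) ∞ (jetChart e m) (jetChart e m).source :=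
  contMDiffOn_of_mem_maximalAtlas (jetChart_mem_maximalAtlas e m)

theorem contMDiffOn_jetChart_symm (e : AdaptedChart n π) (m : ℕ) :
    ContMDiffOn 𝓘(ℝ, Coord n m) 𝓘(ℝ, Coord n m) ∞ (jetChart e m).symm (jetTarget e m) :=
  contMDiffOn_symm_of_mem_maximalAtlas (jetChart_mem_maximalAtlas e m)

theorem exists_mem_jetChart_source (y : Jet n π m) :
    ∃ e : AdaptedChart n π, y ∈ (jetChart e m).source :=
  IsFibred.exists_adaptedChart y.value

theorem value_eq {e : AdaptedChart n π} {y : Jet n π m} (hy : y ∈ (jetChart e m).source) :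
    y.value = e.toOpenPartialHomeomorph.symm ((jetChart e m y).1, (jetChart e m y).2 0) := by
  have h := e.apply_sec y.rep.sec y.rep.mem_dom hy
  have h2 : ((jetChart e m y).1, (jetChart e m y).2 0)
      = e.toOpenPartialHomeomorph (y.rep.sec.toFun y.rep.time) := by
    rw [h, jetChart_apply]
    simp [jetCurve]
  rw [h2]
  exact (e.toOpenPartialHomeomorph.left_inv hy).symm

/-- Pulls bump functions on `E` back to jet bundles; the vertical vector fields below are cut off in
this way. -/
theorem contMDiff_value : ContMDiff 𝓘(ℝ, Coord n m) (𝓡 (n + 1)) ∞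
    (Jet.value : Jet n π m → E) := by
  intro y
  obtain ⟨e, he⟩ := exists_mem_jetChart_source y
  have h1 : ContMDiffOn 𝓘(ℝ, Coord n m) (𝓡 (n + 1)) ∞
      (fun y => e.toOpenPartialHomeomorph.symm ((jetChart e m y).1, (jetChart e m y).2 0))
      (jetChart e m).source := by
    have h2 : ContMDiff 𝓘(ℝ, Coord n m) 𝓘(ℝ, ℝ × (Fin n → ℝ)) ∞
        (fun c : Coord n m => (c.1, c.2 0)) := by
      rw [contMDiff_iff_contDiff]; fun_prop
    exact (e.contMDiffOn_invFun.comp h2.contMDiffOn (t := e.target) (s := jetTarget e m)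
      fun c hc => hc).comp (contMDiffOn_jetChart e m) fun y hy => (jetChart e m).map_source hy
  exact (h1.congr fun y hy => value_eq hy).contMDiffAt ((jetChart e m).open_source.mem_nhds he)

section Lagrangian

variable {k : ℕ} {L : Jet n π k → ℝ}

theorem localLagrangian_jetChart {e : AdaptedChart n π} {y : Jet n π k}
    (hy : y ∈ (jetChart e k).source) : localLagrangian e L (jetChart e k y) = L y :=
  congrArg L ((jetChart e k).left_inv hy)

theorem contDiffOn_localLagrangian (hL : ContMDiff 𝓘(ℝ, Coord n k) 𝓘(ℝ, ℝ) ∞ L)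
    (e : AdaptedChart n π) : ContDiffOn ℝ ∞ (localLagrangian e L) (jetTarget e k) := by
  rw [← contMDiffOn_iff_contDiffOn]
  exact hL.comp_contMDiffOn (contMDiffOn_jetChart_symm e k)

theorem localLagrangian_jetTransition {e e' : AdaptedChart n π} {c : Coord n k}
    (hc : Coord.trunc 0 c ∈ transitionDomain e e') :
    localLagrangian e' L (jetTransition e e' k c) = localLagrangian e L c := by
  have h : c ∈ ((jetPartialEquiv e k).symm.trans (jetPartialEquiv e' k)).source := by
    rw [jetPartialEquiv_trans_source]; exact hc
  have h1 : c ∈ (jetChart e k).target := h.1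
  have h2 : (jetChart e k).symm c ∈ (jetChart e' k).source := h.2
  have h3 := jetChart_eq_jetTransition ((jetChart e k).map_target h1) h2
  rw [(jetChart e k).right_inv h1] at h3
  rw [← h3, localLagrangian_jetChart h2]
  rfl

end Lagrangian

/-- The coordinate expression `(1, q_1, …, q_{r+1})` of the holonomic lift. -/
def Coord.lift {n m : ℕ} (r : ℕ) (c : Coord n m) : Coord n r :=
  (1, 0) + Coord.shiftL n r (Coord.trunc (r + 1) c)

theorem Coord.lift_jetCurve (γ : ℝ → Fin n → ℝ) {r : ℕ} (hr : r < m) (s : ℝ) :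
    Coord.lift r (jetCurve γ m s) = (1, fun i : Fin (r + 1) => iteratedDeriv ((i : ℕ) + 1) γ s) := by
  rw [Coord.lift, trunc_jetCurve γ (by omega)]
  ext <;> simp [Coord.shiftL, jetCurve]

/-- The lift is defined through a chosen representative section. In a chart its prolongation is
`jetCurve`, whose velocity is `(1, q_1, …, q_{r+1})`; as `r < m`, this is determined by the jet
alone. -/
theorem holonomicLift_eq {r : ℕ} (hr : r < m) {e : AdaptedChart n π} {y : Jet n π m}
    (hy : y ∈ (jetChart e m).source) :
    holonomicLift r y = coordFrame e (y.proj r) (Coord.lift r (jetChart e m y)) := by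
  set γ := y.rep.sec.coord e with hγ
  set t := y.rep.time with ht
  have hD := y.rep.sec.isOpen_domIn e
  have htD : t ∈ y.rep.sec.domIn e := ⟨y.rep.mem_dom, hy⟩
  have h1 : y.rep.prolong r =ᶠ[𝓝 t] (jetChart e r).symm ∘ jetCurve γ r := by
    filter_upwards [hD.mem_nhds htD] with s hs
    rw [PreJet.prolong, dif_pos hs.1, comp_apply]
    set b : PreJet n π := ⟨y.rep.sec, s, hs.1⟩
    have hb : b.value ∈ e.source := hs.2
    have h2 := jetChart_mk (m := r) e hb
    have hb' : Jet.mk r b ∈ (jetChart e r).source := by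
      rw [mem_jetChart_source, Jet.value_mk]; exact hb
    rw [← (jetChart e r).left_inv hb', h2]
  have h2 : HasMFDerivAt 𝓘(ℝ, ℝ) 𝓘(ℝ, Coord n r) (jetCurve γ r) t
      (ContinuousLinearMap.toSpanSingleton ℝ
        ((1, fun i => iteratedDeriv ((i : ℕ) + 1) γ t) : Coord n r)) :=
    (hasDerivAt_jetCurve ((y.rep.sec.contDiffOn_coord e).contDiffAt (hD.mem_nhds htD)) r
      ).hasFDerivAt.hasMFDerivAt
  have h3 : jetChart e r (y.proj r) = jetCurve γ r t := jetChart_mk e hy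
  have h4 : HasMFDerivAt 𝓘(ℝ, Coord n r) 𝓘(ℝ, Coord n r) (jetChart e r).symm (jetCurve γ r t)
      (coordFrame e (y.proj r)) := by
    have := ((jetChart_mdifferentiable (m := r) e).mdifferentiableAt_symm
      ((jetChart e r).map_source ((proj_mem_source r).2 hy))).hasMFDerivAt
    rw [coordFrame, ← h3]
    exact this
  have h5 := ((h4.comp t h2).congr_of_eventuallyEq h1).mfderiv
  rw [jetChart_apply, Coord.lift_jetCurve _ hr, holonomicLift, h5]
  change coordFrame e (y.proj r) ((1 : ℝ) • _) = _
  rw [one_smul]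

end JetCoordinates

/-! ### Charts with values in the model vector space, slices, tangent vectors -/

section SmoothCharts

variable {EM : Type*} [NormedAddCommGroup EM] [NormedSpace ℝ EM] {HM : Type*} [TopologicalSpace HM]
  {I : ModelWithCorners ℝ EM HM} {M : Type*} [TopologicalSpace M] [ChartedSpace HM M]

variable (I) in
/-- `Φ` is a diffeomorphism from an open subset of `M` onto an open subset of the vector space on
which `M` is modelled. -/
structure IsSmoothChart (Φ : OpenPartialHomeomorph M EM) : Prop where
  contMDiffOn : ContMDiffOn I 𝓘(ℝ, EM) ∞ Φ Φ.source
  contMDiffOn_symm : ContMDiffOn 𝓘(ℝ, EM) I ∞ Φ.symm Φ.target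

namespace IsSmoothChart

variable {Φ : OpenPartialHomeomorph M EM} (hΦ : IsSmoothChart I Φ)
include hΦ

theorem contMDiffAt {x : M} (hx : x ∈ Φ.source) : ContMDiffAt I 𝓘(ℝ, EM) ∞ Φ x :=
  hΦ.contMDiffOn.contMDiffAt (Φ.open_source.mem_nhds hx)

theorem contMDiffAt_symm {z : EM} (hz : z ∈ Φ.target) : ContMDiffAt 𝓘(ℝ, EM) I ∞ Φ.symm z :=
  hΦ.contMDiffOn_symm.contMDiffAt (Φ.open_target.mem_nhds hz)

theorem mdifferentiable : Φ.MDifferentiable I 𝓘(ℝ, EM) :=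
  ⟨hΦ.contMDiffOn.mdifferentiableOn (by simp), hΦ.contMDiffOn_symm.mdifferentiableOn (by simp)⟩

theorem symm_comp_apply {x : M} (hx : x ∈ Φ.source) (u : TangentSpace I x) :
    mfderiv 𝓘(ℝ, EM) I Φ.symm (Φ x) (mfderiv I 𝓘(ℝ, EM) Φ x u) = u :=
  DFunLike.congr_fun (hΦ.mdifferentiable.symm_comp_deriv hx) u

theorem comp_symm_apply {x : M} (hx : x ∈ Φ.source) (v : EM) :
    mfderiv I 𝓘(ℝ, EM) Φ x (mfderiv 𝓘(ℝ, EM) I Φ.symm (Φ x) v) = v := by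
  have h := hΦ.mdifferentiable.comp_symm_deriv (Φ.map_source hx)
  rw [Φ.left_inv hx] at h
  exact DFunLike.congr_fun h v

theorem trans_shear {Ψ : OpenPartialHomeomorph EM EM} (h : ContDiffOn ℝ ∞ Ψ Ψ.source)
    (h' : ContDiffOn ℝ ∞ Ψ.symm Ψ.target) : IsSmoothChart I (Φ.trans Ψ) where
  contMDiffOn := h.contMDiffOn.comp (hΦ.contMDiffOn.mono fun _ hx => hx.1) fun _ hx => hx.2
  contMDiffOn_symm := hΦ.contMDiffOn_symm.comp (h'.contMDiffOn.mono fun _ hx => hx.1)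
    fun _ hx => hx.2

theorem prod {EM' : Type*} [NormedAddCommGroup EM'] [NormedSpace ℝ EM'] {HM' : Type*}
    [TopologicalSpace HM'] {I' : ModelWithCorners ℝ EM' HM'} {M' : Type*} [TopologicalSpace M']
    [ChartedSpace HM' M'] {Φ' : OpenPartialHomeomorph M' EM'} (hΦ' : IsSmoothChart I' Φ') :
    IsSmoothChart (I.prod I') (Φ.prod Φ') where
  contMDiffOn := (hΦ.contMDiffOn.comp contMDiffOn_fst fun _ hx => hx.1).prodMk_space
    (hΦ'.contMDiffOn.comp contMDiffOn_snd fun _ hx => hx.2)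
  contMDiffOn_symm :=
    (hΦ.contMDiffOn_symm.comp contDiff_fst.contMDiff.contMDiffOn fun _ hx => hx.1).prodMk
    (hΦ'.contMDiffOn_symm.comp contDiff_snd.contMDiff.contMDiffOn fun _ hx => hx.2)

variable [I.Boundaryless]

/-- Charts of the atlas take values in `HM` and smooth charts in `EM`; without boundary the
homeomorphism `I` translates between the two. -/
theorem mem_maximalAtlas [IsManifold I ∞ M] :
    Φ.trans I.toHomeomorph.symm.toOpenPartialHomeomorph ∈ IsManifold.maximalAtlas I ∞ M := by
  refine OpenPartialHomeomorph.mem_maximalAtlas_of_contMDiffOn _ ?_ ?_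
  · have h := I.contMDiffOn_symm (n := ∞)
    rw [I.range_eq_univ] at h
    exact h.comp (hΦ.contMDiffOn.mono fun x hx => hx.1) fun x _ => mem_univ _
  · exact hΦ.contMDiffOn_symm.comp I.contMDiff.contMDiffOn fun x hx => hx.2

omit hΦ in
theorem of_mem_maximalAtlas {φ : OpenPartialHomeomorph M HM}
    (hφ : φ ∈ IsManifold.maximalAtlas I ∞ M) :
    IsSmoothChart I (φ.trans I.toHomeomorph.toOpenPartialHomeomorph) where
  contMDiffOn := I.contMDiff.comp_contMDiffOn
    ((contMDiffOn_of_mem_maximalAtlas hφ).mono fun x hx => hx.1)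
  contMDiffOn_symm := by
    have h := I.contMDiffOn_symm (n := ∞)
    rw [I.range_eq_univ] at h
    exact (contMDiffOn_symm_of_mem_maximalAtlas hφ).comp (h.mono (subset_univ _)) fun x hx => hx.2

end IsSmoothChart

/-- A set which in suitable charts has the form `ρ z = g z`, for a linear surjection `ρ` with
section `σ` and `g` constant along the range of `σ`, is a submanifold of dimension
`dim M - rank ρ`. -/
theorem isEmbeddedSubmanifold_of_forall_exists [I.Boundaryless] [IsManifold I ∞ M]
    [FiniteDimensional ℝ EM] {F : Type*} [NormedAddCommGroup F] [NormedSpace ℝ F] {S : Set M}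
    {d : ℕ} (hd : Module.finrank ℝ EM = d + Module.finrank ℝ F)
    (ρ : EM →L[ℝ] F) (σ : F →L[ℝ] EM) (hρσ : ∀ f, ρ (σ f) = f)
    (h : ∀ x ∈ S, ∃ Φ : OpenPartialHomeomorph M EM, IsSmoothChart I Φ ∧ x ∈ Φ.source ∧
      ∃ (U : Set EM) (g : EM → F), IsOpen U ∧ Φ.target ⊆ U ∧ ContDiffOn ℝ ∞ g U ∧
        (∀ z ∈ U, ∀ f, z + σ f ∈ U ∧ g (z + σ f) = g z) ∧
        ∀ y ∈ Φ.source, y ∈ S ↔ ρ (Φ y) = g (Φ y)) :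
    IsEmbeddedSubmanifold I S d := by
  intro x hx
  obtain ⟨Φ, hΦ, hxΦ, U, g, hU, hΦU, hg, hinv, hS⟩ := h x hx
  have hinv' : ∀ z ∈ U, ∀ f, z - σ f ∈ U ∧ g (z - σ f) = g z := by
    intro z hz f
    simpa [sub_eq_add_neg] using hinv z hz (-f)
  have hc : ContDiffOn ℝ ∞ (fun z => z - σ (g z)) U :=
    contDiffOn_id.sub (σ.contDiff.comp_contDiffOn hg)
  have hc' : ContDiffOn ℝ ∞ (fun z => z + σ (g z)) U :=
    contDiffOn_id.add (σ.contDiff.comp_contDiffOn hg)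
  -- A shear along the range of `σ`. Because `g` is constant in that direction, adding `σ (g z)`
  -- inverts it, and since `ρ (z - σ (g z)) = ρ z - g z`, it carries `S` to the kernel of `ρ`.
  let Ψ : OpenPartialHomeomorph EM EM :=
    { toFun := fun z => z - σ (g z)
      invFun := fun z => z + σ (g z)
      source := U
      target := U
      map_source' := fun z hz => (hinv' z hz _).1
      map_target' := fun z hz => (hinv z hz _).1
      left_inv' := fun z hz => by simp [(hinv' z hz _).2]
      right_inv' := fun z hz => by simp [(hinv z hz _).2]
      open_source := hU
      open_target := hU
      continuousOn_toFun := hc.continuousOn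
      continuousOn_invFun := hc'.continuousOn }
  have hΨ := hΦ.trans_shear (Ψ := Ψ) hc hc'
  refine ⟨_, hΨ.mem_maximalAtlas, ⟨⟨hxΦ, hΦU (Φ.map_source hxΦ)⟩, mem_univ _⟩,
    LinearMap.ker (ρ : EM →ₗ[ℝ] F), ?_, ?_⟩
  · have hsurj : LinearMap.range (ρ : EM →ₗ[ℝ] F) = ⊤ :=
      LinearMap.range_eq_top.2 fun f => ⟨σ f, hρσ f⟩
    have := (ρ : EM →ₗ[ℝ] F).finrank_range_add_finrank_ker
    rw [hsurj, finrank_top] at this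
    omega
  · rintro z ⟨⟨hz, -⟩, -⟩
    have h1 : ((Φ.trans Ψ).trans I.toHomeomorph.symm.toOpenPartialHomeomorph).extend I z
        = Φ z - σ (g (Φ z)) := I.toHomeomorph.apply_symm_apply _
    rw [hS z hz, h1, LinearMap.mem_ker]
    change _ ↔ ρ _ = 0
    rw [map_sub, hρσ, sub_eq_zero]

/-- A smooth curve in a chart domain with values in `S` has tangent velocities. -/
theorem isTangentTo_of_curve {Φ : OpenPartialHomeomorph M EM} (hΦ : IsSmoothChart I Φ) {S : Set M}
    {c : ℝ → EM} (hc : ContDiff ℝ ∞ c) (hcΦ : ∀ s, c s ∈ Φ.target) (hcS : ∀ s, Φ.symm (c s) ∈ S)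
    {x : M} (hx : x ∈ Φ.source) (h0 : c 0 = Φ x) {v : EM} (hv : HasDerivAt c v 0) :
    IsTangentTo I S (x := x) (mfderiv 𝓘(ℝ, EM) I Φ.symm (Φ x) v) := by
  refine ⟨fun s => Φ.symm (c s), fun s => ?_, hcS, ?_⟩
  · exact (hΦ.contMDiffAt_symm (hcΦ s)).comp s hc.contMDiff.contMDiffAt
  · have h1 := ((hΦ.contMDiffAt_symm (hcΦ 0)).mdifferentiableAt (by simp)).hasMFDerivAt.comp 0
      hv.hasFDerivAt.hasMFDerivAt
    have h2 : mfderiv 𝓘(ℝ, ℝ) I (fun s => Φ.symm (c s)) 0 (1 : ℝ)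
        = mfderiv 𝓘(ℝ, EM) I Φ.symm (c 0) v := by
      have h3 := congrArg (fun T => T (1 : ℝ)) h1.mfderiv
      refine h3.trans ?_
      change mfderiv 𝓘(ℝ, EM) I Φ.symm (c 0) ((1 : ℝ) • v) = _
      rw [one_smul]
    -- The base points `Φ.symm (c 0)` and `x` are equal but not definitionally, so the vectors are
    -- compared in the total space.
    have h5 : ∀ (z : EM), z = Φ x → (⟨Φ.symm z, mfderiv 𝓘(ℝ, EM) I Φ.symm z v⟩ : TangentBundle I M)
        = ⟨x, mfderiv 𝓘(ℝ, EM) I Φ.symm (Φ x) v⟩ := by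
      rintro _ rfl
      have h6 : ∀ (x' : M) (u : EM), x' = x →
          (⟨x', u⟩ : TangentBundle I M) = ⟨x, u⟩ := by rintro _ u rfl; rfl
      exact h6 _ _ (Φ.left_inv hx)
    refine Eq.trans ?_ (h5 _ h0)
    exact congrArg (fun u : EM => (⟨Φ.symm (c 0), u⟩ : TangentBundle I M)) h2

/-- Tangent vectors in a chart are velocities of curves. -/
theorem IsTangentTo.exists_curve {Φ : OpenPartialHomeomorph M EM} (hΦ : IsSmoothChart I Φ)
    {S : Set M} {x : M} (hx : x ∈ Φ.source) {u : TangentSpace I x} (hu : IsTangentTo I S u) :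
    ∃ γ : ℝ → M, Continuous γ ∧ (∀ s, γ s ∈ S) ∧ γ 0 = x ∧
      HasDerivAt (fun s => Φ (γ s)) (mfderiv I 𝓘(ℝ, EM) Φ x u) 0 := by
  obtain ⟨γ, hγ, hγS, h⟩ := hu
  refine ⟨γ, hγ.continuous, hγS, congrArg Bundle.TotalSpace.proj h, ?_⟩
  have h0 : γ 0 = x := congrArg Bundle.TotalSpace.proj h
  subst h0
  have hu : mfderiv 𝓘(ℝ, ℝ) I γ 0 (1 : ℝ) = u :=
    eq_of_heq (Bundle.TotalSpace.mk.inj h).2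
  have h1 := ((hΦ.contMDiffAt hx).mdifferentiableAt (by simp)).hasMFDerivAt.comp 0
    (hγ.contMDiffAt.mdifferentiableAt (by simp)).hasMFDerivAt
  let A : EM →L[ℝ] EM := mfderiv I 𝓘(ℝ, EM) Φ (γ 0)
  let B : ℝ →L[ℝ] EM := mfderiv 𝓘(ℝ, ℝ) I γ 0
  have h2 : HasFDerivAt (fun s => Φ (γ s)) (A.comp B) 0 := hasMFDerivAt_iff_hasFDerivAt.1 h1
  rw [← hu]
  exact h2.hasDerivAt

/-- On the chart domain `Y` is the pull-back of `V` along `Φ`, because the differential of `Φ.symm`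
inverts that of `Φ`; pull-backs of smooth fields by local diffeomorphisms are smooth. -/
theorem contMDiffAt_vectorField [FiniteDimensional ℝ EM] [IsManifold I 1 M] [IsManifold I ∞ M]
    {Φ : OpenPartialHomeomorph M EM}
    (hΦ : IsSmoothChart I Φ) {V : EM → EM} {x : M} (hx : x ∈ Φ.source)
    (hV : ContDiffAt ℝ ∞ V (Φ x)) {Y : (x : M) → TangentSpace I x}
    (hY : ∀ y ∈ Φ.source, Y y = mfderiv 𝓘(ℝ, EM) I Φ.symm (Φ y) (V (Φ y))) :
    ContMDiffAt I I.tangent ∞ (fun x => (⟨x, Y x⟩ : TangentBundle I M)) x := by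
  have hcomplete : CompleteSpace EM := FiniteDimensional.complete ℝ EM
  have hV' : ContMDiffAt 𝓘(ℝ, EM) 𝓘(ℝ, EM).tangent ∞
      (fun z => (⟨z, V z⟩ : TangentBundle 𝓘(ℝ, EM) EM)) (Φ x) :=
    contMDiffAt_vectorSpace_iff_contDiffAt.2 hV
  have hinv : ∀ y (hy : y ∈ Φ.source), mfderiv I 𝓘(ℝ, EM) Φ y
      = (hΦ.mdifferentiable.mfderiv hy :
        TangentSpace I y →L[ℝ] TangentSpace 𝓘(ℝ, EM) (Φ y)) := fun y hy => rfl
  have h1 := ContMDiffAt.mpullback_vectorField_preimage (n := ∞) (m := ∞) (V := V) hV'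
    (hΦ.contMDiffAt hx) (by rw [hinv x hx]; exact ContinuousLinearMap.isInvertible_equiv)
    (by simp)
  refine h1.congr_of_eventuallyEq ?_
  filter_upwards [Φ.open_source.mem_nhds hx] with y hy
  have h2 : VectorField.mpullback I 𝓘(ℝ, EM) Φ V y = Y y := by
    have h3 : (mfderiv I 𝓘(ℝ, EM) Φ y).inverse
        = ((hΦ.mdifferentiable.mfderiv hy).symm :
          TangentSpace 𝓘(ℝ, EM) (Φ y) →L[ℝ] TangentSpace I y) := by
      rw [hinv y hy]
      exact ContinuousLinearMap.inverse_equiv _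
    exact (congrArg (fun T => T (V (Φ y))) h3).trans (hY y hy).symm
  rw [h2]

end SmoothCharts

/-! ### The exterior derivative of a 1-form in an arbitrary chart -/

section ExteriorDerivative

variable {EM : Type*} [NormedAddCommGroup EM] [NormedSpace ℝ EM] {HM : Type*} [TopologicalSpace HM]
  {I : ModelWithCorners ℝ EM HM} {M : Type*} [TopologicalSpace M] [ChartedSpace HM M]

theorem extDeriv_ofSubsingleton {β : EM → EM →L[ℝ] ℝ} {z : EM} (hβ : DifferentiableAt ℝ β z)
    (u v : EM) :
    extDeriv (fun z => ContinuousAlternatingMap.ofSubsingleton ℝ EM ℝ (0 : Fin 1) (β z)) z ![u, v]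
      = fderiv ℝ β z u v - fderiv ℝ β z v u := by
  have h : DifferentiableAt ℝ
      (fun z => ContinuousAlternatingMap.ofSubsingleton ℝ EM ℝ (0 : Fin 1) (β z)) z :=
    (ContinuousAlternatingMap.ofSubsingletonLIE (𝕜 := ℝ) (E := EM) (F := ℝ) (ι := Fin 1) (i := 0)).differentiable.differentiableAt.comp
      z hβ
  have hd : ∀ w : EM, fderiv ℝ (fun z => β z w) z = (fderiv ℝ β z).flip w := by
    intro w
    ext x
    rw [fderiv_clm_apply hβ (differentiableAt_const w)]
    simp
  rw [extDeriv_apply h]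
  simp [Fin.sum_univ_two, Fin.removeNth, hd, sub_eq_add_neg]

/-- The exterior derivative of a `1`-form may be computed in any chart. -/
theorem extDerivOneForm_eq [I.Boundaryless] [IsManifold I ∞ M] {Φ : OpenPartialHomeomorph M EM}
    (hΦ : IsSmoothChart I Φ) {θ : (x : M) → TangentSpace I x →L[ℝ] ℝ} {β : EM → EM →L[ℝ] ℝ}
    (hθ : ∀ z ∈ Φ.target, ∀ v : EM, θ (Φ.symm z) (mfderiv 𝓘(ℝ, EM) I Φ.symm z v) = β z v)
    {x : M} (hx : x ∈ Φ.source) (hβ : DifferentiableAt ℝ β (Φ x)) (u v : TangentSpace I x) :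
    extDerivOneForm I θ x u v
      = fderiv ℝ β (Φ x) (mfderiv I 𝓘(ℝ, EM) Φ x u) (mfderiv I 𝓘(ℝ, EM) Φ x v)
        - fderiv ℝ β (Φ x) (mfderiv I 𝓘(ℝ, EM) Φ x v) (mfderiv I 𝓘(ℝ, EM) Φ x u) := by
  -- The preferred chart at `x`, in which `extDerivOneForm` is defined; `τ` is the change of
  -- coordinates from it to `Φ`.
  set Ψ : OpenPartialHomeomorph M EM :=
    (chartAt HM x).trans I.toHomeomorph.toOpenPartialHomeomorph with hΨdef
  have hΨ : IsSmoothChart I Ψ :=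
    IsSmoothChart.of_mem_maximalAtlas (IsManifold.chart_mem_maximalAtlas x)
  have hxΨ : x ∈ Ψ.source := ⟨mem_chart_source HM x, mem_univ _⟩
  set τ : EM → EM := fun z => Φ (Ψ.symm z) with hτ
  have hτx : τ (Ψ x) = Φ x := by rw [hτ]; simp only; rw [Ψ.left_inv hxΨ]
  set N := (Ψ.symm.trans Φ).source with hN
  have hNx : Ψ x ∈ N := ⟨Ψ.map_source hxΨ, by
    change Ψ.symm (Ψ x) ∈ Φ.source
    rwa [Ψ.left_inv hxΨ]⟩
  have hNo : IsOpen N := (Ψ.symm.trans Φ).open_source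
  have hτc : ContDiffOn ℝ ∞ τ N := by
    rw [← contMDiffOn_iff_contDiffOn]
    exact hΦ.contMDiffOn.comp (hΨ.contMDiffOn_symm.mono fun z hz => hz.1) fun z hz => hz.2
  have hfd : ∀ z ∈ N, ∀ v : EM, fderiv ℝ τ z v
      = mfderiv I 𝓘(ℝ, EM) Φ (Ψ.symm z) (mfderiv 𝓘(ℝ, EM) I Ψ.symm z v) := by
    intro z hz v
    have h1 := (hΦ.mdifferentiable.mdifferentiableAt hz.2).hasMFDerivAt.comp z
      (hΨ.mdifferentiable.mdifferentiableAt_symm hz.1).hasMFDerivAt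
    let A : EM →L[ℝ] EM := mfderiv I 𝓘(ℝ, EM) Φ (Ψ.symm z)
    let B : EM →L[ℝ] EM := mfderiv 𝓘(ℝ, EM) I Ψ.symm z
    have h2 : HasFDerivAt τ (A.comp B) z := hasMFDerivAt_iff_hasFDerivAt.1 h1
    rw [h2.fderiv]
    rfl
  -- The expression of `θ` in the preferred chart is the pull-back of `β` along `τ`; the claim then
  -- follows because `d` commutes with pull-back.
  have hform : ∀ z ∈ N, oneFormInChart I θ x z = (β (τ z)).comp (fderiv ℝ τ z) := by
    intro z hz
    refine ContinuousLinearMap.ext fun v => ?_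
    have h1 := hθ (τ z) (Φ.map_source hz.2) (fderiv ℝ τ z v)
    have h2 : Φ.symm (τ z) = Ψ.symm z := Φ.left_inv hz.2
    have h3 : (mfderiv 𝓘(ℝ, EM) I Φ.symm (τ z) (fderiv ℝ τ z v) : EM)
        = mfderiv 𝓘(ℝ, EM) I Ψ.symm z v := by
      rw [hfd z hz]
      exact hΦ.symm_comp_apply hz.2 _
    rw [ContinuousLinearMap.comp_apply, ← h1]
    have h4 : ∀ (x' x'' : M) (h : x' = x'') (a b : EM), a = b →
        (θ x' : EM →L[ℝ] ℝ) a = (θ x'' : EM →L[ℝ] ℝ) b := by rintro _ _ rfl a b rfl; rfl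
    exact (h4 _ _ h2 _ _ h3).symm
  have hev : (fun z => ContinuousAlternatingMap.ofSubsingleton ℝ EM ℝ (0 : Fin 1)
      (oneFormInChart I θ x z)) =ᶠ[𝓝 (Ψ x)] fun z =>
        (ContinuousAlternatingMap.ofSubsingleton ℝ EM ℝ (0 : Fin 1)
          (β (τ z))).compContinuousLinearMap (fderiv ℝ τ z) := by
    filter_upwards [hNo.mem_nhds hNx] with z hz
    rw [hform z hz]
    ext w
    simp
  have hdiff : DifferentiableAt ℝ
      (fun z => ContinuousAlternatingMap.ofSubsingleton ℝ EM ℝ (0 : Fin 1) (β z)) (τ (Ψ x)) := by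
    rw [hτx]
    exact (ContinuousAlternatingMap.ofSubsingletonLIE (𝕜 := ℝ) (E := EM) (F := ℝ) (ι := Fin 1) (i := 0)
      ).differentiable.differentiableAt.comp _ hβ
  change extDeriv _ (Ψ x) ![mfderiv I 𝓘(ℝ, EM) Ψ x u, mfderiv I 𝓘(ℝ, EM) Ψ x v] = _
  rw [hev.extDeriv_eq, extDeriv_pullback (r := ∞) hdiff (hτc.contDiffAt (hNo.mem_nhds hNx))
    (by simpa using ENat.LEInfty.out), ContinuousAlternatingMap.compContinuousLinearMap_apply]
  have hcomp : ∀ w : TangentSpace I x, fderiv ℝ τ (Ψ x) (mfderiv I 𝓘(ℝ, EM) Ψ x w)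
      = mfderiv I 𝓘(ℝ, EM) Φ x w := by
    intro w
    refine (hfd _ hNx _).trans ?_
    have h1 : ∀ (x' : M) (a b : EM), x' = x → a = b → (mfderiv I 𝓘(ℝ, EM) Φ x' a : EM)
        = mfderiv I 𝓘(ℝ, EM) Φ x b := by rintro _ a b rfl rfl; rfl
    exact h1 _ _ _ (Ψ.left_inv hxΨ) (hΨ.symm_comp_apply hxΨ w)
  have hvec : ⇑(fderiv ℝ τ (Ψ x)) ∘ ![mfderiv I 𝓘(ℝ, EM) Ψ x u, mfderiv I 𝓘(ℝ, EM) Ψ x v]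
      = ![(mfderiv I 𝓘(ℝ, EM) Φ x u : EM), mfderiv I 𝓘(ℝ, EM) Φ x v] := by
    funext i
    fin_cases i
    · exact hcomp u
    · exact hcomp v
  rw [hvec, hτx]
  exact extDeriv_ofSubsingleton hβ _ _

end ExteriorDerivative

/-! ### Charts of the momentum bundles and the canonical forms in coordinates -/

section MomentumCharts

variable {n : ℕ} {E : Type*} [TopologicalSpace E]
  [ChartedSpace (EuclideanSpace ℝ (Fin (n + 1))) E] {π : E → ℝ} [IsFibred n π] {m : ℕ}

/-- The trivialization of the tangent bundle of `J^m π` given by an induced chart. -/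
def jetTriv (e : AdaptedChart n π) (m : ℕ) : Bundle.Trivialization (Coord n m)
    (Bundle.TotalSpace.proj : TangentBundle 𝓘(ℝ, Coord n m) (Jet n π m) → Jet n π m) :=
  (tangentBundleCore 𝓘(ℝ, Coord n m) (Jet n π m)).localTriv ⟨jetChart e m, jetChart_mem_atlas e m⟩

instance (e : AdaptedChart n π) : MemTrivializationAtlas (jetTriv e m) :=
  ⟨mem_range_self (f := (tangentBundleCore 𝓘(ℝ, Coord n m) (Jet n π m)).localTriv)
    ⟨jetChart e m, jetChart_mem_atlas e m⟩⟩

/-- The trivialization of the cotangent bundle of `J^m π` given by an induced chart. -/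
def cotangentTriv (e : AdaptedChart n π) (m : ℕ) : Bundle.Trivialization (Coord n m →L[ℝ] ℝ)
    (Bundle.TotalSpace.proj : Cotangent n π m → Jet n π m) :=
  Bundle.Trivialization.continuousLinearMap (RingHom.id ℝ) (jetTriv e m)
    (Bundle.Trivial.trivialization (Jet n π m) ℝ) (he₂ := ⟨mem_singleton _⟩)

instance (e : AdaptedChart n π) : MemTrivializationAtlas (cotangentTriv e m) := by
  unfold cotangentTriv; infer_instance

/-- The chart `(t, q_i^A, p, p_A^i)` of `T^*(J^m π)`, the momenta being the components of the
covector in the coordinate frame. -/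
def cotangentChart (e : AdaptedChart n π) (m : ℕ) :
    OpenPartialHomeomorph (Cotangent n π m) (Coord n m × (Coord n m →L[ℝ] ℝ)) :=
  (cotangentTriv e m).toOpenPartialHomeomorph.trans
    ((jetChart e m).prod (OpenPartialHomeomorph.refl _))

theorem mem_cotangentChart_source {e : AdaptedChart n π} {α : Cotangent n π m} :
    α ∈ (cotangentChart e m).source ↔ α.proj ∈ (jetChart e m).source := by
  constructor
  · exact fun h => h.2.1
  · exact fun h => ⟨⟨h, mem_univ _⟩, h, mem_univ _⟩

theorem mem_cotangentChart_target {e : AdaptedChart n π} {z : Coord n m × (Coord n m →L[ℝ] ℝ)} :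
    z ∈ (cotangentChart e m).target ↔ z.1 ∈ jetTarget e m := by
  constructor
  · exact fun h => h.1.1
  · exact fun h => ⟨⟨h, mem_univ _⟩, ⟨(jetChart e m).map_target h, mem_univ _⟩, mem_univ _⟩

/-- Both sides are the derivative of the change from the induced chart to the preferred chart at
`y`, the latter being the one that models the tangent space at `y`. This links the bundle charts to
the momentum coordinates. -/
theorem jetTriv_symmL {e : AdaptedChart n π} {y : Jet n π m} (hy : y ∈ (jetChart e m).source) :
    (jetTriv e m).symmL ℝ y = coordFrame e y := by
  have h1 := (tangentBundleCore 𝓘(ℝ, Coord n m) (Jet n π m)).localTriv_symmL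
    (i := ⟨jetChart e m, jetChart_mem_atlas e m⟩) hy
  have h2 := (jetChart_mdifferentiable (m := m) e).mdifferentiableAt_symm
    ((jetChart e m).map_source hy)
  have h3 : coordFrame e y = fderivWithin ℝ (writtenInExtChartAt 𝓘(ℝ, Coord n m)
      𝓘(ℝ, Coord n m) (jetChart e m y) (jetChart e m).symm) (range 𝓘(ℝ, Coord n m))
      (extChartAt 𝓘(ℝ, Coord n m) (jetChart e m y) (jetChart e m y)) := if_pos h2
  have h4 : writtenInExtChartAt 𝓘(ℝ, Coord n m) 𝓘(ℝ, Coord n m) (jetChart e m y)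
      (jetChart e m).symm = extChartAt 𝓘(ℝ, Coord n m) y ∘ (jetChart e m).symm := by
    rw [writtenInExtChartAt, (jetChart e m).left_inv hy]
    rfl
  rw [h4] at h3
  exact h1.trans h3.symm

theorem cotangentChart_snd {e : AdaptedChart n π} {α : Cotangent n π m}
    (hα : α.proj ∈ (jetChart e m).source) (v : Coord n m) :
    (cotangentChart e m α).2 v = α.2 (coordFrame e α.proj v) := by
  have h : (cotangentChart e m α).2 v = (Bundle.Trivial.trivialization (Jet n π m) ℝ
      ).continuousLinearMapAt ℝ α.proj (α.2 ((jetTriv e m).symmL ℝ α.proj v)) := rfl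
  rw [h, jetTriv_symmL hα, Bundle.Trivial.continuousLinearMapAt_trivialization]
  rfl

theorem isSmoothChart_cotangentChart (e : AdaptedChart n π) (m : ℕ) :
    IsSmoothChart (cotangentModel n m) (cotangentChart (π := π) e m) where
  contMDiffOn := by
    have h1 := (cotangentTriv (π := π) e m).contMDiffOn (n := ∞) (IB := 𝓘(ℝ, Coord n m))
    have h2 : ContMDiffOn (cotangentModel n m) 𝓘(ℝ, Coord n m →L[ℝ] ℝ) ∞
        (fun α => (cotangentTriv (π := π) e m α).2) (cotangentChart e m).source :=
      contMDiff_snd.comp_contMDiffOn (h1.mono fun α hα => hα.1)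
    have h3 : ContMDiffOn (cotangentModel n m) 𝓘(ℝ, Coord n m) ∞
        (fun α : Cotangent n π m => jetChart e m α.proj) (cotangentChart e m).source :=
      (contMDiffOn_jetChart e m).comp
        (Bundle.contMDiff_proj (fun y : Jet n π m => TangentSpace 𝓘(ℝ, Coord n m) y →L[ℝ] ℝ)
          ).contMDiffOn fun α hα => mem_cotangentChart_source.1 hα
    exact h3.prodMk_space h2
  contMDiffOn_symm := by
    have h1 := (cotangentTriv (π := π) e m).contMDiffOn_symm (n := ∞) (IB := 𝓘(ℝ, Coord n m))
    refine h1.comp (((contMDiffOn_jetChart_symm e m).comp contDiff_fst.contMDiff.contMDiffOn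
      fun z hz => mem_cotangentChart_target.1 hz).prodMk
        contDiff_snd.contMDiff.contMDiffOn) fun z hz => hz.2

theorem isSmoothChart_jetChart (e : AdaptedChart n π) (m : ℕ) :
    IsSmoothChart 𝓘(ℝ, Coord n m) (jetChart (π := π) e m) :=
  ⟨contMDiffOn_jetChart e m, contMDiffOn_jetChart_symm e m⟩

/-- The chart `(t, q_i^A, p_A^i)` of `J^m π^*`. -/
def restrictedChart (e : AdaptedChart n π) (m : ℕ) :
    OpenPartialHomeomorph (Restricted n π m) (Coord n m × (Fin (m + 1) → Fin n → ℝ)) :=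
  (restrictedCore π m).openPartialHomeomorph (restrictedPartialEquiv e m) (mem_range_self e)

theorem isSmoothChart_restrictedChart (e : AdaptedChart n π) (m : ℕ) :
    IsSmoothChart (restrictedModel n m) (restrictedChart (π := π) e m) := by
  have h : restrictedChart (π := π) e m ∈ IsManifold.maximalAtlas (restrictedModel n m) ∞
      (Restricted n π m) :=
    IsManifold.subset_maximalAtlas (mem_iUnion₂.2 ⟨_, mem_range_self e, rfl⟩)
  exact ⟨contMDiffOn_of_mem_maximalAtlas h, contMDiffOn_symm_of_mem_maximalAtlas h⟩

theorem mem_restrictedChart_source {e : AdaptedChart n π} {x : Restricted n π m} :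
    x ∈ (restrictedChart e m).source ↔ x.proj ∈ (jetChart e m).source := Iff.rfl

/-- The components `p_A^i` of a covector in coordinates. -/
def momentaL (n m : ℕ) : (Coord n m →L[ℝ] ℝ) →L[ℝ] (Fin (m + 1) → Fin n → ℝ) :=
  ContinuousLinearMap.pi fun i => ContinuousLinearMap.pi fun A =>
    ContinuousLinearMap.apply ℝ ℝ ((0, Pi.single i (Pi.single A 1)) : Coord n m)

theorem momentaL_apply (a : Coord n m →L[ℝ] ℝ) (i : Fin (m + 1)) (A : Fin n) :
    momentaL n m a i A = a (0, Pi.single i (Pi.single A 1)) := rfl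

theorem momentumQ_eq {e : AdaptedChart n π} {α : Cotangent n π m}
    (hα : α.proj ∈ (jetChart e m).source) (i : Fin (m + 1)) (A : Fin n) :
    momentumQ e α i A = momentaL n m (cotangentChart e m α).2 i A :=
  (cotangentChart_snd hα _).symm

theorem momentumT_eq {e : AdaptedChart n π} {α : Cotangent n π m}
    (hα : α.proj ∈ (jetChart e m).source) :
    momentumT e α = (cotangentChart e m α).2 (1, 0) :=
  (cotangentChart_snd hα _).symm

theorem restrictedChart_quotientMap {e : AdaptedChart n π} {α : Cotangent n π m}
    (hα : α.proj ∈ (jetChart e m).source) :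
    restrictedChart e m (quotientMap α)
      = ((cotangentChart e m α).1, momentaL n m (cotangentChart e m α).2) := by
  refine Prod.ext rfl (funext fun i => funext fun A => ?_)
  exact (momentum_mk e hα α.2 i A).trans (momentumQ_eq hα i A)

theorem contMDiff_quotientMap : ContMDiff (cotangentModel n m) (restrictedModel n m) ∞
    (quotientMap : Cotangent n π m → Restricted n π m) := by
  intro α
  obtain ⟨e, he⟩ := exists_mem_jetChart_source α.proj
  have h1 : ContMDiffOn (cotangentModel n m) (restrictedModel n m) ∞
      (fun α : Cotangent n π m => (restrictedChart e m).symm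
        ((cotangentChart e m α).1, momentaL n m (cotangentChart e m α).2))
      (cotangentChart e m).source := by
    have h2 : ContDiff ℝ ∞ (fun z : Coord n m × (Coord n m →L[ℝ] ℝ) =>
        (z.1, momentaL n m z.2)) := by fun_prop
    refine (isSmoothChart_restrictedChart e m).contMDiffOn_symm.comp
      (h2.contMDiff.comp_contMDiffOn (isSmoothChart_cotangentChart e m).contMDiffOn) ?_
    intro α hα
    exact ⟨(jetChart e m).map_source (mem_cotangentChart_source.1 hα), mem_univ _⟩
  refine ContMDiffOn.contMDiffAt (h1.congr fun α hα => ?_)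
    ((cotangentChart e m).open_source.mem_nhds (mem_cotangentChart_source.2 he))
  have hα' := mem_cotangentChart_source.1 hα
  rw [← restrictedChart_quotientMap hα']
  exact ((restrictedChart e m).left_inv hα').symm

/-- The tautological form in coordinates. -/
theorem tautologicalForm_chart {e : AdaptedChart n π} {z : Coord n m × (Coord n m →L[ℝ] ℝ)}
    (hz : z ∈ (cotangentChart e m).target) (v : Coord n m × (Coord n m →L[ℝ] ℝ)) :
    tautologicalForm ((cotangentChart e m).symm z)
      (mfderiv 𝓘(ℝ, Coord n m × (Coord n m →L[ℝ] ℝ)) (cotangentModel n m)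
        (cotangentChart e m).symm z v) = z.2 v.1 := by
  set α := (cotangentChart e m).symm z with hα
  have hαs : α.proj ∈ (jetChart e m).source :=
    mem_cotangentChart_source.1 ((cotangentChart e m).map_target hz)
  have hzα : cotangentChart e m α = z := (cotangentChart e m).right_inv hz
  have h1 := ((isSmoothChart_cotangentChart (π := π) e m).mdifferentiable.mdifferentiableAt_symm
    hz).hasMFDerivAt
  have h2 : MDifferentiableAt (cotangentModel n m) 𝓘(ℝ, Coord n m)
      (Bundle.TotalSpace.proj : Cotangent n π m → Jet n π m) α :=
    (Bundle.contMDiff_proj (n := ∞)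
      (fun y : Jet n π m => TangentSpace 𝓘(ℝ, Coord n m) y →L[ℝ] ℝ)).contMDiffAt.mdifferentiableAt
        (by simp)
  have h3 := (((jetChart_mdifferentiable e).mdifferentiableAt hαs).hasMFDerivAt.comp α
    h2.hasMFDerivAt).comp z h1
  have h4 : (jetChart e m ∘ Bundle.TotalSpace.proj) ∘ (cotangentChart e m).symm
      =ᶠ[𝓝 z] (Prod.fst : Coord n m × (Coord n m →L[ℝ] ℝ) → Coord n m) := by
    filter_upwards [(cotangentChart e m).open_target.mem_nhds hz] with x hx
    exact congrArg Prod.fst ((cotangentChart e m).right_inv hx)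
  have h5 : HasMFDerivAt 𝓘(ℝ, Coord n m × (Coord n m →L[ℝ] ℝ)) 𝓘(ℝ, Coord n m)
      (Prod.fst : Coord n m × (Coord n m →L[ℝ] ℝ) → Coord n m) z
      (ContinuousLinearMap.fst ℝ (Coord n m) (Coord n m →L[ℝ] ℝ)) :=
    (hasFDerivAt_fst (𝕜 := ℝ)).hasMFDerivAt
  have h6 := hasMFDerivAt_unique h3 (h5.congr_of_eventuallyEq h4)
  have h7 := congrArg (fun T => T v) h6
  change α.2 (mfderiv (cotangentModel n m) 𝓘(ℝ, Coord n m)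
    (Bundle.TotalSpace.proj : Cotangent n π m → Jet n π m) α _) = _
  have h8 := coordFrame_coordCoframe e hαs (mfderiv (cotangentModel n m) 𝓘(ℝ, Coord n m)
    (Bundle.TotalSpace.proj : Cotangent n π m → Jet n π m) α
    (mfderiv 𝓘(ℝ, Coord n m × (Coord n m →L[ℝ] ℝ)) (cotangentModel n m)
        (cotangentChart e m).symm z v))
  refine (congrArg α.2 h8).symm.trans ?_
  refine (cotangentChart_snd hαs _).symm.trans ?_
  rw [hzα]
  exact congrArg z.2 h7

/-- This is the local expression `p dt + ∑ p_A^i dq_i^A` of the tautological form. It is linear in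
the point, so the symplectic form has constant coefficients. -/
theorem hasFDerivAt_snd_comp_fst {A : Type*} [NormedAddCommGroup A] [NormedSpace ℝ A]
    (z : A × (A →L[ℝ] ℝ)) :
    HasFDerivAt (fun z : A × (A →L[ℝ] ℝ) =>
        z.2.comp (ContinuousLinearMap.fst ℝ A (A →L[ℝ] ℝ)))
      (((ContinuousLinearMap.compL ℝ (A × (A →L[ℝ] ℝ)) A ℝ).flip
        (ContinuousLinearMap.fst ℝ A (A →L[ℝ] ℝ))).comp
          (ContinuousLinearMap.snd ℝ A (A →L[ℝ] ℝ))) z :=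
  (((ContinuousLinearMap.compL ℝ (A × (A →L[ℝ] ℝ)) A ℝ).flip
    (ContinuousLinearMap.fst ℝ A (A →L[ℝ] ℝ))).comp
      (ContinuousLinearMap.snd ℝ A (A →L[ℝ] ℝ))).hasFDerivAt

/-- The canonical symplectic form in coordinates. -/
theorem symplecticForm_eq {e : AdaptedChart n π} {α : Cotangent n π m}
    (hα : α.proj ∈ (jetChart e m).source) (u v : TangentSpace (cotangentModel n m) α)
    {u' v' : Coord n m × (Coord n m →L[ℝ] ℝ)}
    (hu : mfderiv (cotangentModel n m) 𝓘(ℝ, Coord n m × (Coord n m →L[ℝ] ℝ))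
      (cotangentChart e m) α u = u')
    (hv : mfderiv (cotangentModel n m) 𝓘(ℝ, Coord n m × (Coord n m →L[ℝ] ℝ))
      (cotangentChart e m) α v = v') :
    symplecticForm α u v = v'.2 u'.1 - u'.2 v'.1 := by
  have hT := hasFDerivAt_snd_comp_fst (cotangentChart e m α)
  have h := extDerivOneForm_eq (isSmoothChart_cotangentChart (π := π) e m)
    (θ := tautologicalForm) (fun z hz v => tautologicalForm_chart hz v)
    (mem_cotangentChart_source.2 hα) hT.differentiableAt u v
  rw [symplecticForm, h, hu, hv, hT.fderiv]
  simp

end MomentumCharts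

/-! ### The unified formalism in coordinates -/

section AmbientCharts

variable {n : ℕ} {E : Type*} [TopologicalSpace E]
  [ChartedSpace (EuclideanSpace ℝ (Fin (n + 1))) E] {π : E → ℝ} [IsFibred n π] {m k : ℕ}

/-- The coordinate space `(t, q_0, …, q_{2k-1}; t, q_i, p, p^i)` of `J^{2k-1}π × T^*(J^{k-1}π)`. -/
abbrev AmbientCoord (n k : ℕ) : Type :=
  Coord n (2 * k - 1) × (Coord n (k - 1) × (Coord n (k - 1) →L[ℝ] ℝ))

/-- The product of the induced charts. -/
def ambientChart (e : AdaptedChart n π) (k : ℕ) :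
    OpenPartialHomeomorph (Ambient n π k) (AmbientCoord n k) :=
  (jetChart e (2 * k - 1)).prod (cotangentChart e (k - 1))

theorem isSmoothChart_ambientChart (e : AdaptedChart n π) (k : ℕ) :
    IsSmoothChart (ambientModel n k) (ambientChart (π := π) e k) :=
  (isSmoothChart_jetChart e _).prod (isSmoothChart_cotangentChart e _)

theorem mem_ambientChart_source {e : AdaptedChart n π} {w : Ambient n π k} :
    w ∈ (ambientChart e k).source ↔
      w.1 ∈ (jetChart e (2 * k - 1)).source ∧ w.2.proj ∈ (jetChart e (k - 1)).source :=
  and_congr_right' mem_cotangentChart_source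

theorem mem_ambientChart_target {e : AdaptedChart n π} {z : AmbientCoord n k} :
    z ∈ (ambientChart e k).target ↔ z.1 ∈ jetTarget e (2 * k - 1) ∧ z.2.1 ∈ jetTarget e (k - 1) :=
  and_congr_right' mem_cotangentChart_target

theorem ambientChart_fst (e : AdaptedChart n π) (w : Ambient n π k) :
    (ambientChart e k w).1 = jetChart e (2 * k - 1) w.1 := rfl

theorem ambientChart_snd (e : AdaptedChart n π) (w : Ambient n π k) :
    (ambientChart e k w).2 = cotangentChart e (k - 1) w.2 := rfl

theorem mem_jetMomentum_iff {e : AdaptedChart n π} {w : Ambient n π k}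
    (hw : w ∈ (ambientChart e k).source) :
    w ∈ jetMomentum n π k ↔
      (ambientChart e k w).2.1 = Coord.trunc (k - 1) (ambientChart e k w).1 := by
  rw [mem_ambientChart_source] at hw
  change w.2.proj = w.1.proj (k - 1) ↔ jetChart e (k - 1) w.2.proj = _
  rw [ambientChart_fst, ← jetChart_proj (by omega) hw.1]
  exact ((jetChart e (k - 1)).injOn.eq_iff hw.2 ((proj_mem_source _).2 hw.1)).symm

theorem mem_ambientChart_source_of_mem_jetMomentum {e : AdaptedChart n π} {w : Ambient n π k}
    (hw : w ∈ jetMomentum n π k) :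
    w ∈ (ambientChart e k).source ↔ w.1 ∈ (jetChart e (2 * k - 1)).source := by
  rw [mem_ambientChart_source, show w.2.proj = w.1.proj (k - 1) from hw, proj_mem_source, and_self]

/-- Off `jetMomentum` covector and lift may sit at different points, and the pairing has no
geometric meaning. The bound on `k` ensures `k - 1 < 2 * k - 1`, so that the jet determines the
lift. -/
theorem couplingFunction_eq (hk : 1 ≤ k) {e : AdaptedChart n π} {w : Ambient n π k}
    (hw : w ∈ (ambientChart e k).source) (hwJ : w ∈ jetMomentum n π k) :
    couplingFunction w
      = (ambientChart e k w).2.2 (Coord.lift (k - 1) (ambientChart e k w).1) := by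
  have hw' := mem_ambientChart_source.1 hw
  have h1 : (holonomicLift (k - 1) w.1 : Coord n (k - 1))
      = coordFrame e w.2.proj (Coord.lift (k - 1) (jetChart e (2 * k - 1) w.1)) := by
    refine (holonomicLift_eq (by omega) hw'.1).trans ?_
    have h2 : ∀ y y' : Jet n π (k - 1), y = y' → ∀ v, (coordFrame e y v : Coord n (k - 1))
        = coordFrame e y' v := by rintro y _ rfl v; rfl
    exact h2 _ _ hwJ.symm _
  exact (congrArg w.2.2 h1).trans (cotangentChart_snd hw'.2 _).symm

theorem localLagrangian_ambientChart {L : Jet n π k → ℝ} {e : AdaptedChart n π}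
    {w : Ambient n π k} (hw : w.1 ∈ (jetChart e (2 * k - 1)).source) (hk : 1 ≤ k) :
    localLagrangian e L (Coord.trunc k (ambientChart e k w).1) = L (w.1.proj k) := by
  rw [ambientChart_fst, ← jetChart_proj (by omega) hw,
    localLagrangian_jetChart ((proj_mem_source _).2 hw)]

theorem mem_hamiltonianSubmanifold_iff (hk : 1 ≤ k) {L : Jet n π k → ℝ} {e : AdaptedChart n π}
    {w : Ambient n π k} (hw : w ∈ (ambientChart e k).source) :
    w ∈ hamiltonianSubmanifold L ↔
      (ambientChart e k w).2.1 = Coord.trunc (k - 1) (ambientChart e k w).1 ∧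
      (ambientChart e k w).2.2 (Coord.lift (k - 1) (ambientChart e k w).1)
        = localLagrangian e L (Coord.trunc k (ambientChart e k w).1) := by
  rw [localLagrangian_ambientChart (mem_ambientChart_source.1 hw).1 hk, ← mem_jetMomentum_iff hw]
  refine and_congr_right fun h => ?_
  rw [couplingFunction_eq hk hw h]

theorem exists_mem_ambientChart_source {w : Ambient n π k} (hw : w ∈ jetMomentum n π k) :
    ∃ e : AdaptedChart n π, w ∈ (ambientChart e k).source := by
  obtain ⟨e, he⟩ := exists_mem_jetChart_source w.1
  exact ⟨e, (mem_ambientChart_source_of_mem_jetMomentum hw).2 he⟩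

/-- The components of a tangent vector of `J^{2k-1}π × T^*(J^{k-1}π)`. -/
def ambientCoframe (e : AdaptedChart n π) {w : Ambient n π k}
    (u : TangentSpace (ambientModel n k) w) : AmbientCoord n k :=
  mfderiv (ambientModel n k) 𝓘(ℝ, AmbientCoord n k) (ambientChart e k) w u

theorem cotangentChart_mfderiv_snd {e : AdaptedChart n π} {w : Ambient n π k}
    (hw : w ∈ (ambientChart e k).source) (u : TangentSpace (ambientModel n k) w) :
    mfderiv (cotangentModel n (k - 1)) 𝓘(ℝ, Coord n (k - 1) × (Coord n (k - 1) →L[ℝ] ℝ))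
      (cotangentChart e (k - 1)) w.2
      (mfderiv (ambientModel n k) (cotangentModel n (k - 1)) Prod.snd w u)
      = (ambientCoframe e u).2 := by
  have hw2 : w.2 ∈ (cotangentChart e (k - 1)).source := hw.2
  have h1 : MDifferentiableAt (ambientModel n k) (cotangentModel n (k - 1))
      (Prod.snd : Ambient n π k → _) w := mdifferentiableAt_snd
  have h2 := ((isSmoothChart_cotangentChart e (k - 1)).mdifferentiable.mdifferentiableAt
    hw2).hasMFDerivAt.comp w h1.hasMFDerivAt
  have h3 := ((isSmoothChart_ambientChart e k).mdifferentiable.mdifferentiableAt hw).hasMFDerivAt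
  have h4 : HasMFDerivAt 𝓘(ℝ, AmbientCoord n k)
      𝓘(ℝ, Coord n (k - 1) × (Coord n (k - 1) →L[ℝ] ℝ)) Prod.snd (ambientChart e k w)
      (ContinuousLinearMap.snd ℝ (Coord n (2 * k - 1))
        (Coord n (k - 1) × (Coord n (k - 1) →L[ℝ] ℝ))) := hasFDerivAt_snd.hasMFDerivAt
  exact congrArg (fun T => T u) (hasMFDerivAt_unique h2 (h4.comp w h3))

theorem presymplecticForm_eq {e : AdaptedChart n π} {w : Ambient n π k}
    (hw : w ∈ (ambientChart e k).source) (u v : TangentSpace (ambientModel n k) w) :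
    presymplecticForm w u v = (ambientCoframe e v).2.2 (ambientCoframe e u).2.1
      - (ambientCoframe e u).2.2 (ambientCoframe e v).2.1 :=
  symplecticForm_eq (mem_ambientChart_source.1 hw).2 _ _ (cotangentChart_mfderiv_snd hw u)
    (cotangentChart_mfderiv_snd hw v)

/-- In charts the map is the linear map `T` that forgets the jet and the momentum `p`, and the
differential of a chart is injective. -/
theorem mfderiv_quotientMap_snd_eq_zero_iff {e : AdaptedChart n π} {w : Ambient n π k}
    (hw : w ∈ (ambientChart e k).source) (u : TangentSpace (ambientModel n k) w) :
    mfderiv (ambientModel n k) (restrictedModel n (k - 1))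
      (fun w : Ambient n π k => quotientMap w.2) w u = 0 ↔
      (ambientCoframe e u).2.1 = 0 ∧ momentaL n (k - 1) (ambientCoframe e u).2.2 = 0 := by
  have hw2 : quotientMap w.2 ∈ (restrictedChart e (k - 1)).source :=
    mem_restrictedChart_source.2 (mem_ambientChart_source.1 hw).2
  have h1 : MDifferentiableAt (ambientModel n k) (restrictedModel n (k - 1))
      (fun w : Ambient n π k => quotientMap w.2) w :=
    (contMDiff_quotientMap.comp contMDiff_snd).contMDiffAt.mdifferentiableAt (by simp)
  have h2 := ((isSmoothChart_restrictedChart e (k - 1)).mdifferentiable.mdifferentiableAt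
    hw2).hasMFDerivAt.comp w h1.hasMFDerivAt
  have h3 := ((isSmoothChart_ambientChart e k).mdifferentiable.mdifferentiableAt hw).hasMFDerivAt
  let T : AmbientCoord n k →L[ℝ] Coord n (k - 1) × (Fin (k - 1 + 1) → Fin n → ℝ) :=
    (((ContinuousLinearMap.id ℝ (Coord n (k - 1))).prodMap (momentaL n (k - 1))).comp
      (ContinuousLinearMap.snd ℝ (Coord n (2 * k - 1))
        (Coord n (k - 1) × (Coord n (k - 1) →L[ℝ] ℝ))))
  have h4 : HasMFDerivAt 𝓘(ℝ, AmbientCoord n k) (restrictedModel n (k - 1)) T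
      (ambientChart e k w) T := T.hasFDerivAt.hasMFDerivAt
  have h5 : restrictedChart e (k - 1) ∘ (fun w : Ambient n π k => quotientMap w.2)
      =ᶠ[𝓝 w] T ∘ ambientChart e k := by
    filter_upwards [(ambientChart e k).open_source.mem_nhds hw] with x hx
    exact restrictedChart_quotientMap (mem_ambientChart_source.1 hx).2
  have h6 : mfderiv (restrictedModel n (k - 1)) 𝓘(ℝ, _) (restrictedChart e (k - 1))
      (quotientMap w.2) (mfderiv (ambientModel n k) (restrictedModel n (k - 1))
      (fun w : Ambient n π k => quotientMap w.2) w u) = T (ambientCoframe e u) :=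
    congrArg (fun T => T u) (hasMFDerivAt_unique h2 ((h4.comp w h3).congr_of_eventuallyEq h5))
  have h7 : T (ambientCoframe e u) = 0 ↔ (ambientCoframe e u).2.1 = 0 ∧
      momentaL n (k - 1) (ambientCoframe e u).2.2 = 0 := Prod.ext_iff
  rw [← h7]
  constructor
  · intro h
    rw [← h6, h]
    exact map_zero _
  · intro h
    have h8 := (isSmoothChart_restrictedChart e (k - 1)).symm_comp_apply hw2
      (mfderiv (ambientModel n k) (restrictedModel n (k - 1))
      (fun w : Ambient n π k => quotientMap w.2) w u)
    rw [← h8, h6, h]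
    exact map_zero _

end AmbientCharts

/-! ### Tangent vectors of the Hamiltonian submanifold -/

section Constraint

variable {n : ℕ} {E : Type*} [TopologicalSpace E]
  [ChartedSpace (EuclideanSpace ℝ (Fin (n + 1))) E] {π : E → ℝ} [IsFibred n π] {m k : ℕ}

/-- The tangent vector `∂/∂q_r^A` in coordinates. -/
def topVector (n m r : ℕ) (A : Fin n) : Coord n m :=
  (0, fun i => if (i : ℕ) = r then Pi.single A 1 else 0)

/-- With nothing below order `k`, truncation at order `k` keeps only the `q_k`-components. The
separate index `r` serves both `k` and `k - 1 + 1`, which are not definitionally equal. -/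
theorem trunc_eq_sum (hk : 1 ≤ k) (hkm : k ≤ m) {r : ℕ} (hr : r = k) {η : Coord n m}
    (hη : Coord.trunc (k - 1) η = 0) :
    Coord.trunc r η = ∑ A, η.q k A • Coord.trunc r (topVector n m k A) := by
  subst hr
  have h0 : η.1 = 0 := congrArg Prod.fst hη
  have h1 : ∀ i : ℕ, (hi : i < r) → ∀ A, η.2 ⟨i, by omega⟩ A = 0 := by
    intro i hi A
    have := congrFun (congrFun (congrArg Prod.snd hη) ⟨i, by omega⟩) A
    simpa [Coord.trunc, show i ≤ m by omega] using this
  refine Prod.ext ?_ ?_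
  · simpa [Coord.trunc, topVector, Prod.fst_sum] using h0
  · funext i B
    have hi : (i : ℕ) < m + 1 := by omega
    simp only [Coord.trunc, topVector, Prod.snd_sum, Finset.sum_apply, Prod.smul_snd,
      Pi.smul_apply, smul_eq_mul, hi, dite_true]
    by_cases hir : (i : ℕ) = r
    · simp only [hir, if_true, Pi.single_apply, mul_ite, mul_one, mul_zero,
        Finset.sum_ite_eq, Finset.mem_univ, Coord.q, show r < m + 1 by omega, dite_true]
    · simp only [hir, if_false, Pi.zero_apply, mul_zero, Finset.sum_const_zero]
      exact h1 i (by omega) B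

/-- The differential of `L̂ - Ĉ` along the fibres of constant momenta, in coordinates. -/
def couplingDefect (e : AdaptedChart n π) (L : Jet n π k → ℝ) (z : AmbientCoord n k) :
    Coord n (2 * k - 1) →L[ℝ] ℝ :=
  (fderiv ℝ (localLagrangian e L) (Coord.trunc k z.1)).comp (Coord.truncL n _ k)
    - z.2.2.comp ((Coord.shiftL n (k - 1)).comp (Coord.truncL n _ (k - 1 + 1)))

theorem couplingDefect_apply (e : AdaptedChart n π) (L : Jet n π k → ℝ) (z : AmbientCoord n k)
    (v : Coord n (2 * k - 1)) : couplingDefect e L z v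
      = fderiv ℝ (localLagrangian e L) (Coord.trunc k z.1) (Coord.trunc k v)
        - z.2.2 (Coord.shiftL n (k - 1) (Coord.trunc (k - 1 + 1) v)) := rfl

/-- The shift moves `q_k` into slot `k - 1`, so the direction `∂/∂q_k^A` meets only the top
momentum. -/
theorem couplingDefect_topVector (hk : 1 ≤ k) (e : AdaptedChart n π) (L : Jet n π k → ℝ)
    (z : AmbientCoord n k) (A : Fin n) :
    couplingDefect e L z (topVector n _ k A)
      = Coord.partialQ k A (localLagrangian e L) (Coord.trunc k z.1)
        - momentaL n (k - 1) z.2.2 (Fin.last _) A := by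
  have h1 : Coord.trunc k (topVector n (2 * k - 1) k A) = topVector n k k A := by
    refine Prod.ext rfl (funext fun i => ?_)
    simp only [Coord.trunc, topVector]
    rw [dif_pos (by omega)]
  have h2 : Coord.shiftL n (k - 1) (Coord.trunc (k - 1 + 1) (topVector n (2 * k - 1) k A))
      = (0, Pi.single (Fin.last _) (Pi.single A 1)) := by
    refine Prod.ext rfl (funext fun i => ?_)
    simp only [Coord.shiftL, Coord.trunc, topVector, ContinuousLinearMap.prod_apply,
      ContinuousLinearMap.coe_pi', ContinuousLinearMap.comp_apply, ContinuousLinearMap.coe_snd',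
      ContinuousLinearMap.proj_apply, Fin.val_succ]
    rw [dif_pos (by omega)]
    by_cases hi : i = Fin.last _
    · subst hi
      rw [if_pos (by simp; omega), Pi.single_eq_same]
    · have : (i : ℕ) ≠ k - 1 := fun h => hi (Fin.ext (by simpa using h))
      rw [if_neg (by omega), Pi.single_eq_of_ne hi]
  rw [couplingDefect_apply, h1, h2, momentaL_apply]
  rfl

theorem couplingDefect_eq_zero (hk : 1 ≤ k) {e : AdaptedChart n π} {L : Jet n π k → ℝ}
    {z : AmbientCoord n k} (h : ∀ A, couplingDefect e L z (topVector n _ k A) = 0)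
    {η : Coord n (2 * k - 1)} (hη : Coord.trunc (k - 1) η = 0) : couplingDefect e L z η = 0 := by
  rw [couplingDefect_apply, trunc_eq_sum hk (by omega) rfl hη,
    trunc_eq_sum hk (by omega) (show k - 1 + 1 = k by omega) hη]
  simp only [map_sum, map_smul, ← Finset.sum_sub_distrib, ← smul_sub]
  refine Finset.sum_eq_zero fun A _ => ?_
  rw [← couplingDefect_apply, h A, smul_zero]

theorem Coord.lift_fst (r : ℕ) (c : Coord n m) : (Coord.lift r c).1 = 1 := by
  simp [Coord.lift, Coord.shiftL]

theorem hasDerivAt_lift {η : ℝ → Coord n m} {v : Coord n m} {s : ℝ} (r : ℕ)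
    (hη : HasDerivAt η v s) :
    HasDerivAt (fun s => Coord.lift r (η s)) (Coord.shiftL n r (Coord.trunc (r + 1) v)) s :=
  (((Coord.shiftL n r).comp (Coord.truncL n m (r + 1))).hasFDerivAt.comp_hasDerivAt s
    hη).const_add _

theorem contDiff_lift (r : ℕ) : ContDiff ℝ ∞ (Coord.lift r : Coord n m → Coord n r) :=
  contDiff_const.add ((Coord.shiftL n r).comp (Coord.truncL n m (r + 1))).contDiff

variable {L : Jet n π k → ℝ}

theorem hasDerivAt_localLagrangian (hL : ContMDiff 𝓘(ℝ, Coord n k) 𝓘(ℝ, ℝ) ∞ L)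
    {e : AdaptedChart n π} {η : ℝ → Coord n m} {v : Coord n m} {s : ℝ}
    (hs : η s ∈ jetTarget e m) (hη : HasDerivAt η v s) :
    HasDerivAt (fun s => localLagrangian e L (Coord.trunc k (η s)))
      (fderiv ℝ (localLagrangian e L) (Coord.trunc k (η s)) (Coord.trunc k v)) s := by
  have h1 : DifferentiableAt ℝ (localLagrangian e L) (Coord.truncL n m k (η s)) :=
    ((contDiffOn_localLagrangian hL e).contDiffAt ((isOpen_jetTarget e k).mem_nhds
      (mem_jetTarget_trunc.2 hs))).differentiableAt (by simp)
  exact h1.hasFDerivAt.comp_hasDerivAt s ((Coord.truncL n m k).hasFDerivAt.comp_hasDerivAt s hη)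

theorem contDiffOn_localLagrangian_trunc (hL : ContMDiff 𝓘(ℝ, Coord n k) 𝓘(ℝ, ℝ) ∞ L)
    (e : AdaptedChart n π) :
    ContDiffOn ℝ ∞ (fun c : Coord n m => localLagrangian e L (Coord.trunc k c)) (jetTarget e m) :=
  (contDiffOn_localLagrangian hL e).comp (Coord.contDiff_trunc k).contDiffOn
    fun _ hc => mem_jetTarget_trunc.2 hc

/-- Tangent vectors of `W_o` in coordinates. -/
theorem IsTangentTo.ambientCoframe_eq (hk : 1 ≤ k) (hL : ContMDiff 𝓘(ℝ, Coord n k) 𝓘(ℝ, ℝ) ∞ L)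
    {e : AdaptedChart n π} {w : Ambient n π k} (hw : w ∈ (ambientChart e k).source)
    {u : TangentSpace (ambientModel n k) w}
    (hu : IsTangentTo (ambientModel n k) (hamiltonianSubmanifold L) u) :
    (ambientCoframe e u).2.1 = Coord.trunc (k - 1) (ambientCoframe e u).1 ∧
    (ambientCoframe e u).2.2 (Coord.lift (k - 1) (ambientChart e k w).1)
      = couplingDefect e L (ambientChart e k w) (ambientCoframe e u).1 := by
  obtain ⟨γ, hγc, hγ, rfl, hd⟩ := hu.exists_curve (isSmoothChart_ambientChart e k) hw
  change HasDerivAt (fun s => ambientChart e k (γ s)) (ambientCoframe e u) 0 at hd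
  have h0 : ∀ᶠ s in 𝓝 (0 : ℝ), γ s ∈ (ambientChart e k).source :=
    hγc.continuousAt.eventually ((ambientChart e k).open_source.mem_nhds hw)
  have hd1 : HasDerivAt (fun s => (ambientChart e k (γ s)).1) (ambientCoframe e u).1 0 := hd.fst
  have hd2 : HasDerivAt (fun s => (ambientChart e k (γ s)).2.1) (ambientCoframe e u).2.1 0 :=
    hd.snd.fst
  have hd3 : HasDerivAt (fun s => (ambientChart e k (γ s)).2.2) (ambientCoframe e u).2.2 0 :=
    hd.snd.snd
  constructor
  · have h1 := (Coord.truncL n _ (k - 1)).hasFDerivAt.comp_hasDerivAt 0 hd1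
    refine hd2.unique (h1.congr_of_eventuallyEq ?_)
    filter_upwards [h0] with s hs
    exact ((mem_hamiltonianSubmanifold_iff hk hs).1 (hγ s)).1
  -- Differentiates `⟨α, lift⟩ = L` along a curve in `W_o`; the part of the product rule in which
  -- the lift varies goes into the defect.
  · have h1 := hasDerivAt_localLagrangian hL (mem_ambientChart_target.1
      ((ambientChart e k).map_source hw)).1 hd1
    have h2 := hd3.clm_apply (hasDerivAt_lift (k - 1) hd1)
    have h3 := h2.unique (h1.congr_of_eventuallyEq (by
      filter_upwards [h0] with s hs
      exact ((mem_hamiltonianSubmanifold_iff hk hs).1 (hγ s)).2))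
    rw [couplingDefect_apply]
    exact eq_sub_of_add_eq h3

/-- The tangent vectors of `W_o` given by curves in `J^{2k-1}π`. -/
theorem isTangentTo_hamiltonianSubmanifold (hk : 1 ≤ k)
    (hL : ContMDiff 𝓘(ℝ, Coord n k) 𝓘(ℝ, ℝ) ∞ L)
    {e : AdaptedChart n π} {w : Ambient n π k} (hw : w ∈ (ambientChart e k).source)
    (hwo : w ∈ hamiltonianSubmanifold L) {η : ℝ → Coord n (2 * k - 1)} (hη : ContDiff ℝ ∞ η)
    (hηe : ∀ s, η s ∈ jetTarget e (2 * k - 1)) (h0 : η 0 = (ambientChart e k w).1)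
    {v : Coord n (2 * k - 1)} (hv : HasDerivAt η v 0) :
    IsTangentTo (ambientModel n k) (hamiltonianSubmanifold L) (x := w)
      (mfderiv 𝓘(ℝ, AmbientCoord n k) (ambientModel n k) (ambientChart e k).symm
        (ambientChart e k w) (v, (Coord.trunc (k - 1) v,
          couplingDefect e L (ambientChart e k w) v •
            ContinuousLinearMap.fst ℝ ℝ (Fin (k - 1 + 1) → Fin n → ℝ)))) := by
  set z := ambientChart e k w with hz
  obtain ⟨hz1, hz2⟩ := (mem_hamiltonianSubmanifold_iff hk hw).1 hwo
  rw [← hz] at hz1 hz2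
  -- The momenta `p_A^i` are kept and only `p` is corrected. Since the lift has time component `1`,
  -- adding the error in the equation to `p` restores the equation.
  let c : ℝ → AmbientCoord n k := fun s => (η s, (Coord.trunc (k - 1) (η s),
    z.2.2 + (localLagrangian e L (Coord.trunc k (η s)) - z.2.2 (Coord.lift (k - 1) (η s))) •
      ContinuousLinearMap.fst ℝ ℝ (Fin (k - 1 + 1) → Fin n → ℝ)))
  have hcT : ∀ s, c s ∈ (ambientChart e k).target := fun s =>
    mem_ambientChart_target.2 ⟨hηe s, mem_jetTarget_trunc.2 (hηe s)⟩
  refine isTangentTo_of_curve (c := c) (isSmoothChart_ambientChart e k) ?_ hcT ?_ hw ?_ ?_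
  · refine hη.prodMk (((Coord.contDiff_trunc (k - 1)).comp hη).prodMk (contDiff_const.add
      (ContDiff.smul (ContDiff.sub ?_ (z.2.2.contDiff.comp ((contDiff_lift (k - 1)).comp hη)))
        contDiff_const)))
    exact contDiffOn_univ.1 ((contDiffOn_localLagrangian_trunc hL e).comp hη.contDiffOn
      fun s _ => hηe s)
  · intro s
    have hs := (ambientChart e k).map_target (hcT s)
    rw [mem_hamiltonianSubmanifold_iff hk hs, (ambientChart e k).right_inv (hcT s)]
    refine ⟨rfl, ?_⟩
    simp [c, Coord.lift_fst]
  · refine Prod.ext h0 (Prod.ext ?_ ?_)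
    · simp only [c]
      rw [h0, hz1]
    · simp only [c]
      rw [h0, hz2, sub_self, zero_smul, add_zero]
  · have h1 := hasDerivAt_localLagrangian hL (hηe 0) hv
    have h2 := z.2.2.hasFDerivAt.comp_hasDerivAt 0 (hasDerivAt_lift (k - 1) hv)
    have h3 := ((h1.sub h2).smul_const
      (ContinuousLinearMap.fst ℝ ℝ (Fin (k - 1 + 1) → Fin n → ℝ))).const_add z.2.2
    rw [couplingDefect_apply, ← h0]
    exact hv.prodMk (((Coord.truncL n _ (k - 1)).hasFDerivAt.comp_hasDerivAt 0 hv).prodMk h3)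

end Constraint

/-! ### Vertical vector fields and the first constraint -/

section Constraint

variable {n : ℕ} {E : Type*} [TopologicalSpace E]
  [ChartedSpace (EuclideanSpace ℝ (Fin (n + 1))) E] {π : E → ℝ} [IsFibred n π] {m k : ℕ}
  {L : Jet n π k → ℝ}

theorem eq_smul_fst {a : Coord n m →L[ℝ] ℝ} (ha : momentaL n m a = 0) :
    a = a (1, 0) • ContinuousLinearMap.fst ℝ ℝ (Fin (m + 1) → Fin n → ℝ) := by
  refine ContinuousLinearMap.ext fun v => ?_
  have h : ∀ i A, a (0, Pi.single i (Pi.single A 1)) = 0 := fun i A => by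
    rw [← momentaL_apply, ha]; rfl
  rw [eq_pairing, pairing_apply]
  simp [h, mul_comm]

theorem momentaL_smul_fst (r : ℝ) :
    momentaL n m (r • ContinuousLinearMap.fst ℝ ℝ (Fin (m + 1) → Fin n → ℝ)) = 0 := by
  ext i A
  simp [momentaL_apply]

/-- The tangent vector of `W_o` at `z` with constant momenta `p_A^i` over a tangent vector of
`J^{2k-1}π`, in coordinates. -/
def hamiltonianLift (e : AdaptedChart n π) (L : Jet n π k → ℝ) (z : AmbientCoord n k)
    (v : Coord n (2 * k - 1)) : AmbientCoord n k :=
  (v, (Coord.trunc (k - 1) v, couplingDefect e L z v •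
    ContinuousLinearMap.fst ℝ ℝ (Fin (k - 1 + 1) → Fin n → ℝ)))

theorem ambientCoframe_mfderiv_symm {e : AdaptedChart n π} {w : Ambient n π k}
    (hw : w ∈ (ambientChart e k).source) (v : AmbientCoord n k) :
    ambientCoframe e (w := w) (mfderiv 𝓘(ℝ, AmbientCoord n k) (ambientModel n k)
      (ambientChart e k).symm (ambientChart e k w) v) = v :=
  (isSmoothChart_ambientChart e k).comp_symm_apply hw v

/-- A vertical tangent vector has at most a `δp` component in `T^*(J^{k-1}π)`, namely the coupling
defect of its jet part. That part involves no order below `k`, so the condition on the top momentum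
makes the defect vanish, and the contraction with `Ω_o` is zero on all vectors. -/
theorem mem_constraintSubmanifold_of_momenta (hk : 1 ≤ k)
    (hL : ContMDiff 𝓘(ℝ, Coord n k) 𝓘(ℝ, ℝ) ∞ L)
    {e : AdaptedChart n π} {w : Ambient n π k} (hw : w ∈ (ambientChart e k).source)
    (hwo : w ∈ hamiltonianSubmanifold L)
    (h : ∀ A, momentaL n (k - 1) (ambientChart e k w).2.2 (Fin.last _) A
      = Coord.partialQ k A (localLagrangian e L) (Coord.trunc k (ambientChart e k w).1)) :
    w ∈ constraintSubmanifold L := by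
  refine ⟨hwo, fun Y hY v _ => ?_⟩
  obtain ⟨h1, h2⟩ := (mfderiv_quotientMap_snd_eq_zero_iff hw (Y w)).1 (hY.vertical w hwo)
  obtain ⟨h3, h4⟩ := (hY.isVectorFieldOn.isTangentTo w hwo).ambientCoframe_eq hk hL hw
  have h5 : couplingDefect e L (ambientChart e k w) (ambientCoframe e (Y w)).1 = 0 :=
    couplingDefect_eq_zero hk (fun A => by rw [couplingDefect_topVector hk, h A, sub_self])
      (h3 ▸ h1)
  -- With vanishing `p_A^i`-components the covector part is `δp dt`; evaluated on the lift it gives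
  -- `δp`, which equals the defect.
  have h6 : (ambientCoframe e (Y w)).2.2 = 0 := by
    have h7 := eq_smul_fst h2
    rw [h5, h7] at h4
    rw [h7]
    have h8 : (ambientCoframe e (Y w)).2.2 (1, 0) = 0 := by
      simpa [Coord.lift_fst] using h4
    rw [h8, zero_smul]
  rw [presymplecticForm_eq hw, h1, h6, map_zero, zero_apply, sub_zero]

theorem trunc_topVector {r : ℕ} (hr : r < k) (A : Fin n) :
    Coord.trunc r (topVector n m k A) = 0 := by
  refine Prod.ext rfl (funext fun i => ?_)
  simp only [Coord.trunc, topVector]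
  split_ifs with h1 h2
  · omega
  · rfl
  · rfl

open Classical in
/-- The vertical vector field `χ ∂/∂q_k^A` on `W_o`, for a function `χ` on `E`. -/
def verticalField (e : AdaptedChart n π) (L : Jet n π k → ℝ) (χ : E → ℝ) (A : Fin n)
    (w : Ambient n π k) : TangentSpace (ambientModel n k) w :=
  if w ∈ (ambientChart e k).source then
    mfderiv 𝓘(ℝ, AmbientCoord n k) (ambientModel n k) (ambientChart e k).symm (ambientChart e k w)
      (hamiltonianLift e L (ambientChart e k w) (χ w.1.value • topVector n _ k A))
  else 0

theorem contDiffOn_hamiltonianLift (hk : 1 ≤ k) (hL : ContMDiff 𝓘(ℝ, Coord n k) 𝓘(ℝ, ℝ) ∞ L)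
    (e : AdaptedChart n π) {χ : E → ℝ} (hχ : ContMDiff (𝓡 (n + 1)) 𝓘(ℝ, ℝ) ∞ χ) (A : Fin n) :
    ContDiffOn ℝ ∞ (fun z : AmbientCoord n k => hamiltonianLift e L z
      (χ (e.toOpenPartialHomeomorph.symm (z.1.1, z.1.2 0)) • topVector n _ k A))
      (ambientChart e k).target := by
  have h1 : ContDiffOn ℝ ∞ (fun z : AmbientCoord n k =>
      χ (e.toOpenPartialHomeomorph.symm (z.1.1, z.1.2 0))) (ambientChart e k).target := by
    rw [← contMDiffOn_iff_contDiffOn]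
    have h2 : ContDiff ℝ ∞ (fun z : AmbientCoord n k => (z.1.1, z.1.2 0)) := by fun_prop
    exact hχ.comp_contMDiffOn (e.contMDiffOn_invFun.comp h2.contMDiff.contMDiffOn
      fun z hz => (mem_ambientChart_target.1 hz).1)
  have h3 : ContDiffOn ℝ ∞ (fun z : AmbientCoord n k =>
      Coord.partialQ k A (localLagrangian e L) (Coord.trunc k z.1)) (ambientChart e k).target :=
    (contDiffOn_partialQ (isOpen_jetTarget e k) (contDiffOn_localLagrangian hL e) k A).comp
      ((Coord.contDiff_trunc k).comp contDiff_fst).contDiffOn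
      fun z hz => mem_jetTarget_trunc.2 (mem_ambientChart_target.1 hz).1
  have h4 : ContDiff ℝ ∞ (fun z : AmbientCoord n k =>
      momentaL n (k - 1) z.2.2 (Fin.last _) A) := by fun_prop
  have h5 := h1.smul (contDiffOn_const (c := topVector n (2 * k - 1) k A))
  refine h5.prodMk ((((Coord.contDiff_trunc (k - 1)).comp_contDiffOn h5)).prodMk ?_)
  refine ((h1.mul (h3.sub h4.contDiffOn)).smul
    (contDiffOn_const (c := ContinuousLinearMap.fst ℝ ℝ (Fin (k - 1 + 1) → Fin n → ℝ)))).congr fun z _ => ?_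
  rw [map_smul, couplingDefect_topVector hk, smul_eq_mul]
  rfl

theorem verticalField_of_mem {e : AdaptedChart n π} {χ : E → ℝ} {A : Fin n}
    {w : Ambient n π k} (hw : w ∈ (ambientChart e k).source) :
    verticalField e L χ A w = mfderiv 𝓘(ℝ, AmbientCoord n k) (ambientModel n k)
      (ambientChart e k).symm (ambientChart e k w)
      (hamiltonianLift e L (ambientChart e k w) (χ w.1.value • topVector n _ k A)) :=
  if_pos hw

theorem verticalField_of_notMem {e : AdaptedChart n π} {χ : E → ℝ} {A : Fin n}
    {w : Ambient n π k} (hw : w ∉ (ambientChart e k).source) : verticalField e L χ A w = 0 :=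
  if_neg hw

theorem hamiltonianLift_zero (e : AdaptedChart n π) (L : Jet n π k → ℝ) (z : AmbientCoord n k) :
    hamiltonianLift e L z 0 = 0 := by
  rw [hamiltonianLift, map_zero, zero_smul, ← Coord.truncL_apply, map_zero]
  rfl

theorem verticalField_of_eq_zero {e : AdaptedChart n π} {χ : E → ℝ} {A : Fin n}
    {w : Ambient n π k} (hw : χ w.1.value = 0) : verticalField e L χ A w = 0 := by
  by_cases hws : w ∈ (ambientChart e k).source
  · refine (verticalField_of_mem hws).trans ?_
    rw [hw, zero_smul, hamiltonianLift_zero]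
    exact map_zero _
  · exact verticalField_of_notMem hws

/-- Inside the chart the coordinate expression is smooth. A point of `W` outside the chart projects
outside the support of `χ`, and there the field vanishes on a neighbourhood. -/
theorem contMDiffAt_verticalField [IsManifold (𝓡 (n + 1)) ∞ E] (hk : 1 ≤ k)
    (hL : ContMDiff 𝓘(ℝ, Coord n k) 𝓘(ℝ, ℝ) ∞ L)
    {e : AdaptedChart n π} {χ : E → ℝ} (hχ : ContMDiff (𝓡 (n + 1)) 𝓘(ℝ, ℝ) ∞ χ)
    (hχe : tsupport χ ⊆ e.source) (A : Fin n) {w : Ambient n π k} (hwo : w ∈ jetMomentum n π k) :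
    ContMDiffAt (ambientModel n k) (ambientModel n k).tangent ∞
      (fun x => (⟨x, verticalField e L χ A x⟩ : TangentBundle (ambientModel n k) _)) w := by
  by_cases hw : w ∈ (ambientChart e k).source
  · refine contMDiffAt_vectorField (isSmoothChart_ambientChart e k) hw
      ((contDiffOn_hamiltonianLift hk hL e hχ A).contDiffAt
        ((ambientChart e k).open_target.mem_nhds ((ambientChart e k).map_source hw)))
      fun y hy => (verticalField_of_mem hy).trans ?_
    rw [value_eq (mem_ambientChart_source.1 hy).1]
    rfl
  · have h1 : w.1.value ∉ tsupport χ := fun h => hw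
      ((mem_ambientChart_source_of_mem_jetMomentum hwo).2 (hχe h))
    have h2 : ∀ᶠ x : Ambient n π k in 𝓝 w, x.1.value ∉ tsupport χ :=
      (contMDiff_value.continuous.comp continuous_fst).continuousAt.eventually
        ((isClosed_tsupport χ).isOpen_compl.mem_nhds h1)
    refine (Bundle.contMDiff_zeroSection ℝ
      (TangentSpace (ambientModel n k) : Ambient n π k → Type _)).contMDiffAt.congr_of_eventuallyEq
        ?_
    filter_upwards [h2] with x hx
    exact congrArg (fun u => (⟨x, u⟩ : TangentBundle (ambientModel n k) _))
      (verticalField_of_eq_zero (image_eq_zero_of_notMem_tsupport hx))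

theorem isTangentTo_verticalField (hk : 1 ≤ k)
    (hL : ContMDiff 𝓘(ℝ, Coord n k) 𝓘(ℝ, ℝ) ∞ L)
    (e : AdaptedChart n π) (χ : E → ℝ) (A : Fin n) {w : Ambient n π k}
    (hwo : w ∈ hamiltonianSubmanifold L) :
    IsTangentTo (ambientModel n k) (hamiltonianSubmanifold L) (verticalField e L χ A w) := by
  by_cases hw : w ∈ (ambientChart e k).source
  · rw [verticalField_of_mem hw]
    have h1 := (mem_ambientChart_target.1 ((ambientChart e k).map_source hw)).1
    set v : Coord n (2 * k - 1) := χ w.1.value • topVector n _ k A with hv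
    have hv0 : Coord.truncL n _ 0 v = 0 := by
      rw [hv, map_smul, Coord.truncL_apply, trunc_topVector (by omega), smul_zero]
    -- A straight line in the direction `∂/∂q_k^A`. As `k ≥ 1`, it fixes `(t, q_0)` and so stays in
    -- the chart for all parameters.
    refine isTangentTo_hamiltonianSubmanifold hk hL hw hwo
      (η := fun s => (ambientChart e k w).1 + s • v)
      (contDiff_const.add (contDiff_id.smul contDiff_const)) (fun s => ?_) (by simp) ?_
    · have h2 : Coord.trunc 0 ((ambientChart e k w).1 + s • v)
          = Coord.trunc 0 (ambientChart e k w).1 := by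
        rw [← Coord.truncL_apply, map_add, map_smul, hv0, smul_zero, add_zero,
          Coord.truncL_apply]
      rw [← mem_jetTarget_trunc (r := 0), h2, mem_jetTarget_trunc]
      exact h1
    · simpa using ((hasDerivAt_id (0 : ℝ)).smul_const v).const_add (ambientChart e k w).1
  · rw [verticalField_of_notMem hw]
    refine ⟨fun _ => w, contMDiff_const, fun _ => hwo, ?_⟩
    rw [mfderiv_const]
    rfl

theorem isVerticalField_verticalField [IsManifold (𝓡 (n + 1)) ∞ E] (hk : 1 ≤ k)
    (hL : ContMDiff 𝓘(ℝ, Coord n k) 𝓘(ℝ, ℝ) ∞ L)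
    (e : AdaptedChart n π) {χ : E → ℝ} (hχ : ContMDiff (𝓡 (n + 1)) 𝓘(ℝ, ℝ) ∞ χ)
    (hχe : tsupport χ ⊆ e.source) (A : Fin n) : IsVerticalField L (verticalField e L χ A) := by
  refine ⟨⟨fun w hwo => (contMDiffAt_verticalField hk hL hχ hχe A hwo.1).contMDiffWithinAt,
    fun w hwo => isTangentTo_verticalField hk hL e χ A hwo⟩, fun w hwo => ?_⟩
  by_cases hw : w ∈ (ambientChart e k).source
  · rw [mfderiv_quotientMap_snd_eq_zero_iff hw, verticalField_of_mem hw,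
      ambientCoframe_mfderiv_symm hw]
    refine ⟨?_, momentaL_smul_fst _⟩
    change Coord.trunc (k - 1) (_ • topVector n _ k A) = 0
    rw [← Coord.truncL_apply, map_smul, Coord.truncL_apply, trunc_topVector (by omega),
      smul_zero]
  · rw [verticalField_of_notMem hw]
    exact map_zero _

/-- `W_o` has tangent vectors with nonzero `∂/∂t`-component and constant `q_i^A`. -/
theorem exists_isTangentTo_time (hk : 1 ≤ k) (hL : ContMDiff 𝓘(ℝ, Coord n k) 𝓘(ℝ, ℝ) ∞ L)
    {e : AdaptedChart n π} {w : Ambient n π k} (hw : w ∈ (ambientChart e k).source)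
    (hwo : w ∈ hamiltonianSubmanifold L) :
    ∃ v : TangentSpace (ambientModel n k) w,
      IsTangentTo (ambientModel n k) (hamiltonianSubmanifold L) v ∧
        (ambientCoframe e v).2.1.1 ≠ 0 := by
  have h1 := (mem_ambientChart_target.1 ((ambientChart e k).map_source hw)).1
  obtain ⟨ε, hε, hball⟩ := Metric.isOpen_iff.1 (isOpen_jetTarget e (2 * k - 1)) _ h1
  -- Tangency asks for a curve defined on all of `ℝ`. Moving `t` by `ε / 2 * sin s` stays in the
  -- ball of radius `ε` and has the nonzero velocity `ε / 2` at `0`.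
  refine ⟨_, isTangentTo_hamiltonianSubmanifold hk hL hw hwo
    (η := fun s => (ambientChart e k w).1
      + (ε / 2 * Real.sin s) • ((1, 0) : Coord n (2 * k - 1)))
    (v := (ε / 2) • (1, 0)) ?_ (fun s => hball ?_) (by simp) ?_, ?_⟩
  · exact contDiff_const.add ((contDiff_const.mul Real.contDiff_sin).smul contDiff_const)
  · rw [mem_ball_iff_norm, add_sub_cancel_left, norm_smul, norm_mul]
    have h2 : ‖((1, 0) : Coord n (2 * k - 1))‖ = 1 := by simp [Prod.norm_def]
    have h3 := Real.abs_sin_le_one s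
    have h4 : ‖ε / 2‖ = ε / 2 := Real.norm_of_nonneg (by positivity)
    rw [h2, h4, mul_one, Real.norm_eq_abs]
    nlinarith
  · have h2 := (((Real.hasDerivAt_sin 0).const_mul (ε / 2)).smul_const
      ((1, 0) : Coord n (2 * k - 1))).const_add (ambientChart e k w).1
    simpa using h2
  · rw [ambientCoframe_mfderiv_symm hw]
    have h2 : (Coord.trunc (k - 1) ((ε / 2) • ((1, 0) : Coord n (2 * k - 1)))).1 = ε / 2 := by
      simp [Coord.trunc]
    rw [h2]
    positivity

/-- For necessity, `χ ∂/∂q_k^A` is used as test field, with a bump function `χ` equal to `1` at the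
point. Contracted with a tangent vector `v`, the form gives minus the defect times `dt(v)`, and some
`v` has `dt(v) ≠ 0`. -/
theorem mem_constraintSubmanifold_iff [T2Space E] [IsManifold (𝓡 (n + 1)) ∞ E] (hk : 1 ≤ k)
    (hL : ContMDiff 𝓘(ℝ, Coord n k) 𝓘(ℝ, ℝ) ∞ L)
    {e : AdaptedChart n π} {w : Ambient n π k} (hw : w ∈ (ambientChart e k).source) :
    w ∈ constraintSubmanifold L ↔ w ∈ hamiltonianSubmanifold L ∧
      ∀ A, momentaL n (k - 1) (ambientChart e k w).2.2 (Fin.last _) A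
        = Coord.partialQ k A (localLagrangian e L) (Coord.trunc k (ambientChart e k w).1) := by
  refine ⟨fun h => ⟨h.1, fun A => ?_⟩,
    fun h => mem_constraintSubmanifold_of_momenta hk hL hw h.1 h.2⟩
  obtain ⟨χ, -, hχ⟩ := (SmoothBumpFunction.nhds_basis_tsupport (I := 𝓡 (n + 1))
    w.1.value).mem_iff.1 (e.open_source.mem_nhds (mem_ambientChart_source.1 hw).1)
  obtain ⟨v, hv, hv0⟩ := exists_isTangentTo_time hk hL hw h.1
  have h1 := h.2 _ (isVerticalField_verticalField hk hL e χ.contMDiff hχ A) v hv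
  have h2 : verticalField e L χ A w = mfderiv 𝓘(ℝ, AmbientCoord n k) (ambientModel n k)
      (ambientChart e k).symm (ambientChart e k w)
      (hamiltonianLift e L (ambientChart e k w) (topVector n _ k A)) := by
    refine (verticalField_of_mem hw).trans ?_
    rw [χ.eq_one, one_smul]
  rw [presymplecticForm_eq hw, h2, ambientCoframe_mfderiv_symm hw] at h1
  have h3 : (hamiltonianLift e L (ambientChart e k w) (topVector n _ k A)).2.1 = 0 :=
    trunc_topVector (by omega) A
  rw [h3, map_zero, zero_sub, neg_eq_zero] at h1
  have h4 : couplingDefect e L (ambientChart e k w) (topVector n _ k A)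
      * (ambientCoframe e v).2.1.1 = 0 := h1
  have h5 := (mul_eq_zero.1 h4).resolve_right hv0
  rw [couplingDefect_topVector hk, sub_eq_zero] at h5
  exact h5.symm

end Constraint

/-! ### Dimensions and slice charts of `W_o` and `W_c` -/

section Submanifolds

variable {n : ℕ} {E : Type*} [TopologicalSpace E]
  [ChartedSpace (EuclideanSpace ℝ (Fin (n + 1))) E] {π : E → ℝ} [IsFibred n π] {m k : ℕ}
  {L : Jet n π k → ℝ}

theorem finrank_coord (n m : ℕ) : Module.finrank ℝ (Coord n m) = 1 + (m + 1) * n := by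
  simp [Module.finrank_pi_fintype]

theorem finrank_coord_dual (n m : ℕ) :
    Module.finrank ℝ (Coord n m →L[ℝ] ℝ) = 1 + (m + 1) * n := by
  rw [← (LinearMap.toContinuousLinearMap (𝕜 := ℝ) (E := Coord n m) (F' := ℝ)).finrank_eq,
    Module.finrank_linearMap, finrank_coord, Module.finrank_self, mul_one]

theorem finrank_coord_prod (n m : ℕ) (F : Type*) [AddCommGroup F] [Module ℝ F]
    [Module.Finite ℝ F] [Module.Free ℝ F] :
    Module.finrank ℝ (Coord n m × F) = 1 + (m + 1) * n + Module.finrank ℝ F := by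
  rw [Module.finrank_prod, finrank_coord]

theorem finrank_ambientCoord (hk : 1 ≤ k) :
    Module.finrank ℝ (AmbientCoord n k) = 4 * k * n + 3 := by
  rw [finrank_coord_prod, finrank_coord_prod, finrank_coord_dual]
  obtain ⟨j, rfl⟩ := Nat.exists_eq_add_of_le' hk
  rw [show 2 * (j + 1) - 1 + 1 = 2 * j + 2 by omega, show j + 1 - 1 + 1 = j + 1 by omega]
  ring

/-- The linear part `(t, q_0, …, q_m) ↦ (0, q_1, …, q_{r+1})` of the holonomic lift. -/
def Coord.liftL (n m r : ℕ) : Coord n m →L[ℝ] Coord n r :=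
  (Coord.shiftL n r).comp (Coord.truncL n m (r + 1))

theorem Coord.lift_eq (r : ℕ) (c : Coord n m) : Coord.lift r c = (1, 0) + Coord.liftL n m r c :=
  rfl

theorem Coord.liftL_fst (r : ℕ) (c : Coord n m) : (Coord.liftL n m r c).1 = 0 := rfl

/-- The part of `J^{2k-1}π × T^*(J^{k-1}π)` in coordinates on which the local expressions are
smooth. -/
def ambientDomain (e : AdaptedChart n π) (k : ℕ) : Set (AmbientCoord n k) :=
  {z | z.1 ∈ jetTarget e (2 * k - 1)}

theorem isOpen_ambientDomain (e : AdaptedChart n π) (k : ℕ) : IsOpen (ambientDomain e k) :=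
  (isOpen_jetTarget e (2 * k - 1)).preimage continuous_fst

theorem ambientChart_target_subset (e : AdaptedChart n π) (k : ℕ) :
    (ambientChart e k).target ⊆ ambientDomain e k :=
  fun _ hz => (mem_ambientChart_target.1 hz).1

theorem isEmbeddedSubmanifold_hamiltonianSubmanifold (hk : 1 ≤ k)
    (hL : ContMDiff 𝓘(ℝ, Coord n k) 𝓘(ℝ, ℝ) ∞ L) :
    IsEmbeddedSubmanifold (ambientModel n k) (hamiltonianSubmanifold L) (3 * k * n + 1) := by
  -- The dependent coordinates: the base point of the covector, and `p`. The section `σ` reinserts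
  -- them, `p` as `p dt`.
  let ρ : AmbientCoord n k →L[ℝ] Coord n (k - 1) × ℝ :=
    ((ContinuousLinearMap.id ℝ (Coord n (k - 1))).prodMap
      (ContinuousLinearMap.apply ℝ ℝ ((1, 0) : Coord n (k - 1)))).comp
      (ContinuousLinearMap.snd ℝ (Coord n (2 * k - 1)) _)
  let σ : Coord n (k - 1) × ℝ →L[ℝ] AmbientCoord n k :=
    ContinuousLinearMap.prod 0 ((ContinuousLinearMap.id ℝ (Coord n (k - 1))).prodMap
      ((ContinuousLinearMap.id ℝ ℝ).smulRight
        (ContinuousLinearMap.fst ℝ ℝ (Fin (k - 1 + 1) → Fin n → ℝ))))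
  refine isEmbeddedSubmanifold_of_forall_exists ?_ ρ σ ?_ fun w hwo => ?_
  · rw [finrank_ambientCoord hk, finrank_coord_prod, Module.finrank_self,
      Nat.sub_add_cancel hk]
    ring
  · rintro ⟨c, r⟩
    exact Prod.ext rfl (by simp [ρ, σ])
  obtain ⟨e, hw⟩ := exists_mem_ambientChart_source hwo.1
  -- Unlike the chart target, `ambientDomain` does not restrict the base point of the covector, so
  -- it is invariant under translation by `σ`. The right-hand side does not see `p`, because `liftL`
  -- has zero time component.
  refine ⟨ambientChart e k, isSmoothChart_ambientChart e k, hw, ambientDomain e k, fun z =>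
    (Coord.trunc (k - 1) z.1, localLagrangian e L (Coord.trunc k z.1)
      - z.2.2 (Coord.liftL n _ (k - 1) z.1)), isOpen_ambientDomain e k,
    ambientChart_target_subset e k, ?_, ?_, fun y hy => ?_⟩
  · refine ((Coord.contDiff_trunc (k - 1)).comp contDiff_fst).contDiffOn.prodMk
      (((contDiffOn_localLagrangian_trunc hL e).comp contDiffOn_fst fun z hz => hz).sub ?_)
    exact ContDiff.contDiffOn (by fun_prop)
  · rintro z hz ⟨c, r⟩
    have h1 : (z + σ (c, r)).1 = z.1 := add_zero _
    refine ⟨?_, ?_⟩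
    · change (z + σ (c, r)).1 ∈ jetTarget e _
      rw [h1]; exact hz
    · have h2 : (z + σ (c, r)).2.2 = z.2.2 + r •
        ContinuousLinearMap.fst ℝ ℝ (Fin (k - 1 + 1) → Fin n → ℝ) := rfl
      simp only [h1, h2]
      simp [Coord.liftL_fst]
  · rw [mem_hamiltonianSubmanifold_iff hk hy, Coord.lift_eq, map_add, ← eq_sub_iff_add_eq]
    exact ⟨fun h => Prod.ext h.1 h.2, fun h => ⟨congrArg Prod.fst h, congrArg Prod.snd h⟩⟩

/-- `pairing` as a linear map in the momenta. -/
def pairingL (n m : ℕ) : (Fin (m + 1) → Fin n → ℝ) →L[ℝ] (Coord n m →L[ℝ] ℝ) :=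
  LinearMap.toContinuousLinearMap
    { toFun := pairing
      map_add' := fun p p' => by
        refine ContinuousLinearMap.ext fun v => ?_
        simp [pairing_apply, add_mul, Finset.sum_add_distrib]
      map_smul' := fun r p => by
        refine ContinuousLinearMap.ext fun v => ?_
        simp [pairing_apply, mul_assoc, Finset.mul_sum] }

theorem momentaL_pairing (p : Fin (m + 1) → Fin n → ℝ) : momentaL n m (pairing p) = p := by
  ext i A
  rw [momentaL_apply, pairing_single]

theorem pairing_single_apply (i : Fin (m + 1)) (u : Fin n → ℝ) (v : Coord n m) :
    pairing (Pi.single i u) v = ∑ A, u A * v.2 i A := by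
  rw [pairing_apply, Finset.sum_eq_single i (fun j _ hj => by simp [Pi.single_eq_of_ne hj])
    (by simp)]
  simp

/-- The projection `(t, q_0, …, q_m) ↦ (t, q_0, …, q_{m-1}, 0)`. -/
def Coord.dropLast (n m : ℕ) : Coord n m →L[ℝ] Coord n m :=
  ContinuousLinearMap.id ℝ _ - ContinuousLinearMap.prod 0
    ((ContinuousLinearMap.single ℝ (fun _ : Fin (m + 1) => Fin n → ℝ) (Fin.last m)).comp
      ((ContinuousLinearMap.proj (R := ℝ) (φ := fun _ : Fin (m + 1) => Fin n → ℝ)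
        (Fin.last m)).comp (ContinuousLinearMap.snd ℝ ℝ _)))

theorem Coord.dropLast_fst (v : Coord n m) : (Coord.dropLast n m v).1 = v.1 := by
  simp [Coord.dropLast]

theorem Coord.dropLast_last (v : Coord n m) : (Coord.dropLast n m v).2 (Fin.last m) = 0 := by
  simp [Coord.dropLast]

/-- Isolates the top momentum, so that on `W_c` it can be replaced by `∂L/∂q_k` in the equation for
`p`. -/
theorem apply_eq_dropLast (a : Coord n m →L[ℝ] ℝ) (v : Coord n m) :
    a v = a (Coord.dropLast n m v)
      + ∑ A, momentaL n m a (Fin.last m) A * v.2 (Fin.last m) A := by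
  have h1 : v = Coord.dropLast n m v + (0, Pi.single (Fin.last m) (v.2 (Fin.last m))) := by
    simp [Coord.dropLast]
  have h2 : a (0, Pi.single (Fin.last m) (v.2 (Fin.last m)))
      = ∑ A, momentaL n m a (Fin.last m) A * v.2 (Fin.last m) A := by
    rw [eq_pairing, zero_mul, zero_add, pairing_apply, Finset.sum_eq_single (Fin.last m)
      (fun j _ hj => by simp [Pi.single_eq_of_ne hj]) (by simp)]
    simp [momentaL_apply]
  conv_lhs => rw [h1]
  rw [map_add, h2]

/-- The dependent coordinates are now the base point, `p` and the top momenta. Substituting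
`∂L/∂q_k` for the top momenta in the equation for `p` makes the right-hand side independent of all
of them. The codimension grows by `n`. -/
theorem isEmbeddedSubmanifold_constraintSubmanifold [T2Space E] [IsManifold (𝓡 (n + 1)) ∞ E]
    (hk : 1 ≤ k) (hL : ContMDiff 𝓘(ℝ, Coord n k) 𝓘(ℝ, ℝ) ∞ L) :
    IsEmbeddedSubmanifold (ambientModel n k) (constraintSubmanifold L)
      ((3 * k - 1) * n + 1) := by
  let ρ : AmbientCoord n k →L[ℝ] Coord n (k - 1) × (ℝ × (Fin n → ℝ)) :=
    ((ContinuousLinearMap.id ℝ (Coord n (k - 1))).prodMap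
      ((ContinuousLinearMap.apply ℝ ℝ ((1, 0) : Coord n (k - 1))).prod
        ((ContinuousLinearMap.proj (R := ℝ) (φ := fun _ : Fin (k - 1 + 1) => Fin n → ℝ)
          (Fin.last _)).comp (momentaL n (k - 1))))).comp
      (ContinuousLinearMap.snd ℝ (Coord n (2 * k - 1)) _)
  let σ : Coord n (k - 1) × (ℝ × (Fin n → ℝ)) →L[ℝ] AmbientCoord n k :=
    ContinuousLinearMap.prod 0 ((ContinuousLinearMap.id ℝ (Coord n (k - 1))).prodMap
      (((ContinuousLinearMap.fst ℝ ℝ (Fin n → ℝ)).smulRight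
        (ContinuousLinearMap.fst ℝ ℝ (Fin (k - 1 + 1) → Fin n → ℝ)))
        + (pairingL n (k - 1)).comp ((ContinuousLinearMap.single ℝ
          (fun _ : Fin (k - 1 + 1) => Fin n → ℝ) (Fin.last _)).comp
            (ContinuousLinearMap.snd ℝ ℝ (Fin n → ℝ)))))
  have hσ : ∀ (z : AmbientCoord n k) c r u, z + σ (c, r, u) = (z.1, z.2.1 + c,
      z.2.2 + (r • ContinuousLinearMap.fst ℝ ℝ (Fin (k - 1 + 1) → Fin n → ℝ)
        + pairing (Pi.single (Fin.last _) u))) := fun z c r u =>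
    Prod.ext (add_zero _) rfl
  refine isEmbeddedSubmanifold_of_forall_exists ?_ ρ σ ?_ fun w hwc => ?_
  · rw [finrank_ambientCoord hk, finrank_coord_prod, Module.finrank_prod,
      Module.finrank_self, Nat.sub_add_cancel hk, Module.finrank_fin_fun]
    obtain ⟨j, rfl⟩ := Nat.exists_eq_add_of_le' hk
    rw [show 3 * (j + 1) - 1 = 3 * j + 2 by omega]
    ring
  · rintro ⟨c, r, u⟩
    have h1 : σ (c, r, u) = (0, c, r • ContinuousLinearMap.fst ℝ ℝ (Fin (k - 1 + 1) → Fin n → ℝ)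
        + pairing (Pi.single (Fin.last _) u)) := rfl
    refine Prod.ext rfl (Prod.ext ?_ ?_)
    · change (r • ContinuousLinearMap.fst ℝ ℝ (Fin (k - 1 + 1) → Fin n → ℝ)
        + pairing (Pi.single (Fin.last _) u) : Coord n (k - 1) →L[ℝ] ℝ) (1, 0) = r
      simp [pairing_single_apply]
    · change momentaL n (k - 1) (r • ContinuousLinearMap.fst ℝ ℝ (Fin (k - 1 + 1) → Fin n → ℝ)
        + pairing (Pi.single (Fin.last _) u)) (Fin.last _) = u
      rw [map_add, momentaL_smul_fst, momentaL_pairing, zero_add, Pi.single_eq_same]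
  obtain ⟨e, hw⟩ := exists_mem_ambientChart_source hwc.1.1
  refine ⟨ambientChart e k, isSmoothChart_ambientChart e k, hw, ambientDomain e k, fun z =>
    (Coord.trunc (k - 1) z.1, localLagrangian e L (Coord.trunc k z.1)
      - (z.2.2 (Coord.dropLast n (k - 1) (Coord.liftL n _ (k - 1) z.1))
        + ∑ A, Coord.partialQ k A (localLagrangian e L) (Coord.trunc k z.1)
          * (Coord.liftL n _ (k - 1) z.1).2 (Fin.last _) A),
      fun A => Coord.partialQ k A (localLagrangian e L) (Coord.trunc k z.1)),
    isOpen_ambientDomain e k, ambientChart_target_subset e k, ?_, ?_, fun y hy => ?_⟩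
  · have h1 : ∀ A, ContDiffOn ℝ ∞ (fun z : AmbientCoord n k =>
        Coord.partialQ k A (localLagrangian e L) (Coord.trunc k z.1)) (ambientDomain e k) :=
      fun A => (contDiffOn_partialQ (isOpen_jetTarget e k) (contDiffOn_localLagrangian hL e) k
        A).comp ((Coord.contDiff_trunc k).comp contDiff_fst).contDiffOn
        fun z hz => mem_jetTarget_trunc.2 hz
    refine ((Coord.contDiff_trunc (k - 1)).comp contDiff_fst).contDiffOn.prodMk
      ((((contDiffOn_localLagrangian_trunc hL e).comp contDiffOn_fst fun z hz => hz).sub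
        (ContDiffOn.add (ContDiff.contDiffOn (by fun_prop))
          (ContDiffOn.sum fun A _ => (h1 A).mul (ContDiff.contDiffOn ?_)))).prodMk
        (contDiffOn_pi.2 h1))
    have h2 : ContDiff ℝ ∞ (fun v : Coord n (k - 1) => v.2 (Fin.last _) A) := by fun_prop
    exact h2.comp ((Coord.liftL n _ (k - 1)).contDiff.comp contDiff_fst)
  · rintro z hz ⟨c, r, u⟩
    rw [hσ]
    refine ⟨hz, ?_⟩
    simp only [_root_.add_apply, _root_.smul_apply, ContinuousLinearMap.coe_fst',
      pairing_single_apply, Coord.dropLast_fst, Coord.dropLast_last, Coord.liftL_fst]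
    simp
  · rw [mem_constraintSubmanifold_iff hk hL hy, mem_hamiltonianSubmanifold_iff hk hy,
      Coord.lift_eq, map_add, apply_eq_dropLast _ (Coord.liftL _ _ _ _)]
    constructor
    · rintro ⟨⟨h1, h2⟩, h3⟩
      refine Prod.ext h1 (Prod.ext ?_ (funext h3))
      simp only [h3] at h2
      exact eq_sub_of_add_eq h2
    · intro h
      have h1 := congrArg Prod.fst h
      have h2 := congrArg (fun x => x.2.1) h
      have h3 := fun A => congrFun (congrArg (fun x => x.2.2) h) A
      refine ⟨⟨h1, ?_⟩, h3⟩
      have h4 : ∀ A, momentaL n (k - 1) (ambientChart e k y).2.2 (Fin.last _) A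
        = Coord.partialQ k A (localLagrangian e L) (Coord.trunc k (ambientChart e k y).1) := h3
      simp only [h4]
      exact add_eq_of_eq_sub h2

end Submanifolds

/-! ### The Legendre–Ostrogradsky covector and its chart independence -/

section Legendre

variable {n : ℕ} {E : Type*} [TopologicalSpace E]
  [ChartedSpace (EuclideanSpace ℝ (Fin (n + 1))) E] {π : E → ℝ} [IsFibred n π] {m k : ℕ}
  {L : Jet n π k → ℝ}

theorem contDiffOn_ostrogradsky (hL : ContMDiff 𝓘(ℝ, Coord n k) 𝓘(ℝ, ℝ) ∞ L)
    (e : AdaptedChart n π) (r : ℕ) (A : Fin n) :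
    ContDiffOn ℝ ∞ (ostrogradsky e L r A) (jetTarget e (2 * k - 1)) := by
  refine ContDiffOn.sum fun i _ => contDiffOn_const.mul ?_
  refine (contDiffOn_totalDerivIter (isOpen_jetTarget e k) (contDiffOn_partialQ
    (isOpen_jetTarget e k) (contDiffOn_localLagrangian hL e) (r + i) A) i).comp
    (Coord.contDiff_trunc (k + i)).contDiffOn fun c hc => ?_
  change Coord.trunc k (Coord.trunc (k + i) c) ∈ jetTarget e k
  rw [Coord.trunc_trunc (by omega)]
  exact mem_jetTarget_trunc.2 hc

theorem ostrogradsky_self {r : ℕ} (hr : r = k) (e : AdaptedChart n π) (A : Fin n)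
    (c : Coord n (2 * k - 1)) :
    ostrogradsky e L r A c = Coord.partialQ k A (localLagrangian e L) (Coord.trunc k c) := by
  subst hr
  simp [ostrogradsky, totalDerivIter]

/-- Along a prolonged curve `d_T^i` is the `i`th derivative. The orders that occur are `k + i ≤ 2 *
k - r`, so `1 ≤ r` is what makes jets of order `2 * k - 1` suffice. -/
theorem ostrogradsky_jetCurve (hL : ContMDiff 𝓘(ℝ, Coord n k) 𝓘(ℝ, ℝ) ∞ L)
    {e : AdaptedChart n π} {γ : ℝ → Fin n → ℝ} {D : Set ℝ} (hD : IsOpen D)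
    (hγ : ContDiffOn ℝ ∞ γ D) (hγe : ∀ s ∈ D, jetCurve γ k s ∈ jetTarget e k) {r : ℕ}
    (hr : 1 ≤ r) (hrk : r ≤ k) (A : Fin n) {s : ℝ} (hs : s ∈ D) :
    ostrogradsky e L r A (jetCurve γ (2 * k - 1) s)
      = curveMomentum (localLagrangian e L) γ r A s := by
  refine Finset.sum_congr rfl fun i hi => ?_
  rw [Finset.mem_range] at hi
  rw [trunc_jetCurve γ (by omega), iteratedDeriv_comp_jetCurve hD hγ (isOpen_jetTarget e k)
    (contDiffOn_partialQ (isOpen_jetTarget e k) (contDiffOn_localLagrangian hL e) (r + i) A)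
    hγe i s hs]

/-- The covector `p dt + ∑ p_A^i dq_i^A` of the Legendre–Ostrogradsky map in coordinates. -/
def legendreCovector (e : AdaptedChart n π) (L : Jet n π k → ℝ) (c : Coord n (2 * k - 1)) :
    Coord n (k - 1) →L[ℝ] ℝ :=
  (localLagrangian e L (Coord.trunc k c)
    - ∑ r ∈ Finset.Icc 1 k, ∑ A, c.q r A * ostrogradsky e L r A c) •
      ContinuousLinearMap.fst ℝ ℝ (Fin (k - 1 + 1) → Fin n → ℝ)
    + pairing fun i A => ostrogradsky e L (i + 1) A c

theorem contDiffOn_legendreCovector (hL : ContMDiff 𝓘(ℝ, Coord n k) 𝓘(ℝ, ℝ) ∞ L)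
    (e : AdaptedChart n π) :
    ContDiffOn ℝ ∞ (legendreCovector e L) (jetTarget e (2 * k - 1)) := by
  have hq : ∀ r A, ContDiff ℝ ∞ (fun c : Coord n (2 * k - 1) => c.q r A) := by
    intro r A
    unfold Coord.q
    split_ifs
    · fun_prop
    · exact contDiff_const
  refine (((contDiffOn_localLagrangian_trunc hL e).sub (ContDiffOn.sum fun r _ =>
    ContDiffOn.sum fun A _ => (hq r A).contDiffOn.mul (contDiffOn_ostrogradsky hL e r A))).smul
      (contDiffOn_const
        (c := ContinuousLinearMap.fst ℝ ℝ (Fin (k - 1 + 1) → Fin n → ℝ)))).add ?_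
  exact (pairingL n (k - 1)).contDiff.comp_contDiffOn (contDiffOn_pi.2 fun i =>
    contDiffOn_pi.2 fun A => contDiffOn_ostrogradsky hL e (i + 1) A)

theorem momentaL_legendreCovector (e : AdaptedChart n π) (L : Jet n π k → ℝ)
    (c : Coord n (2 * k - 1)) (i : Fin (k - 1 + 1)) (A : Fin n) :
    momentaL n (k - 1) (legendreCovector e L c) i A = ostrogradsky e L (i + 1) A c := by
  rw [legendreCovector, map_add, momentaL_smul_fst, momentaL_pairing, zero_add]

theorem legendreCovector_time (e : AdaptedChart n π) (L : Jet n π k → ℝ)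
    (c : Coord n (2 * k - 1)) : legendreCovector e L c (1, 0)
      = localLagrangian e L (Coord.trunc k c)
        - ∑ r ∈ Finset.Icc 1 k, ∑ A, c.q r A * ostrogradsky e L r A c := by
  simp [legendreCovector, pairing_apply]

theorem pairing_eq_sum_range (hk : 1 ≤ k) (p : ℕ → Fin n → ℝ) (v : ℕ → Fin n → ℝ)
    (t : ℝ) : pairing (fun (i : Fin (k - 1 + 1)) A => p i A) (t, fun i : Fin (k - 1 + 1) => v i)
      = ∑ r ∈ Finset.range k, ∑ A, p r A * v r A := by
  rw [pairing_apply, ← Fin.sum_univ_eq_sum_range (fun r => ∑ A, p r A * v r A)]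
  obtain ⟨j, rfl⟩ := Nat.exists_eq_add_of_le' hk
  rfl

theorem Coord.lift_eq_q {r : ℕ} (hr : r < m) (c : Coord n m) :
    Coord.lift r c = (1, fun i : Fin (r + 1) => c.q (i + 1)) := by
  refine Prod.ext (Coord.lift_fst r c) (funext fun i => funext fun A => ?_)
  simp [Coord.lift, Coord.shiftL, Coord.trunc, Coord.q, show (i : ℕ) < m by omega]

/-- The coefficient `p` is chosen for this cancellation. It puts the graph into `W_o` and settles
chart independence in the holonomic direction. -/
theorem legendreCovector_lift (hk : 1 ≤ k) (e : AdaptedChart n π) (L : Jet n π k → ℝ)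
    (c : Coord n (2 * k - 1)) : legendreCovector e L c (Coord.lift (k - 1) c)
      = localLagrangian e L (Coord.trunc k c) := by
  have h1 : ∑ r ∈ Finset.Icc 1 k, ∑ A, c.q r A * ostrogradsky e L r A c
      = ∑ r ∈ Finset.range k, ∑ A, ostrogradsky e L (r + 1) A c * c.q (r + 1) A := by
    rw [Finset.range_eq_Ico, Finset.sum_Ico_add' (fun r => ∑ A, ostrogradsky e L r A c * c.q r A)
      0 k 1, zero_add]
    simp only [mul_comm]
    rfl
  rw [Coord.lift_eq_q (by omega), legendreCovector, _root_.add_apply,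
    pairing_eq_sum_range hk (fun i A => ostrogradsky e L (i + 1) A c) (fun i => c.q (i + 1)), h1]
  simp

/-- Translates the invariance of the boundary term into invariance of the covector on vectors
vertical over `ℝ`. -/
theorem legendreCovector_jetVariation (hk : 1 ≤ k)
    (hL : ContMDiff 𝓘(ℝ, Coord n k) 𝓘(ℝ, ℝ) ∞ L)
    {e : AdaptedChart n π} {γ : ℝ → Fin n → ℝ} {D : Set ℝ} (hD : IsOpen D)
    (hγ : ContDiffOn ℝ ∞ γ D) (hγe : ∀ s ∈ D, jetCurve γ k s ∈ jetTarget e k)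
    (ξ : ℝ → Fin n → ℝ) {s : ℝ} (hs : s ∈ D) :
    legendreCovector e L (jetCurve γ (2 * k - 1) s) (jetVariation ξ (k - 1) s)
      = boundaryTerm (localLagrangian e L) γ ξ s := by
  rw [legendreCovector, _root_.add_apply, jetVariation, pairing_eq_sum_range hk
    (fun i A => ostrogradsky e L (i + 1) A (jetCurve γ (2 * k - 1) s))
    (fun i => iteratedDeriv i ξ s), boundaryTerm]
  simp only [_root_.smul_apply, ContinuousLinearMap.coe_fst', smul_zero, zero_add]
  refine Finset.sum_congr rfl fun r hr => Finset.sum_congr rfl fun A _ => ?_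
  rw [ostrogradsky_jetCurve hL hD hγ hγe (by omega) (Finset.mem_range.1 hr) A hs]

section Transition

variable {e e' : AdaptedChart n π} {φ : LocalSection n π}

theorem LocalSection.jetCurve_coord_mem {s : ℝ} (hs : s ∈ φ.domIn e) (m : ℕ) :
    jetCurve (φ.coord e) m s ∈ jetTarget e m := by
  have h := (jetChart e m).map_source (x := Jet.mk m ⟨φ, s, hs.1⟩)
    (by rw [mem_jetChart_source, Jet.value_mk]; exact hs.2)
  rwa [jetChart_mk e (a := ⟨φ, s, hs.1⟩) hs.2] at h

omit [IsFibred n π] in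
theorem LocalSection.trunc_jetCurve_coord_mem {s : ℝ} (hs : s ∈ φ.domIn e)
    (hs' : s ∈ φ.domIn e') (m : ℕ) :
    Coord.trunc 0 (jetCurve (φ.coord e) m s) ∈ transitionDomain e e' :=
  PreJet.trunc_coords_mem ⟨φ, s, hs.1⟩ e e' hs.2 hs'.2

omit [IsFibred n π] in
theorem LocalSection.jetCurve_coord {s : ℝ} (hs : s ∈ φ.domIn e) (hs' : s ∈ φ.domIn e') (m : ℕ) :
    jetCurve (φ.coord e') m s = jetTransition e e' m (jetCurve (φ.coord e) m s) :=
  PreJet.coords_eq_jetTransition ⟨φ, s, hs.1⟩ e e' hs.2 hs'.2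

omit [IsFibred n π] in
theorem isOpen_trunc_transitionDomain (e e' : AdaptedChart n π) (m : ℕ) :
    IsOpen {c : Coord n m | Coord.trunc 0 c ∈ transitionDomain e e'} :=
  (isOpen_transitionDomain e e').preimage (Coord.contDiff_trunc 0).continuous

omit [IsFibred n π] in
theorem differentiableAt_jetTransition {c : Coord n m}
    (hc : Coord.trunc 0 c ∈ transitionDomain e e') :
    DifferentiableAt ℝ (jetTransition e e' m) c :=
  ((contDiffOn_jetTransition e e' m).contDiffAt
    ((isOpen_trunc_transitionDomain e e' m).mem_nhds hc)).differentiableAt (by simp)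

/-- The first variation of the Lagrangian along a section does not depend on the chart. -/
theorem variation_localLagrangian (hL : ContMDiff 𝓘(ℝ, Coord n k) 𝓘(ℝ, ℝ) ∞ L)
    {ξ : ℝ → Fin n → ℝ} (hξ : ContDiff ℝ ∞ ξ) {s : ℝ} (hs : s ∈ φ.domIn e)
    (hs' : s ∈ φ.domIn e') :
    variation (localLagrangian e L) (φ.coord e) ξ s
      = variation (localLagrangian e' L) (φ.coord e')
        (variation (fibreTransition e e') (φ.coord e) ξ) s := by
  have hc := LocalSection.trunc_jetCurve_coord_mem hs hs' k
  have h1 : localLagrangian e L =ᶠ[𝓝 (jetCurve (φ.coord e) k s)]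
      localLagrangian e' L ∘ jetTransition e e' k := by
    filter_upwards [(isOpen_trunc_transitionDomain e e' k).mem_nhds hc] with c hc
    exact (localLagrangian_jetTransition hc).symm
  have h2 : DifferentiableAt ℝ (localLagrangian e' L)
      (jetTransition e e' k (jetCurve (φ.coord e) k s)) := by
    rw [← LocalSection.jetCurve_coord hs hs' k]
    exact ((contDiffOn_localLagrangian hL e').contDiffAt ((isOpen_jetTarget e' k).mem_nhds
      (LocalSection.jetCurve_coord_mem hs' k))).differentiableAt (by simp)
  rw [variation, h1.fderiv_eq, fderiv_comp _ h2 (differentiableAt_jetTransition hc),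
    ← LocalSection.jetCurve_coord hs hs' k, ContinuousLinearMap.comp_apply,
    fderiv_jetTransition e e' ((φ.isOpen_domIn e).inter (φ.isOpen_domIn e'))
      ((φ.contDiffOn_coord e).mono inter_subset_left) hξ.contDiffOn (fun s hs => ?_) ⟨hs, hs'⟩]
  · rfl
  · have := LocalSection.trunc_jetCurve_coord_mem hs.1 hs.2 0
    rwa [Coord.trunc_self] at this

-- The lift is the velocity of the jet curve, and the transition maps the jet curve in one chart to
-- that in the other.
omit [IsFibred n π] in
theorem fderiv_jetTransition_lift {r : ℕ} (hr : r < m) {s : ℝ} (hs : s ∈ φ.domIn e)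
    (hs' : s ∈ φ.domIn e') :
    fderiv ℝ (jetTransition e e' r) (jetCurve (φ.coord e) r s)
      (Coord.lift r (jetCurve (φ.coord e) m s)) = Coord.lift r (jetCurve (φ.coord e') m s) := by
  have hd : ∀ {e : AdaptedChart n π}, s ∈ φ.domIn e →
      HasDerivAt (jetCurve (φ.coord e) r) (Coord.lift r (jetCurve (φ.coord e) m s)) s := by
    intro e hs
    rw [Coord.lift_jetCurve _ hr]
    exact hasDerivAt_jetCurve ((φ.contDiffOn_coord e).contDiffAt
      ((φ.isOpen_domIn e).mem_nhds hs)) r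
  have h1 := (differentiableAt_jetTransition
    (LocalSection.trunc_jetCurve_coord_mem hs hs' r)).hasFDerivAt.comp_hasDerivAt s (hd hs)
  refine (h1.congr_of_eventuallyEq ?_).unique (hd hs')
  filter_upwards [(φ.isOpen_domIn e).mem_nhds hs, (φ.isOpen_domIn e').mem_nhds hs'] with x hx hx'
  exact LocalSection.jetCurve_coord hx hx' r

/-- The Legendre–Ostrogradsky covector does not depend on the chart. -/
theorem legendreCovector_eq (hk : 1 ≤ k) (hL : ContMDiff 𝓘(ℝ, Coord n k) 𝓘(ℝ, ℝ) ∞ L)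
    {s : ℝ} (hs : s ∈ φ.domIn e) (hs' : s ∈ φ.domIn e') (v : Coord n (k - 1)) :
    legendreCovector e L (jetCurve (φ.coord e) (2 * k - 1) s) v
      = legendreCovector e' L (jetCurve (φ.coord e') (2 * k - 1) s)
        (fderiv ℝ (jetTransition e e' (k - 1)) (jetCurve (φ.coord e) (k - 1) s) v) := by
  set X := Coord.lift (k - 1) (jetCurve (φ.coord e) (2 * k - 1) s) with hX
  have hD := (φ.isOpen_domIn e).inter (φ.isOpen_domIn e')
  have hγ := (φ.contDiffOn_coord e).mono (inter_subset_left (t := φ.domIn e'))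
  have hγ' := (φ.contDiffOn_coord e').mono (inter_subset_right (s := φ.domIn e))
  have hU : ∀ s ∈ φ.domIn e ∩ φ.domIn e', jetCurve (φ.coord e) 0 s ∈ transitionDomain e e' := by
    intro s hs
    have := LocalSection.trunc_jetCurve_coord_mem hs.1 hs.2 0
    rwa [Coord.trunc_self] at this
  -- Subtracting `v.1 • X` removes the time component. The rest is the prolongation at `s` of the
  -- Taylor polynomial with these derivatives.
  obtain ⟨ξ, hξ, hv⟩ : ∃ ξ : ℝ → Fin n → ℝ, ContDiff ℝ ∞ ξ ∧
      v = v.1 • X + jetVariation ξ (k - 1) s := by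
    refine ⟨taylorCurve ((s, (v - v.1 • X).2) : Coord n (k - 1)), contDiff_taylorCurve _, ?_⟩
    have h1 : (v - v.1 • X).1 = 0 := by simp [hX, Coord.lift_fst]
    have h2 : jetCurve (taylorCurve ((s, (v - v.1 • X).2) : Coord n (k - 1))) (k - 1) s
        = (s, (v - v.1 • X).2) := jetCurve_taylorCurve ((s, (v - v.1 • X).2) : Coord n (k - 1))
    have h3 : jetVariation (taylorCurve ((s, (v - v.1 • X).2) : Coord n (k - 1))) (k - 1) s
        = v - v.1 • X := Prod.ext h1.symm (congrArg Prod.snd h2 :)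
    rw [h3, add_sub_cancel]
  rw [hv]
  simp only [map_add, map_smul]
  congr 1
  -- On the holonomic lift both covectors give the value of the Lagrangian at the same jet.
  · rw [fderiv_jetTransition_lift (by omega) hs hs', legendreCovector_lift hk,
      legendreCovector_lift hk, trunc_jetCurve _ (by omega), trunc_jetCurve _ (by omega),
      LocalSection.jetCurve_coord hs hs' k, localLagrangian_jetTransition
      (LocalSection.trunc_jetCurve_coord_mem hs hs' k)]
  · rw [fderiv_jetTransition e e' hD hγ hξ.contDiffOn hU ⟨hs, hs'⟩,
      legendreCovector_jetVariation hk hL hD hγ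
        (fun s hs => LocalSection.jetCurve_coord_mem hs.1 k) ξ ⟨hs, hs'⟩,
      legendreCovector_jetVariation hk hL hD hγ'
        (fun s hs => LocalSection.jetCurve_coord_mem hs.2 k) _ ⟨hs, hs'⟩]
    exact boundaryTerm_eq (isOpen_jetTarget e k) (isOpen_jetTarget e' k)
      (contDiffOn_localLagrangian hL e) (contDiffOn_localLagrangian hL e') hD hγ hγ'
      (fun s hs => LocalSection.jetCurve_coord_mem hs.1 k)
      (fun s hs => LocalSection.jetCurve_coord_mem hs.2 k) (isOpen_transitionDomain e e')
      (contDiffOn_fibreTransition e e') hU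
      (fun ξ hξ s hs => variation_localLagrangian hL hξ hs.1 hs.2) hξ ⟨hs, hs'⟩

theorem coordFrame_eq_coordFrame {y : Jet n π m} (hy : y ∈ (jetChart e m).source)
    (hy' : y ∈ (jetChart e' m).source) (v : Coord n m) :
    coordFrame e y v
      = coordFrame e' y (fderiv ℝ (jetTransition e e' m) (jetChart e m y) v) := by
  have h1 := coordCoframe_coordFrame' e' e hy' hy v
  have h2 : ((jetChart e m).symm.trans (jetChart e' m)) =ᶠ[𝓝 (jetChart e m y)]
      jetTransition e e' m := by
    have h3 : jetChart e m y ∈ ((jetChart e m).symm.trans (jetChart e' m)).source := by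
      refine ⟨(jetChart e m).map_source hy, ?_⟩
      change (jetChart e m).symm (jetChart e m y) ∈ (jetChart e' m).source
      rwa [(jetChart e m).left_inv hy]
    filter_upwards [((jetChart e m).symm.trans (jetChart e' m)).open_source.mem_nhds h3]
      with c hc
    have h4 : (jetChart e m).symm c ∈ (jetChart e m).source := (jetChart e m).map_target hc.1
    have h5 := jetChart_eq_jetTransition h4 hc.2
    rwa [(jetChart e m).right_inv hc.1] at h5
  rw [h2.fderiv_eq] at h1
  exact ((coordFrame_coordCoframe e' hy' (coordFrame e y v)).symm).trans
    (congrArg (coordFrame e' y) h1)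

end Transition

end Legendre

/-! ### The global Legendre–Ostrogradsky maps and the submanifold `W_1` -/

section LegendreMap

variable {n : ℕ} {E : Type*} [TopologicalSpace E]
  [ChartedSpace (EuclideanSpace ℝ (Fin (n + 1))) E] {π : E → ℝ} [IsFibred n π] {m k : ℕ}
  {L : Jet n π k → ℝ}

/-- The extended Legendre–Ostrogradsky map. -/
def legendreMap (L : Jet n π k → ℝ) (y : Jet n π (2 * k - 1)) : Cotangent n π (k - 1) :=
  (cotangentChart (exists_mem_jetChart_source y).choose (k - 1)).symm
    (Coord.trunc (k - 1) (jetChart (exists_mem_jetChart_source y).choose (2 * k - 1) y),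
      legendreCovector (exists_mem_jetChart_source y).choose L
        (jetChart (exists_mem_jetChart_source y).choose (2 * k - 1) y))

theorem cotangentChart_legendreMap_choose (y : Jet n π (2 * k - 1)) :
    cotangentChart (exists_mem_jetChart_source y).choose (k - 1) (legendreMap L y)
      = (Coord.trunc (k - 1) (jetChart (exists_mem_jetChart_source y).choose (2 * k - 1) y),
      legendreCovector (exists_mem_jetChart_source y).choose L
        (jetChart (exists_mem_jetChart_source y).choose (2 * k - 1) y)) ∧
    (legendreMap L y).proj ∈ (jetChart (exists_mem_jetChart_source y).choose (k - 1)).source := by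
  set e := (exists_mem_jetChart_source y).choose
  have hy : y ∈ (jetChart e (2 * k - 1)).source := (exists_mem_jetChart_source y).choose_spec
  have h1 : (Coord.trunc (k - 1) (jetChart e (2 * k - 1) y),
      legendreCovector e L (jetChart e (2 * k - 1) y)) ∈ (cotangentChart e (k - 1)).target :=
    mem_cotangentChart_target.2 (mem_jetTarget_trunc.2 ((jetChart e _).map_source hy))
  exact ⟨(cotangentChart e (k - 1)).right_inv h1,
    mem_cotangentChart_source.1 ((cotangentChart e (k - 1)).map_target h1)⟩

theorem proj_legendreMap (y : Jet n π (2 * k - 1)) :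
    (legendreMap L y).proj = y.proj (k - 1) := by
  obtain ⟨h1, h2⟩ := cotangentChart_legendreMap_choose (L := L) y
  have hy := (exists_mem_jetChart_source y).choose_spec
  refine (jetChart _ (k - 1)).injOn h2 ((proj_mem_source _).2 hy) ?_
  rw [jetChart_proj (by omega) hy]
  exact congrArg Prod.fst h1

theorem proj_legendreMap_mem {e : AdaptedChart n π} {y : Jet n π (2 * k - 1)} :
    (legendreMap L y).proj ∈ (jetChart e (k - 1)).source ↔
      y ∈ (jetChart e (2 * k - 1)).source := by
  rw [proj_legendreMap, proj_mem_source]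

/-- In the chosen chart this holds by construction; `legendreCovector_eq` carries it to every other
chart. Smoothness and the formulas in all adapted charts rest on it. -/
theorem cotangentChart_legendreMap (hk : 1 ≤ k) (hL : ContMDiff 𝓘(ℝ, Coord n k) 𝓘(ℝ, ℝ) ∞ L)
    {e : AdaptedChart n π} {y : Jet n π (2 * k - 1)} (hy : y ∈ (jetChart e (2 * k - 1)).source) :
    cotangentChart e (k - 1) (legendreMap L y)
      = (Coord.trunc (k - 1) (jetChart e (2 * k - 1) y),
        legendreCovector e L (jetChart e (2 * k - 1) y)) := by
  obtain ⟨h1, h2⟩ := cotangentChart_legendreMap_choose (L := L) y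
  have hy' := (exists_mem_jetChart_source y).choose_spec
  set e' := (exists_mem_jetChart_source y).choose
  have h3 : (legendreMap L y).proj ∈ (jetChart e (k - 1)).source := proj_legendreMap_mem.2 hy
  have h4 : jetChart e (k - 1) (legendreMap L y).proj
      = Coord.trunc (k - 1) (jetChart e (2 * k - 1) y) := by
    rw [proj_legendreMap, jetChart_proj (by omega) hy]
  refine Prod.ext h4 (ContinuousLinearMap.ext fun v => ?_)
  have h5 := cotangentChart_snd h2 (fderiv ℝ (jetTransition e e' (k - 1))
    (jetChart e (k - 1) (legendreMap L y).proj) v)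
  rw [h1] at h5
  rw [cotangentChart_snd h3]
  refine (congrArg (legendreMap L y).2 (coordFrame_eq_coordFrame h3 h2 v)).trans (h5.symm.trans ?_)
  rw [h4]
  change legendreCovector e' L (jetCurve (y.rep.sec.coord e') (2 * k - 1) y.rep.time)
    (fderiv ℝ (jetTransition e e' (k - 1)) (Coord.trunc (k - 1)
      (jetCurve (y.rep.sec.coord e) (2 * k - 1) y.rep.time)) v) = _
  rw [trunc_jetCurve _ (by omega)]
  exact (legendreCovector_eq hk hL ⟨y.rep.mem_dom, hy⟩ ⟨y.rep.mem_dom, hy'⟩ v).symm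

theorem contMDiff_legendreMap (hk : 1 ≤ k) (hL : ContMDiff 𝓘(ℝ, Coord n k) 𝓘(ℝ, ℝ) ∞ L) :
    ContMDiff 𝓘(ℝ, Coord n (2 * k - 1)) (cotangentModel n (k - 1)) ∞ (legendreMap L) := by
  intro y
  obtain ⟨e, he⟩ := exists_mem_jetChart_source y
  have h1 : ContDiffOn ℝ ∞ (fun c => (Coord.trunc (k - 1) c, legendreCovector e L c))
      (jetTarget e (2 * k - 1)) :=
    (Coord.contDiff_trunc (k - 1)).contDiffOn.prodMk (contDiffOn_legendreCovector hL e)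
  have h2 : ContMDiffOn 𝓘(ℝ, Coord n (2 * k - 1)) (cotangentModel n (k - 1)) ∞
      (fun y => (cotangentChart e (k - 1)).symm (Coord.trunc (k - 1) (jetChart e (2 * k - 1) y),
        legendreCovector e L (jetChart e (2 * k - 1) y))) (jetChart e (2 * k - 1)).source :=
    (isSmoothChart_cotangentChart e (k - 1)).contMDiffOn_symm.comp
      (h1.contMDiffOn.comp (contMDiffOn_jetChart e _) fun y hy => (jetChart e _).map_source hy)
      fun y hy => mem_cotangentChart_target.2
        (mem_jetTarget_trunc.2 ((jetChart e _).map_source hy))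
  refine ContMDiffOn.contMDiffAt (h2.congr fun y hy => ?_)
    ((jetChart e (2 * k - 1)).open_source.mem_nhds he)
  rw [← cotangentChart_legendreMap hk hL hy, (cotangentChart e (k - 1)).left_inv
    (mem_cotangentChart_source.2 (proj_legendreMap_mem.2 hy))]

theorem Coord.q_trunc {r s : ℕ} (hrs : r ≤ s) (c : Coord n m) (A : Fin n) :
    (Coord.trunc s c).q r A = c.q r A := by
  unfold Coord.q Coord.trunc
  rw [dif_pos (by omega)]
  by_cases h : r < m + 1 <;> simp [h]

theorem isExtendedLegendre_legendreMap (hk : 1 ≤ k)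
    (hL : ContMDiff 𝓘(ℝ, Coord n k) 𝓘(ℝ, ℝ) ∞ L) : IsExtendedLegendre L (legendreMap L) := by
  intro e y hy
  have h1 : (legendreMap L y).proj ∈ (jetChart e (k - 1)).source := proj_legendreMap_mem.2 hy
  have h2 : jetChart e (k - 1) (legendreMap L y).proj
      = Coord.trunc (k - 1) (jetChart e (2 * k - 1) y) := by
    rw [proj_legendreMap, jetChart_proj (by omega) hy]
  refine ⟨h1, by rw [h2]; rfl, fun r hr A => by rw [h2, Coord.q_trunc (by omega)], ?_,
    fun s A => ?_⟩
  · rw [momentumT_eq h1, cotangentChart_legendreMap hk hL hy, legendreCovector_time]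
  · rw [momentumQ_eq h1, cotangentChart_legendreMap hk hL hy, momentaL_legendreCovector]

theorem isRestrictedLegendre_legendreMap (hk : 1 ≤ k)
    (hL : ContMDiff 𝓘(ℝ, Coord n k) 𝓘(ℝ, ℝ) ∞ L) :
    IsRestrictedLegendre L (fun y => quotientMap (legendreMap L y)) := by
  intro e y hy
  obtain ⟨h1, h2, h3, -, h4⟩ := isExtendedLegendre_legendreMap hk hL e y hy
  exact ⟨h1, h2, h3, fun s A => (momentum_mk e h1 _ s A).trans (h4 s A)⟩

/-- The value on the lift is `L`, which gives `W_o`; the top Ostrogradsky sum has the single term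
`∂L/∂q_k`, which gives `W_c`. -/
theorem legendreGraph_subset_constraintSubmanifold (hk : 1 ≤ k)
    (hL : ContMDiff 𝓘(ℝ, Coord n k) 𝓘(ℝ, ℝ) ∞ L) :
    {w : Ambient n π k | w.2 = legendreMap L w.1} ⊆ constraintSubmanifold L := by
  intro w hwL
  have hwJ : w ∈ jetMomentum n π k :=
    (congrArg Bundle.TotalSpace.proj hwL).trans (proj_legendreMap w.1)
  obtain ⟨e, hw⟩ := exists_mem_ambientChart_source hwJ
  have h1 : (ambientChart e k w).2 = (Coord.trunc (k - 1) (ambientChart e k w).1,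
      legendreCovector e L (ambientChart e k w).1) := by
    rw [ambientChart_snd, show w.2 = legendreMap L w.1 from hwL]
    exact cotangentChart_legendreMap hk hL (mem_ambientChart_source.1 hw).1
  refine mem_constraintSubmanifold_of_momenta hk hL hw
    ((mem_hamiltonianSubmanifold_iff hk hw).2 ?_) fun A => ?_
  · rw [h1]
    exact ⟨rfl, legendreCovector_lift hk e L _⟩
  · rw [h1, momentaL_legendreCovector, Fin.val_last,
      ostrogradsky_self (Nat.sub_add_cancel hk)]

/-- All coordinates of `T^*(J^{k-1}π)` are functions of the jet, so the dimension is that of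
`J^{2k-1}π`. -/
theorem isEmbeddedSubmanifold_legendreGraph (hk : 1 ≤ k)
    (hL : ContMDiff 𝓘(ℝ, Coord n k) 𝓘(ℝ, ℝ) ∞ L) :
    IsEmbeddedSubmanifold (ambientModel n k)
      {w : Ambient n π k | w.2 = legendreMap L w.1} (2 * k * n + 1) := by
  refine isEmbeddedSubmanifold_of_forall_exists ?_
    (ContinuousLinearMap.snd ℝ (Coord n (2 * k - 1)) (Coord n (k - 1) × (Coord n (k - 1) →L[ℝ] ℝ)))
    (ContinuousLinearMap.inr ℝ (Coord n (2 * k - 1)) (Coord n (k - 1) × (Coord n (k - 1) →L[ℝ] ℝ)))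
    (fun _ => rfl) fun w hwL => ?_
  · rw [finrank_ambientCoord hk, finrank_coord_prod, finrank_coord_dual, Nat.sub_add_cancel hk]
    ring
  obtain ⟨e, hw⟩ := exists_mem_ambientChart_source
    (legendreGraph_subset_constraintSubmanifold hk hL hwL).1.1
  refine ⟨ambientChart e k, isSmoothChart_ambientChart e k, hw, ambientDomain e k, fun z =>
    (Coord.trunc (k - 1) z.1, legendreCovector e L z.1), isOpen_ambientDomain e k,
    ambientChart_target_subset e k, ?_, ?_, fun y hy => ?_⟩
  · exact ((Coord.contDiff_trunc (k - 1)).comp contDiff_fst).contDiffOn.prodMk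
      ((contDiffOn_legendreCovector hL e).comp contDiffOn_fst fun z hz => hz)
  · rintro z hz f
    have h1 : (z + ContinuousLinearMap.inr ℝ (Coord n (2 * k - 1))
        (Coord n (k - 1) × (Coord n (k - 1) →L[ℝ] ℝ)) f).1 = z.1 := add_zero _
    refine ⟨?_, by simp only [h1]⟩
    change (z + _).1 ∈ jetTarget e (2 * k - 1)
    rw [h1]
    exact hz
  · obtain ⟨hy1, hy2⟩ := mem_ambientChart_source.1 hy
    change y.2 = legendreMap L y.1 ↔ cotangentChart e (k - 1) y.2
      = (Coord.trunc (k - 1) (jetChart e (2 * k - 1) y.1),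
        legendreCovector e L (jetChart e (2 * k - 1) y.1))
    have h1 := cotangentChart_legendreMap hk hL hy1
    rw [← h1]
    exact ((cotangentChart e (k - 1)).injOn.eq_iff (mem_cotangentChart_source.2 hy2)
      (mem_cotangentChart_source.2 (proj_legendreMap_mem.2 hy1))).symm

/-- Both sets are graphs over `J^{2k-1}π`, and the map preserves the jet. -/
theorem bijOn_restrictMomentum (L : Jet n π k → ℝ) :
    BijOn restrictMomentum {w : Ambient n π k | w.2 = legendreMap L w.1}
      {x | x.2 = quotientMap (legendreMap L x.1)} := by
  refine ⟨fun w hw => congrArg quotientMap hw, fun w hw w' hw' h => ?_, fun x hx => ?_⟩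
  · have h1 : w.1 = w'.1 := congrArg
      (fun x : Jet n π (2 * k - 1) × Restricted n π (k - 1) => x.1) h
    have h2 : w.2 = legendreMap L w.1 := hw
    have h3 : w'.2 = legendreMap L w'.1 := hw'
    exact Prod.ext h1 (by rw [h2, h3, h1])
  · exact ⟨(x.1, legendreMap L x.1), rfl, Prod.ext rfl (Eq.symm hx)⟩

end LegendreMap

end SkinnerRusk

end

theorem mainTheorem7 {n k : ℕ} (hk : 1 ≤ k) {E : Type*} [TopologicalSpace E] [T2Space E]
    [SecondCountableTopology E] [ChartedSpace (EuclideanSpace ℝ (Fin (n + 1))) E]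
    [IsManifold (𝓡 (n + 1)) ∞ E] (π : E → ℝ) [IsFibred n π]
    (L : Jet n π k → ℝ) (hL : ContMDiff 𝓘(ℝ, Coord n k) 𝓘(ℝ, ℝ) ∞ L) :
    IsEmbeddedSubmanifold (ambientModel n k) (hamiltonianSubmanifold L) (3 * k * n + 1) ∧
    IsEmbeddedSubmanifold (ambientModel n k) (constraintSubmanifold L) ((3 * k - 1) * n + 1) ∧
    ∃ (W₁ : Set (Ambient n π k)) (FL : Jet n π (2 * k - 1) → Restricted n π (k - 1))
      (FLext : Jet n π (2 * k - 1) → Cotangent n π (k - 1)),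
      W₁ ⊆ constraintSubmanifold L ∧
      IsEmbeddedSubmanifold (ambientModel n k) W₁ (2 * k * n + 1) ∧
      ContMDiff 𝓘(ℝ, Coord n (2 * k - 1)) (restrictedModel n (k - 1)) ∞ FL ∧
      IsRestrictedLegendre L FL ∧
      BijOn restrictMomentum W₁ {x | x.2 = FL x.1} ∧
      ContMDiff 𝓘(ℝ, Coord n (2 * k - 1)) (cotangentModel n (k - 1)) ∞ FLext ∧
      IsExtendedLegendre L FLext ∧
      W₁ = {w | w.2 = FLext w.1} := by
  exact ⟨isEmbeddedSubmanifold_hamiltonianSubmanifold hk hL,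
    isEmbeddedSubmanifold_constraintSubmanifold hk hL,
    {w | w.2 = legendreMap L w.1}, fun y => quotientMap (legendreMap L y), legendreMap L,
    legendreGraph_subset_constraintSubmanifold hk hL,
    isEmbeddedSubmanifold_legendreGraph hk hL,
    contMDiff_quotientMap.comp (contMDiff_legendreMap hk hL),
    isRestrictedLegendre_legendreMap hk hL, bijOn_restrictMomentum L,
    contMDiff_legendreMap hk hL, isExtendedLegendre_legendreMap hk hL, rfl⟩
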